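/- Let $\Omega\subseteq\mathbb{R}^n$ be a non-empty open convex set, $T_\Omega=\mathbb{R}^n+i\Omega\subseteq\mathbb{C}^n$, and let $F=(f_1,\dots,f_m)\in HAP(T_\Omega,\mathbb{C}^m)$, i.e. $F:T_\Omega\to\mathbb{C}^m$ is holomorphic and for every $\varepsilon>0$ and every $\Omega'\Subset\Omega$ (that is, $\overline{\Omega'}$ is compact and contained in $\Omega$) there are $t_1,\dots,t_n>0$ such that for every $\xi\in\mathbb{R}^n$ there is $\tau\in\mathbb{R}^n$ with $|\tau_k-\xi_k|<t_k$ for all $k$ and $\sup_{z\in T_{\Omega'}}\max_\ell|f_\ell(z+\tau)-f_\ell(z)|<\varepsilon$. For $z\in\mathbb{C}^n$ and $\lambda\in\mathbb{R}^n$ put $\langle z,\lambda\rangle=\sum_k z_k\lambda_k$. For a (holomorphic almost periodic) function $f$ on $T_\Omega$ let $$a(\lambda,f)=\lim_{s\to+\infty}\frac1{(2s)^n}\int_{|x_k|<s,\ 1\le k\le n}e^{-i\langle x+iy,\lambda\rangle}f(x+iy)\,dx$$ (which does not depend on $y\in\Omega$), and $\operatorname{Sp}f=\{\lambda\in\mathbb{R}^n: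 a(\lambda,f)\neq0\}$. Let $L_F$ be the $\mathbb{Q}$-linear subspace of $\mathbb{R}^n$ generated by $\bigcup_\ell\operatorname{Sp}f_\ell$. Given a basis $(\omega_r)_{r\in I}$ of $L_F$, indexed by a set $I\subseteq\mathbb{N}=\{0,1,2,\dots\}$, let $I_j=\{r\in I: r<j\}$ and let $Q_j(F)=(Q_j(f_1),\dots,Q_j(f_m))$, $j\in\mathbb{N}$, be the Bochner-Fejér sums $$Q_j(f_\ell)(z)=\sum_{\nu}\ \prod_{r\in I_j}\Bigl(1-\frac{|\nu_r|}{(j!)^2}\Bigr)\,a(\lambda_\nu,f_\ell)\,e^{i\langle z,\lambda_\nu\rangle},\qquad \lambda_\nu=\sum_{r\in I_j}\nu_r\,\frac{\omega_r}{j!},$$ where $\nu$ runs over the tuples $(\nu_r)_{r\in I_j}$ of integers with $|\nu_r|\le(j!)^2$. For a subgroup $\mathbb{G}\subseteq\mathbb{R}^n$ let $\operatorname{Ch}\mathbb{G}$ be the set of all (not necessarily continuous) group homomorphisms $\chi:\mathbb{G}\to\mathbb{S}^1$. If $f$ is an exponential sum with $\operatorname{Sp}f\subseteq\mathbb{G}$,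 put $f_\chi(z)=\sum_{\lambda\in\operatorname{Sp}f}a(\lambda,f)\chi(\lambda)e^{i\langle z,\lambda\rangle}$, and for a mapping whose components are such sums perturb each component. If $\mathbb{G}$ contains $\operatorname{Sp}f_\ell$ for all $\ell$, the perturbed mapping of $F$ by $\chi\in\operatorname{Ch}\mathbb{G}$ is $$F_\chi=\lim_{j\to\infty}Q_j(F)_\chi,$$ for some choice of the basis, the limit being uniform on $T_{\Omega'}$ for every $\Omega'\Subset\Omega$. Write $V(G)$ for the set of zeros in $T_\Omega$ of a mapping $G$. The $\mathcal{Y}$-amoeba of $F$ is $\mathcal{Y}_F=\bigcup_{\chi\in\operatorname{Ch}\mathbb{G}}\operatorname{Im}V(F_\chi)$. **Theorem 4.1.** Let $F\in HAP(T_\Omega,\mathbb{C}^m)$ and let $\mathbb{G}$ be any subgroup of $\mathbb{R}^n$ containing the spectra of the components of $F$. Then the perturbed mappings are well defined (a basis of $L_F$ indexed by a subset of $\mathbb{N}$ exists and, for every $\chi\in\operatorname{Ch}\mathbb{G}$, the limit $F_\chi$ exists, belongs to $HAP(T_\Omega,\mathbb{C}^m)$ and is the same for every such basis), $\mathcal{Y}_F$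 is a (relatively) closed subset of $\Omega$, and $$i\mathcal{Y}_F=i\Omega\cap\bigcup_{\chi\in\operatorname{Ch}\mathbb{R}^n}V(F_\chi).$$ -/

import Mathlib

open Filter Topology MeasureTheory
open scoped Nat

noncomputable section

namespace HAP

/-- The bilinear pairing `⟨z, lam⟩ = ∑ k, z_k lam_k` for `z ∈ ℂⁿ` and `lam ∈ ℝⁿ`. -/
def pairing {n : ℕ} (z : Fin n → ℂ) (lam : Fin n → ℝ) : ℂ :=
  ∑ k, z k * (lam k : ℂ)

/-- The point `x + i y` of `ℂⁿ`, for `x, y ∈ ℝⁿ`. -/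
def cpoint {n : ℕ} (x y : Fin n → ℝ) : Fin n → ℂ :=
  fun k => (x k : ℂ) + Complex.I * (y k : ℂ)

/-- The projection `Im : ℂⁿ → ℝⁿ`. -/
def imPart {n : ℕ} (z : Fin n → ℂ) : Fin n → ℝ :=
  fun k => (z k).im

/-- The tube `T_Ω = ℝⁿ + iΩ`. -/
def tube {n : ℕ} (Ω : Set (Fin n → ℝ)) : Set (Fin n → ℂ) :=
  {z | imPart z ∈ Ω}

/-- `Ω' ⋐ Ω`: the closure of `Ω'` is compact and contained in `Ω`. -/
def RelCompactIn {n : ℕ} (Ω' Ω : Set (Fin n → ℝ)) : Prop :=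
  IsCompact (closure Ω') ∧ closure Ω' ⊆ Ω

/-- `F ∈ HAP(T_Ω, ℂ^m)`: `F` is holomorphic and almost periodic in the tube `T_Ω`. The norm of
`Fin m → ℂ` is the maximum of the moduli of the components. Only the values of `F` on the tube
matter. -/
structure IsHAP {n m : ℕ} (Ω : Set (Fin n → ℝ)) (F : (Fin n → ℂ) → (Fin m → ℂ)) : Prop where
  holomorphic : DifferentiableOn ℂ F (tube Ω)
  almostPeriodic : ∀ ε : ℝ, 0 < ε → ∀ Ω' : Set (Fin n → ℝ), RelCompactIn Ω' Ω →
    ∃ t : Fin n → ℝ, (∀ l, 0 < t l) ∧ ∀ ξ : Fin n → ℝ, ∃ τ : Fin n → ℝ,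
      (∀ l, |τ l - ξ l| < t l) ∧
      ∀ z ∈ tube Ω', ‖F (fun k => z k + (τ k : ℂ)) - F z‖ < ε

/-- Convergence of a sequence of mappings in the topology `τ(T_Ω)`, i.e. uniformly on every
subtube `T_Ω'` with `Ω' ⋐ Ω`. -/
def TendstoTube {n m : ℕ} (Ω : Set (Fin n → ℝ)) (G : ℕ → (Fin n → ℂ) → (Fin m → ℂ))
    (H : (Fin n → ℂ) → (Fin m → ℂ)) : Prop :=
  ∀ Ω' : Set (Fin n → ℝ), RelCompactIn Ω' Ω → TendstoUniformlyOn G H atTop (tube Ω')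

/-- The mean over the cube `|x_j| < s` of `e^{-i⟨x+iy, lam⟩} f(x+iy)`. -/
def bohrMean {n : ℕ} (f : (Fin n → ℂ) → ℂ) (lam y : Fin n → ℝ) (s : ℝ) : ℂ :=
  ((2 * s : ℝ) ^ n : ℂ)⁻¹ *
    ∫ x in {x : Fin n → ℝ | ∀ j, |x j| < s},
      Complex.exp (-Complex.I * pairing (cpoint x y) lam) * f (cpoint x y)

/-- The Bohr transform `a(lam, f)`: the limit of the means as `s → +∞`, which for a holomorphic
almost periodic `f` exists and does not depend on the choice of `y ∈ Ω`. -/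
def bohr {n : ℕ} (Ω : Set (Fin n → ℝ)) (f : (Fin n → ℂ) → ℂ) (lam : Fin n → ℝ) : ℂ :=
  Classical.epsilon fun c : ℂ => ∀ y ∈ Ω, Tendsto (bohrMean f lam y) atTop (𝓝 c)

/-- The spectrum of `f`. -/
def spec {n : ℕ} (Ω : Set (Fin n → ℝ)) (f : (Fin n → ℂ) → ℂ) : Set (Fin n → ℝ) :=
  {lam | bohr Ω f lam ≠ 0}

/-- The union of the spectra of the components of `F`. -/
def specUnion {n m : ℕ} (Ω : Set (Fin n → ℝ)) (F : (Fin n → ℂ) → (Fin m → ℂ)) :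
    Set (Fin n → ℝ) :=
  ⋃ l : Fin m, spec Ω (fun z => F z l)

/-- The `ℤ`-module `Ξ_F` of `F`. -/
def zModule {n m : ℕ} (Ω : Set (Fin n → ℝ)) (F : (Fin n → ℂ) → (Fin m → ℂ)) :
    AddSubgroup (Fin n → ℝ) :=
  AddSubgroup.closure (specUnion Ω F)

/-- The `ℚ`-module `lin_ℚ Ξ_F` of `F`. -/
def qModule {n m : ℕ} (Ω : Set (Fin n → ℝ)) (F : (Fin n → ℂ) → (Fin m → ℂ)) :
    Submodule ℚ (Fin n → ℝ) :=
  Submodule.span ℚ (zModule Ω F : Set (Fin n → ℝ))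

/-- `(ω_r)_{r ∈ I}` is a basis of the rational vector space `lin_ℚ Ξ_F`. It is indexed by a set
`I` of natural numbers, since this space may have finite or countably infinite dimension. -/
def IsQBasis {n m : ℕ} (Ω : Set (Fin n → ℝ)) (F : (Fin n → ℂ) → (Fin m → ℂ))
    (I : Set ℕ) (ω : ℕ → Fin n → ℝ) : Prop :=
  LinearIndepOn ℚ ω I ∧ Submodule.span ℚ (ω '' I) = qModule Ω F

open Classical in
/-- The (finite) set of those among the first `j` indices that lie in `I`. -/
def firstIdx (I : Set ℕ) (j : ℕ) : Finset ℕ :=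
  (Finset.range j).filter (· ∈ I)

/-- The frequency `∑_r ν_r (ω_r / j!)`. -/
def freq {n : ℕ} (I : Set ℕ) (ω : ℕ → Fin n → ℝ) (j : ℕ) (ν : firstIdx I j → ℤ) : Fin n → ℝ :=
  ∑ r, ((ν r : ℝ) / (j ! : ℝ)) • ω r

/-- The `j`-th Bochner-Fejer sum `Q_j(f)` of a scalar function `f`; the sum extends over the tuples
of integers `ν_r` with `|ν_r| ≤ (j!)²`. -/
def bochnerFejer {n : ℕ} (Ω : Set (Fin n → ℝ)) (I : Set ℕ) (ω : ℕ → Fin n → ℝ) (j : ℕ)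
    (f : (Fin n → ℂ) → ℂ) (z : Fin n → ℂ) : ℂ :=
  ∑ ν ∈ Fintype.piFinset
      (fun _ : firstIdx I j => Finset.Icc (-((j ! : ℤ) ^ 2)) ((j ! : ℤ) ^ 2)),
    (∏ r, (1 - |(ν r : ℝ)| / (j ! : ℝ) ^ 2 : ℝ) : ℂ) * bohr Ω f (freq I ω j ν) *
      Complex.exp (Complex.I * pairing z (freq I ω j ν))

open Classical in
/-- The value `χ(lam)` of a character (an arbitrary homomorphism into the unit circle, with no
continuity assumption) of a subgroup `𝔾` of `ℝⁿ` at a point of `𝔾`; it is extended by zero, but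
it is only used at points of `𝔾`. -/
def charVal {n : ℕ} {𝔾 : AddSubgroup (Fin n → ℝ)} (χ : AddChar 𝔾 Circle) (lam : Fin n → ℝ) : ℂ :=
  if h : lam ∈ 𝔾 then (χ ⟨lam, h⟩ : ℂ) else 0

/-- The perturbation by `χ` of an exponential sum `f`:
`f_χ(z) = ∑_{lam ∈ Sp f} a(lam, f) χ(lam) e^{i⟨z, lam⟩}`. The spectrum of an exponential sum is
finite. -/
def expPerturb {n : ℕ} (Ω : Set (Fin n → ℝ)) {𝔾 : AddSubgroup (Fin n → ℝ)}
    (χ : AddChar 𝔾 Circle) (f : (Fin n → ℂ) → ℂ) (z : Fin n → ℂ) : ℂ :=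
  ∑ᶠ lam ∈ spec Ω f, bohr Ω f lam * charVal χ lam * Complex.exp (Complex.I * pairing z lam)

/-- The perturbed Bochner-Fejer mapping `Q_j(F)_χ`. -/
def perturbedSum {n m : ℕ} (Ω : Set (Fin n → ℝ)) (F : (Fin n → ℂ) → (Fin m → ℂ))
    {𝔾 : AddSubgroup (Fin n → ℝ)} (χ : AddChar 𝔾 Circle) (I : Set ℕ) (ω : ℕ → Fin n → ℝ)
    (j : ℕ) : (Fin n → ℂ) → (Fin m → ℂ) :=
  fun z l => expPerturb Ω χ (bochnerFejer Ω I ω j (fun w => F w l)) z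

/-- The perturbed mapping `F_χ`: the limit of `Q_j(F)_χ` in the topology `τ(T_Ω)`, for some choice
of a basis of `lin_ℚ Ξ_F`. It is determined on the tube `T_Ω` only. -/
def perturb {n m : ℕ} (Ω : Set (Fin n → ℝ)) (F : (Fin n → ℂ) → (Fin m → ℂ))
    {𝔾 : AddSubgroup (Fin n → ℝ)} (χ : AddChar 𝔾 Circle) : (Fin n → ℂ) → (Fin m → ℂ) :=
  Classical.epsilon fun G : (Fin n → ℂ) → (Fin m → ℂ) =>
    ∃ (I : Set ℕ) (ω : ℕ → Fin n → ℝ), IsQBasis Ω F I ω ∧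
      TendstoTube Ω (perturbedSum Ω F χ I ω) G

/-- The zero set `V(G)` of a mapping `G` on the tube `T_Ω`. -/
def zeroSet {n m : ℕ} (Ω : Set (Fin n → ℝ)) (G : (Fin n → ℂ) → (Fin m → ℂ)) :
    Set (Fin n → ℂ) :=
  {z | z ∈ tube Ω ∧ G z = 0}

/-- The `𝒴`-amoeba of `F`, computed with the characters of the group `𝔾`. -/
def yAmoeba {n m : ℕ} (Ω : Set (Fin n → ℝ)) (F : (Fin n → ℂ) → (Fin m → ℂ))
    (𝔾 : AddSubgroup (Fin n → ℝ)) : Set (Fin n → ℝ) :=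
  ⋃ χ : AddChar 𝔾 Circle, imPart '' zeroSet Ω (perturb Ω F χ)

/-- Multiplication by `i`, from `ℝⁿ` to `ℂⁿ`. -/
def mulI {n : ℕ} (y : Fin n → ℝ) : Fin n → ℂ :=
  fun k => Complex.I * (y k : ℂ)

end HAP

end

/-! On a fibre `y` of the tube, a perturbed Bochner-Fejér sum is the mean of the translates of the
slice against a kernel (`bfSum_eq_mean`). Perturbing this kernel by `χ` only evaluates the Fejér
kernel at another character of `ℝⁿ`, so it stays non-negative with mean one (`kernel_nonneg`,
`mean_bfKernel`), and the sums are contractions for the supremum norm whatever `χ` is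
(`norm_bfSum_le`). Applied to an exponential sum with `j → ∞`, this shows that perturbation never
increases a supremum (`norm_sum_perturb_le`). Hence the distance between two unperturbed
Bochner-Fejér sums, even for different bases, bounds the distance between the perturbed ones
uniformly in `χ`. Since the unperturbed sums converge, the perturbed ones are Cauchy, with a limit
independent of the basis.

Convergence of the unperturbed sums rests on a quantitative uniqueness theorem,
`BohrAP.exists_coef_bound`: within a family of functions whose translates are controlled by those of
a fixed almost periodic function, small Fourier-Bohr coefficients force a small supremum. By
Plancherel on cubes, small coefficients make the correlation function small in mean square
(`meanSq_corr_le`); a finite net of translates turns this into uniform smallness (`norm_le_of_net`);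
the value at `0` of the correlation is the mean square of the function, and the net argument applies
once more. Cauchy's theorem on long rectangles (`mean_slice_eq`) links the coefficients of different
fibres, and compactness makes the convergence uniform on compact subsets of `Ω`.

For the amoeba, characters of `𝔾` extend to `ℝⁿ` because the circle is divisible, and a real
translation by `x` has the same effect as multiplying `χ` by `lam ↦ e^{i⟨x, lam⟩}`
(`pert_mul_evChar`). So every zero can be moved to the point `iy`, and `y` lies in the amoeba
exactly when `F_χ(iy) = 0` for some `χ` (`IsHAP.mem_yAmoeba_iff`). This gives the last identity. It
also gives closedness: `F_χ(iy)` is jointly continuous in `(χ, y)`, the characters form a compact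
space, and projection along a compact factor is a closed map. -/

noncomputable section

namespace HAP

/-! ### Exponentials on `ℝⁿ` -/

/-- The exponential `x ↦ e^{i⟨x, lam⟩}` on `ℝⁿ`. -/
def ex {n : ℕ} (lam x : Fin n → ℝ) : ℂ :=
  Complex.exp (Complex.I * ((dotProduct x lam : ℝ) : ℂ))

section ex

variable {n : ℕ} (lam mu x y : Fin n → ℝ)

@[simp] lemma ex_zero_left : ex 0 x = 1 := by simp [ex]

@[simp] lemma ex_zero_right : ex lam 0 = 1 := by simp [ex]

lemma ex_add_right : ex lam (x + y) = ex lam x * ex lam y := by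
  simp [ex, add_dotProduct, mul_add, Complex.exp_add]

lemma ex_add_left : ex (lam + mu) x = ex lam x * ex mu x := by
  simp [ex, dotProduct_add, mul_add, Complex.exp_add]

@[simp] lemma norm_ex : ‖ex lam x‖ = 1 := by
  rw [ex, mul_comm, Complex.norm_exp_ofReal_mul_I]

lemma ex_mul_neg_self : ex lam x * ex (-lam) x = 1 := by
  rw [← ex_add_left]; simp

lemma ex_neg_right : ex lam (-x) = ex (-lam) x := by
  simp [ex]

lemma conj_ex : (starRingEnd ℂ) (ex lam x) = ex (-lam) x := by
  rw [ex, ← Complex.exp_conj, ex]; simp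

lemma continuous_ex : Continuous (ex lam) := by
  unfold ex dotProduct; fun_prop

lemma norm_ex_add_sub (s t : Fin n → ℝ) :
    ‖ex lam (x + t) - ex lam (x + s)‖ = ‖ex lam t - ex lam s‖ := by
  rw [ex_add_right, ex_add_right, ← mul_sub, norm_mul, norm_ex, one_mul]

end ex

/-! ### Bohr almost periodic functions on `ℝⁿ` -/

/-- Bohr almost periodic functions on `ℝⁿ`, described by Bochner's criterion: uniformly continuous
functions whose translates form a totally bounded set. -/
structure BohrAP {n : ℕ} (f : (Fin n → ℝ) → ℂ) : Prop where
  uc : ∀ ε : ℝ, 0 < ε → ∃ δ : ℝ, 0 < δ ∧ ∀ u : Fin n → ℝ, ‖u‖ < δ → ∀ x, ‖f (x + u) - f x‖ ≤ ε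
  net : ∀ ε : ℝ, 0 < ε → ∃ S : Finset (Fin n → ℝ), ∀ t, ∃ s ∈ S, ∀ x, ‖f (x + t) - f (x + s)‖ ≤ ε

/-- The translates of `g` vary at most `C` times as much as those of `f`. -/
def Dominated {n : ℕ} (C : ℝ) (f g : (Fin n → ℝ) → ℂ) : Prop :=
  ∀ (s t : Fin n → ℝ) (δ : ℝ), (∀ x, ‖f (x + t) - f (x + s)‖ ≤ δ) →
    ∀ x, ‖g (x + t) - g (x + s)‖ ≤ C * δ

namespace BohrAP

variable {n : ℕ} {f g : (Fin n → ℝ) → ℂ}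

lemma continuous (hf : BohrAP f) : Continuous f := by
  rw [Metric.continuous_iff]
  intro x ε hε
  obtain ⟨δ, hδ, h⟩ := hf.uc (ε / 2) (half_pos hε)
  refine ⟨δ, hδ, fun y hy => ?_⟩
  have := h (y - x) (by rwa [dist_eq_norm] at hy) x
  rw [add_sub_cancel] at this
  rw [dist_eq_norm]; linarith

lemma exists_bound (hf : BohrAP f) : ∃ C : ℝ, 0 ≤ C ∧ ∀ x, ‖f x‖ ≤ C := by
  obtain ⟨S, hS⟩ := hf.net 1 one_pos
  refine ⟨∑ s ∈ S, ‖f s‖ + 1, by positivity, fun t => ?_⟩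
  obtain ⟨s, hs, h⟩ := hS t
  have h1 := h 0
  rw [zero_add, zero_add] at h1
  have h2 : ‖f s‖ ≤ ∑ s ∈ S, ‖f s‖ :=
    Finset.single_le_sum (f := fun s => ‖f s‖) (fun _ _ => norm_nonneg _) hs
  have h3 := norm_le_norm_add_norm_sub' (f t) (f s)
  linarith

/-- A net for `f` and a net for `g` need not share points. Classify each `t` by its pair of net
points and keep one representative per class: two members of a class are within `ε / 2 + ε / 2` for
both functions. -/
lemma common_net (hf : BohrAP f) (hg : BohrAP g) {ε : ℝ} (hε : 0 < ε) :
    ∃ S : Finset (Fin n → ℝ), ∀ t, ∃ s ∈ S, (∀ x, ‖f (x + t) - f (x + s)‖ ≤ ε) ∧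
      ∀ x, ‖g (x + t) - g (x + s)‖ ≤ ε := by
  classical
  obtain ⟨S, hS⟩ := hf.net (ε / 2) (half_pos hε)
  obtain ⟨T, hT⟩ := hg.net (ε / 2) (half_pos hε)
  choose a ha ha' using hS
  choose b hb hb' using hT
  let cl : (Fin n → ℝ) → (Fin n → ℝ) × (Fin n → ℝ) := fun t => (a t, b t)
  refine ⟨(S ×ˢ T).image (Function.invFun cl), fun t => ⟨Function.invFun cl (cl t), ?_, ?_⟩⟩
  · exact Finset.mem_image_of_mem _ (Finset.mk_mem_product (ha t) (hb t))
  have hcl : cl (Function.invFun cl (cl t)) = cl t := Function.invFun_eq ⟨t, rfl⟩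
  set s := Function.invFun cl (cl t)
  have h1 : a s = a t := congrArg Prod.fst hcl
  have h2 : b s = b t := congrArg Prod.snd hcl
  constructor
  · intro x
    have := norm_sub_le_norm_sub_add_norm_sub (f (x + t)) (f (x + a t)) (f (x + s))
    have h3 := ha' t x
    have h4 := ha' s x
    rw [h1, norm_sub_rev] at h4
    linarith
  · intro x
    have := norm_sub_le_norm_sub_add_norm_sub (g (x + t)) (g (x + b t)) (g (x + s))
    have h3 := hb' t x
    have h4 := hb' s x
    rw [h2, norm_sub_rev] at h4
    linarith

/-- Almost periodicity of a function whose translates are controlled by those of two almost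
periodic functions. -/
lemma of_dominated₂ (hf : BohrAP f) (hg : BohrAP g) {k : (Fin n → ℝ) → ℂ} {C : ℝ}
    (h : ∀ (s t : Fin n → ℝ) (δ : ℝ), (∀ x, ‖f (x + t) - f (x + s)‖ ≤ δ) →
      (∀ x, ‖g (x + t) - g (x + s)‖ ≤ δ) → ∀ x, ‖k (x + t) - k (x + s)‖ ≤ C * δ) : BohrAP k := by
  -- The sign of `C` is unknown, hence the denominator `|C| + 1`.
  have key : ∀ ε : ℝ, 0 < ε → ∃ δ : ℝ, 0 < δ ∧ C * δ ≤ ε := fun ε hε => by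
    refine ⟨ε / (|C| + 1), by positivity, ?_⟩
    rw [mul_div_assoc', div_le_iff₀ (by positivity)]
    nlinarith [le_abs_self C, abs_nonneg C]
  constructor
  · intro ε hε
    obtain ⟨η, hη, hC⟩ := key ε hε
    obtain ⟨δ, hδ, hu⟩ := hf.uc η hη
    obtain ⟨δ', hδ', hu'⟩ := hg.uc η hη
    refine ⟨min δ δ', lt_min hδ hδ', fun u hlt x => ?_⟩
    have := h 0 u η (fun x => by simpa using hu u (hlt.trans_le (min_le_left _ _)) x)
      (fun x => by simpa using hu' u (hlt.trans_le (min_le_right _ _)) x) x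
    rw [add_zero] at this
    exact this.trans hC
  · intro ε hε
    obtain ⟨η, hη, hC⟩ := key ε hε
    obtain ⟨S, hS⟩ := hf.common_net hg hη
    refine ⟨S, fun t => ?_⟩
    obtain ⟨s, hs, h', h''⟩ := hS t
    exact ⟨s, hs, fun x => (h s t η h' h'' x).trans hC⟩

lemma of_dominated (hf : BohrAP f) {C : ℝ} (h : Dominated C f g) : BohrAP g :=
  of_dominated₂ hf hf fun s t δ h1 _ => h s t δ h1

lemma add (hf : BohrAP f) (hg : BohrAP g) : BohrAP (fun x => f x + g x) := by
  refine of_dominated₂ hf hg (C := 2) fun s t δ h1 h2 x => ?_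
  have := norm_add_le (f (x + t) - f (x + s)) (g (x + t) - g (x + s))
  rw [show f (x + t) + g (x + t) - (f (x + s) + g (x + s))
    = f (x + t) - f (x + s) + (g (x + t) - g (x + s)) by ring]
  linarith [h1 x, h2 x]

lemma mul (hf : BohrAP f) (hg : BohrAP g) : BohrAP (fun x => f x * g x) := by
  obtain ⟨A, hA, hfA⟩ := hf.exists_bound
  obtain ⟨B, hB, hgB⟩ := hg.exists_bound
  refine of_dominated₂ hf hg (C := A + B) fun s t δ h1 h2 x => ?_
  rw [show f (x + t) * g (x + t) - f (x + s) * g (x + s)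
    = f (x + t) * (g (x + t) - g (x + s)) + (f (x + t) - f (x + s)) * g (x + s) by ring]
  refine (norm_add_le _ _).trans ?_
  rw [norm_mul, norm_mul, add_mul]
  have h0 : 0 ≤ δ := (norm_nonneg _).trans (h1 x)
  have := mul_le_mul (hfA (x + t)) (h2 x) (norm_nonneg _) hA
  have := mul_le_mul (h1 x) (hgB (x + s)) (norm_nonneg _) h0
  linarith

lemma conj (hf : BohrAP f) : BohrAP (fun x => (starRingEnd ℂ) (f x)) := by
  refine of_dominated hf (C := 1) fun s t δ h x => ?_
  rw [← map_sub, RCLike.norm_conj, one_mul]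
  exact h x

lemma translate (hf : BohrAP f) (u : Fin n → ℝ) : BohrAP (fun x => f (x + u)) := by
  refine of_dominated hf (C := 1) fun s t δ h x => ?_
  rw [add_right_comm, add_right_comm x s, one_mul]
  exact h _

lemma const (c : ℂ) : BohrAP (fun _ : Fin n → ℝ => c) :=
  ⟨fun ε hε => ⟨1, one_pos, fun _ _ _ => by simpa using hε.le⟩,
    fun ε hε => ⟨{0}, fun _ => ⟨0, by simp, fun _ => by simpa using hε.le⟩⟩⟩

lemma const_mul (hf : BohrAP f) (c : ℂ) : BohrAP (fun x => c * f x) := (const c).mul hf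

lemma sub (hf : BohrAP f) (hg : BohrAP g) : BohrAP (fun x => f x - g x) := by
  simpa [sub_eq_add_neg] using hf.add (hg.const_mul (-1))

/-- Translates by `s` and `t` are at the constant distance `‖ex lam t - ex lam s‖`, so total
boundedness is inherited from the unit disc. -/
lemma ex (lam : Fin n → ℝ) : BohrAP (HAP.ex lam) := by
  constructor
  · intro ε hε
    have hc : ContinuousAt (HAP.ex lam) 0 := (continuous_ex lam).continuousAt
    obtain ⟨δ, hδ, h⟩ := Metric.continuousAt_iff.1 hc ε hε
    refine ⟨δ, hδ, fun u hu x => ?_⟩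
    have h1 := h (by simpa using hu)
    have h2 := norm_ex_add_sub lam x 0 u
    rw [add_zero] at h2
    rw [h2, ← dist_eq_norm]
    exact h1.le
  · intro ε hε
    have htb : TotallyBounded (Set.range (HAP.ex lam)) :=
      (isCompact_closedBall (0 : ℂ) 1).totallyBounded.subset (by
        rintro _ ⟨x, rfl⟩; simp)
    obtain ⟨T, hT, hTf, hcov⟩ := Metric.finite_approx_of_totallyBounded htb ε hε
    refine ⟨hTf.toFinset.image (Function.invFun (HAP.ex lam)), fun t => ?_⟩
    obtain ⟨c, hcT, hc⟩ := Set.mem_iUnion₂.1 (hcov ⟨t, rfl⟩)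
    refine ⟨Function.invFun (HAP.ex lam) c,
      Finset.mem_image_of_mem _ (hTf.mem_toFinset.2 hcT), fun x => ?_⟩
    rw [norm_ex_add_sub, Function.invFun_eq (hT hcT), ← dist_eq_norm]
    exact (Metric.mem_ball.1 hc).le

lemma sum {ι : Type*} {F : ι → (Fin n → ℝ) → ℂ} (S : Finset ι) (h : ∀ i ∈ S, BohrAP (F i)) :
    BohrAP (fun x => ∑ i ∈ S, F i x) := by
  classical
  induction S using Finset.induction_on with
  | empty => simpa using const 0
  | insert a S ha ih =>
    simp only [Finset.sum_insert ha]
    exact (h a (Finset.mem_insert_self _ _)).add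
      (ih fun i hi => h i (Finset.mem_insert_of_mem hi))

end BohrAP

/-! ### Averages over cubes (balls of the supremum norm) -/

/-- The normalised Lebesgue measure of the cube `|x_k| < s`. -/
def cubeProb (n : ℕ) (s : ℝ) : Measure (Fin n → ℝ) :=
  ProbabilityTheory.cond volume (Metric.ball 0 s)

section cube

variable {n : ℕ} {s : ℝ} {f : (Fin n → ℝ) → ℂ} {C : ℝ}

instance : IsZeroOrProbabilityMeasure (cubeProb n s) := by unfold cubeProb; infer_instance

lemma isProbabilityMeasure_cubeProb (hs : 0 < s) : IsProbabilityMeasure (cubeProb n s) := by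
  refine ProbabilityTheory.cond_isProbabilityMeasure_of_finite ?_ ?_
  · exact (Metric.measure_ball_pos _ _ hs).ne'
  · exact measure_ball_lt_top.ne

lemma volume_real_ball (hs : 0 < s) (a : Fin n → ℝ) :
    volume.real (Metric.ball a s) = (2 * s) ^ n := by
  rw [measureReal_def, Real.volume_pi_ball _ hs, Fintype.card_fin, ENNReal.toReal_ofReal]
  positivity

lemma integral_cubeProb {E : Type*} [NormedAddCommGroup E] [NormedSpace ℝ E] (hs : 0 < s)
    (f : (Fin n → ℝ) → E) :
    ∫ x, f x ∂cubeProb n s = ((2 * s) ^ n)⁻¹ • ∫ x in Metric.ball 0 s, f x := by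
  rw [cubeProb, ProbabilityTheory.cond, integral_smul_measure, ENNReal.toReal_inv,
    ← measureReal_def, volume_real_ball hs]

lemma integrable_cubeProb (hf : Continuous f) (hC : ∀ x, ‖f x‖ ≤ C) :
    Integrable f (cubeProb n s) :=
  Integrable.of_bound hf.aestronglyMeasurable C (Eventually.of_forall hC)

lemma norm_integral_cubeProb_le (hC0 : 0 ≤ C) (hC : ∀ x, ‖f x‖ ≤ C) :
    ‖∫ x, f x ∂cubeProb n s‖ ≤ C := by
  refine (norm_integral_le_of_norm_le_const (Eventually.of_forall hC)).trans ?_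
  exact mul_le_of_le_one_right hC0 measureReal_le_one

lemma norm_setIntegral_sub_le {A B : Set (Fin n → ℝ)} (hAB : A ⊆ B) (hA : MeasurableSet A)
    (hB : volume B ≠ ⊤) (hf : Continuous f) (hC : ∀ x, ‖f x‖ ≤ C) :
    ‖(∫ x in B, f x) - ∫ x in A, f x‖ ≤ C * (volume.real B - volume.real A) := by
  have hI : IntegrableOn f B :=
    Measure.integrableOn_of_bounded hB hf.aestronglyMeasurable
      (Eventually.of_forall hC)
  rw [← setIntegral_sdiff hA hI hAB, ← measureReal_sdiff hAB hA hB]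
  exact norm_setIntegral_le_of_norm_le_const
    ((measure_mono Set.sdiff_subset).trans_lt hB.lt_top) fun x _ => hC x

/-- The cube and its translate both lie in the cube of radius `s + ‖u‖`; each misses only the
difference of volumes, which accounts for the factor `2`. -/
lemma norm_integral_translate_sub_le (hs : 0 < s) (hf : Continuous f) (hC : ∀ x, ‖f x‖ ≤ C)
    (u : Fin n → ℝ) :
    ‖(∫ x, f (x + u) ∂cubeProb n s) - ∫ x, f x ∂cubeProb n s‖ ≤
      2 * C * ((1 + ‖u‖ / s) ^ n - 1) := by
  have h1 : ∫ x in Metric.ball 0 s, f (x + u) = ∫ x in Metric.ball u s, f x := by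
    have h := (measurePreserving_add_right volume u).setIntegral_preimage_emb
      (measurableEmbedding_addRight u) f (Metric.ball u s)
    have hpre : (fun x => x + u) ⁻¹' Metric.ball u s = Metric.ball 0 s := by
      ext x; simp [dist_eq_norm]
    rwa [hpre] at h
  have hpos : 0 < s + ‖u‖ := by positivity
  have hb : ∀ a : Fin n → ℝ, ‖a‖ ≤ ‖u‖ →
      ‖(∫ x in Metric.ball 0 (s + ‖u‖), f x) - ∫ x in Metric.ball a s, f x‖ ≤
        C * ((2 * (s + ‖u‖)) ^ n - (2 * s) ^ n) := fun a ha => by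
    have := norm_setIntegral_sub_le (A := Metric.ball a s) (B := Metric.ball 0 (s + ‖u‖))
      (Metric.ball_subset_ball' (by simpa using ha)) measurableSet_ball measure_ball_lt_top.ne hf hC
    rwa [volume_real_ball hpos, volume_real_ball hs] at this
  rw [integral_cubeProb hs, integral_cubeProb hs, h1, ← smul_sub, norm_smul, norm_inv,
    Real.norm_of_nonneg (by positivity)]
  have h2 := hb u le_rfl
  have h3 := hb 0 (by simp)
  have h4 : ‖(∫ x in Metric.ball u s, f x) - ∫ x in Metric.ball 0 s, f x‖ ≤
      2 * C * ((2 * (s + ‖u‖)) ^ n - (2 * s) ^ n) := by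
    rw [norm_sub_rev] at h2
    have := norm_sub_le_norm_sub_add_norm_sub (∫ x in Metric.ball u s, f x)
      (∫ x in Metric.ball 0 (s + ‖u‖), f x) (∫ x in Metric.ball 0 s, f x)
    linarith
  rw [inv_mul_le_iff₀ (by positivity)]
  refine h4.trans (le_of_eq ?_)
  have : 2 * (s + ‖u‖) = 2 * s * (1 + ‖u‖ / s) := by field_simp
  rw [this, mul_pow]; ring

lemma tendsto_translation_error (n : ℕ) (C a : ℝ) :
    Tendsto (fun s : ℝ => 2 * C * ((1 + a / s) ^ n - 1)) atTop (𝓝 0) := by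
  have : Tendsto (fun s : ℝ => a / s) atTop (𝓝 0) := tendsto_const_nhds.div_atTop tendsto_id
  simpa using (((this.const_add 1).pow n).sub_const 1).const_mul (2 * C)

end cube

/-! ### Mean values, Fourier-Bohr coefficients, Bessel's inequality -/

section mean

variable {n : ℕ} {f g : (Fin n → ℝ) → ℂ}

lemma BohrAP.integrable (hf : BohrAP f) (s : ℝ) : Integrable f (cubeProb n s) :=
  let ⟨_, _, hC⟩ := hf.exists_bound
  integrable_cubeProb hf.continuous hC

/-- A finite net reduces all translations to finitely many, for which the boundary effect of a large
cube is negligible. -/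
lemma BohrAP.eventually_osc_le (hf : BohrAP f) {ε : ℝ} (hε : 0 < ε) :
    ∀ᶠ s in atTop, ∀ x, ‖(∫ u, f (u + x) ∂cubeProb n s) - ∫ u, f u ∂cubeProb n s‖ ≤ ε := by
  obtain ⟨S, hS⟩ := hf.net (ε / 2) (half_pos hε)
  obtain ⟨C, hC0, hC⟩ := hf.exists_bound
  have h1 : ∀ᶠ s in atTop, ∀ t ∈ S,
      ‖(∫ u, f (u + t) ∂cubeProb n s) - ∫ u, f u ∂cubeProb n s‖ ≤ ε / 2 := by
    rw [Filter.eventually_all_finset]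
    intro t _
    filter_upwards [(tendsto_translation_error n C ‖t‖).eventually_le_const (half_pos hε),
      eventually_gt_atTop 0] with s hs hs0
    exact (norm_integral_translate_sub_le hs0 hf.continuous hC t).trans hs
  filter_upwards [h1] with s hs x
  obtain ⟨t, ht, hxt⟩ := hS x
  have h2 : ‖(∫ u, f (u + x) ∂cubeProb n s) - ∫ u, f (u + t) ∂cubeProb n s‖ ≤ ε / 2 := by
    rw [← integral_sub ((hf.translate x).integrable s) ((hf.translate t).integrable s)]
    exact norm_integral_cubeProb_le (half_pos hε).le hxt
  have := norm_sub_le_norm_sub_add_norm_sub (∫ u, f (u + x) ∂cubeProb n s)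
    (∫ u, f (u + t) ∂cubeProb n s) (∫ u, f u ∂cubeProb n s)
  linarith [hs t ht]

/-- The double average of `f (u + x)` over both cubes is symmetric by Fubini, so it is within `ε` of
each of the two averages. This yields the Cauchy property of the means. -/
lemma BohrAP.norm_integral_sub_integral_le (hf : BohrAP f) {ε s s' : ℝ} (hs : 0 < s) (hs' : 0 < s')
    (h : ∀ x, ‖(∫ u, f (u + x) ∂cubeProb n s) - ∫ u, f u ∂cubeProb n s‖ ≤ ε)
    (h' : ∀ x, ‖(∫ u, f (u + x) ∂cubeProb n s') - ∫ u, f u ∂cubeProb n s'‖ ≤ ε) :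
    ‖(∫ u, f u ∂cubeProb n s) - ∫ u, f u ∂cubeProb n s'‖ ≤ 2 * ε := by
  obtain ⟨C, hC0, hC⟩ := hf.exists_bound
  have hε : 0 ≤ ε := (norm_nonneg _).trans (h 0)
  have hcont : Continuous (Function.uncurry fun x y : Fin n → ℝ => f (y + x)) :=
    hf.continuous.comp (by fun_prop)
  have key : ∀ a b : ℝ, 0 < b →
      (∀ x, ‖(∫ u, f (u + x) ∂cubeProb n a) - ∫ u, f u ∂cubeProb n a‖ ≤ ε) →
      ‖(∫ x, ∫ u, f (u + x) ∂cubeProb n a ∂cubeProb n b) - ∫ u, f u ∂cubeProb n a‖ ≤ ε := by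
    intro a b hb hab
    have := isProbabilityMeasure_cubeProb (n := n) hb
    have hint : Integrable (fun x => ∫ u, f (u + x) ∂cubeProb n a) (cubeProb n b) := by
      have : Integrable (Function.uncurry fun x y : Fin n → ℝ => f (y + x))
          ((cubeProb n b).prod (cubeProb n a)) :=
        Integrable.of_bound hcont.aestronglyMeasurable C (Eventually.of_forall fun _ => hC _)
      exact this.integral_prod_left
    have : ∫ u, f u ∂cubeProb n a =
        ∫ _ : Fin n → ℝ, (∫ u, f u ∂cubeProb n a) ∂cubeProb n b := by simp
    rw [this, ← integral_sub hint (integrable_const _)]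
    exact norm_integral_cubeProb_le hε hab
  have h1 := key s s' hs' h
  have h2 := key s' s hs h'
  have hswap : ∫ x, ∫ u, f (u + x) ∂cubeProb n s ∂cubeProb n s' =
      ∫ x, ∫ u, f (u + x) ∂cubeProb n s' ∂cubeProb n s := by
    rw [integral_integral_swap]
    · simp only [add_comm]
    · exact Integrable.of_bound hcont.aestronglyMeasurable C (Eventually.of_forall fun _ => hC _)
  rw [hswap, norm_sub_rev] at h1
  have := norm_sub_le_norm_sub_add_norm_sub (∫ u, f u ∂cubeProb n s)
    (∫ x, ∫ u, f (u + x) ∂cubeProb n s' ∂cubeProb n s) (∫ u, f u ∂cubeProb n s')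
  linarith

/-- The mean value of an almost periodic function. -/
def mean (f : (Fin n → ℝ) → ℂ) : ℂ :=
  limUnder atTop fun s : ℝ => ∫ u, f u ∂cubeProb n s

lemma BohrAP.tendsto_mean (hf : BohrAP f) :
    Tendsto (fun s : ℝ => ∫ u, f u ∂cubeProb n s) atTop (𝓝 (mean f)) := by
  refine CauchySeq.tendsto_limUnder (Metric.cauchySeq_iff'.2 fun ε hε => ?_)
  obtain ⟨N, hN⟩ := eventually_atTop.1
    ((hf.eventually_osc_le (show 0 < ε / 3 by positivity)).and (eventually_gt_atTop 0))
  refine ⟨N, fun s hs => ?_⟩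
  rw [dist_eq_norm]
  have := hf.norm_integral_sub_integral_le (hN s hs).2 (hN N le_rfl).2 (hN s hs).1 (hN N le_rfl).1
  linarith

lemma mean_eq_of_tendsto {c : ℂ} (h : Tendsto (fun s : ℝ => ∫ u, f u ∂cubeProb n s) atTop (𝓝 c)) :
    mean f = c := h.limUnder_eq

lemma BohrAP.eventually_norm_sub_mean_le (hf : BohrAP f) {ε : ℝ} (hε : 0 < ε) :
    ∀ᶠ s in atTop, ∀ x, ‖(∫ u, f (u + x) ∂cubeProb n s) - mean f‖ ≤ ε := by
  have h1 := (Metric.tendsto_nhds.1 hf.tendsto_mean) (ε / 2) (half_pos hε)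
  filter_upwards [h1, hf.eventually_osc_le (half_pos hε)] with s hs hs' x
  rw [dist_eq_norm] at hs
  have := norm_sub_le_norm_sub_add_norm_sub (∫ u, f (u + x) ∂cubeProb n s)
    (∫ u, f u ∂cubeProb n s) (mean f)
  linarith [hs' x]

lemma mean_const (c : ℂ) : mean (fun _ : Fin n → ℝ => c) = c := by
  refine mean_eq_of_tendsto (tendsto_const_nhds.congr' ?_)
  filter_upwards [eventually_gt_atTop 0] with s hs
  have := isProbabilityMeasure_cubeProb (n := n) hs
  simp

lemma mean_sub (hf : BohrAP f) (hg : BohrAP g) :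
    mean (fun x => f x - g x) = mean f - mean g :=
  mean_eq_of_tendsto <| (hf.tendsto_mean.sub hg.tendsto_mean).congr fun s =>
    (integral_sub (hf.integrable s) (hg.integrable s)).symm

lemma mean_const_mul (hf : BohrAP f) (c : ℂ) : mean (fun x => c * f x) = c * mean f :=
  mean_eq_of_tendsto <| (hf.tendsto_mean.const_mul c).congr fun _ =>
    (integral_const_mul c _).symm

lemma mean_sum {ι : Type*} {F : ι → (Fin n → ℝ) → ℂ} (S : Finset ι) (h : ∀ i ∈ S, BohrAP (F i)) :
    mean (fun x => ∑ i ∈ S, F i x) = ∑ i ∈ S, mean (F i) :=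
  mean_eq_of_tendsto <| (tendsto_finsetSum S fun i hi => (h i hi).tendsto_mean).congr fun s =>
    (integral_finsetSum S fun i hi => (h i hi).integrable s).symm

lemma mean_conj (hf : BohrAP f) :
    mean (fun x => (starRingEnd ℂ) (f x)) = (starRingEnd ℂ) (mean f) :=
  mean_eq_of_tendsto <|
    ((Complex.continuous_conj.tendsto _).comp hf.tendsto_mean).congr fun _ => integral_conj.symm

lemma mean_translate (hf : BohrAP f) (t : Fin n → ℝ) : mean (fun x => f (x + t)) = mean f := by
  have h := (hf.translate t).tendsto_mean
  refine tendsto_nhds_unique h ?_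
  rw [Metric.tendsto_nhds]
  intro ε hε
  filter_upwards [hf.eventually_norm_sub_mean_le (half_pos hε)] with s hs
  rw [dist_eq_norm]
  linarith [hs t]

lemma norm_mean_le (hf : BohrAP f) {C : ℝ} (hC : ∀ x, ‖f x‖ ≤ C) : ‖mean f‖ ≤ C :=
  le_of_tendsto hf.tendsto_mean.norm <| Eventually.of_forall fun _ =>
    norm_integral_cubeProb_le ((norm_nonneg _).trans (hC 0)) hC

lemma re_mean_mono (hf : BohrAP f) (hg : BohrAP g) (h : ∀ x, (f x).re ≤ (g x).re) :
    (mean f).re ≤ (mean g).re := by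
  refine le_of_tendsto_of_tendsto ((Complex.continuous_re.tendsto _).comp hf.tendsto_mean)
    ((Complex.continuous_re.tendsto _).comp hg.tendsto_mean) (Eventually.of_forall fun s => ?_)
  have h1 := integral_re (𝕜 := ℂ) (hf.integrable s)
  have h2 := integral_re (𝕜 := ℂ) (hg.integrable s)
  simp only [RCLike.re_to_complex] at h1 h2
  simp only [Function.comp]
  rw [← h1, ← h2]
  exact integral_mono (hf.integrable s).re (hg.integrable s).re h

/-- The mean of the squared modulus. -/
def meanSq (f : (Fin n → ℝ) → ℂ) : ℝ := (mean fun x => f x * (starRingEnd ℂ) (f x)).re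

lemma re_mul_conj (z : ℂ) : (z * (starRingEnd ℂ) z).re = ‖z‖ ^ 2 := by
  rw [RCLike.mul_conj]; norm_cast

lemma meanSq_nonneg (hf : BohrAP f) : 0 ≤ meanSq f := by
  have := re_mean_mono (BohrAP.const (n := n) 0) (hf.mul hf.conj) fun x => by
    rw [re_mul_conj]; simp
  rwa [mean_const, Complex.zero_re] at this

lemma meanSq_le (hf : BohrAP f) {C : ℝ} (hC : ∀ x, ‖f x‖ ≤ C) : meanSq f ≤ C ^ 2 := by
  have := re_mean_mono (hf.mul hf.conj) (BohrAP.const (n := n) ((C ^ 2 : ℝ) : ℂ)) fun x => by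
    rw [re_mul_conj, Complex.ofReal_re]
    exact pow_le_pow_left₀ (norm_nonneg _) (hC x) 2
  rwa [mean_const, Complex.ofReal_re] at this

/-- Translation by `π lam / ⟨lam, lam⟩` changes the sign of the exponential but not its mean. -/
lemma mean_ex_of_ne_zero {lam : Fin n → ℝ} (h : lam ≠ 0) : mean (ex lam) = 0 := by
  have hpos : dotProduct lam lam ≠ 0 := fun h0 => h (dotProduct_self_eq_zero.1 h0)
  have h1 := mean_translate (BohrAP.ex lam) ((Real.pi / dotProduct lam lam) • lam)
  have h2 : ex lam ((Real.pi / dotProduct lam lam) • lam) = -1 := by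
    rw [ex, smul_dotProduct, smul_eq_mul, div_mul_cancel₀ _ hpos, mul_comm, Complex.exp_pi_mul_I]
  simp only [ex_add_right, h2] at h1
  have h3 := mean_const_mul (BohrAP.ex lam) (-1)
  simp only [mul_comm _ (-1 : ℂ)] at h1
  rw [h3] at h1
  linear_combination (-1 / 2 : ℂ) * h1

lemma mean_ex (lam : Fin n → ℝ) : mean (ex lam) = if lam = 0 then 1 else 0 := by
  split_ifs with h
  · subst h
    have : (ex (0 : Fin n → ℝ)) = fun _ => 1 := by ext; simp
    rw [this, mean_const]
  · exact mean_ex_of_ne_zero h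

/-- The Fourier-Bohr coefficient of `f` at the frequency `lam`. -/
def coef (f : (Fin n → ℝ) → ℂ) (lam : Fin n → ℝ) : ℂ := mean fun x => f x * ex (-lam) x

lemma coef_sub (hf : BohrAP f) (hg : BohrAP g) (lam : Fin n → ℝ) :
    coef (fun x => f x - g x) lam = coef f lam - coef g lam := by
  unfold coef
  rw [← mean_sub (hf.mul (BohrAP.ex _)) (hg.mul (BohrAP.ex _))]
  simp only [sub_mul]

lemma coef_sum_ex {ι : Type*} (S : Finset ι) (c : ι → ℂ) (l : ι → Fin n → ℝ) (mu : Fin n → ℝ) :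
    coef (fun x => ∑ i ∈ S, c i * ex (l i) x) mu = ∑ i ∈ S, if l i = mu then c i else 0 := by
  have h : (fun x => (∑ i ∈ S, c i * ex (l i) x) * ex (-mu) x) =
      fun x => ∑ i ∈ S, c i * ex (l i - mu) x := by
    ext x
    rw [Finset.sum_mul]
    refine Finset.sum_congr rfl fun i _ => ?_
    rw [sub_eq_add_neg, ex_add_left, mul_assoc]
  rw [coef, h, mean_sum _ fun i _ => (BohrAP.ex _).const_mul _]
  refine Finset.sum_congr rfl fun i _ => ?_
  rw [mean_const_mul (BohrAP.ex _), mean_ex]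
  simp [sub_eq_zero]

lemma BohrAP.sum_ex {ι : Type*} (S : Finset ι) (c : ι → ℂ) (l : ι → Fin n → ℝ) :
    BohrAP (fun x => ∑ i ∈ S, c i * HAP.ex (l i) x) :=
  BohrAP.sum S fun i _ => (BohrAP.ex (l i)).const_mul (c i)

lemma norm_coef_le (hf : BohrAP f) {C : ℝ} (hC : ∀ x, ‖f x‖ ≤ C) (lam : Fin n → ℝ) :
    ‖coef f lam‖ ≤ C :=
  norm_mean_le (hf.mul (BohrAP.ex _)) fun x => by simpa using hC x

lemma mean_translate_mul_ex (hf : BohrAP f) (lam x : Fin n → ℝ) :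
    mean (fun t => f (x + t) * ex (-lam) t) = coef f lam * ex lam x := by
  have h := mean_translate ((hf.mul (BohrAP.ex (-lam))).const_mul (ex lam x)) x
  rw [mean_const_mul (hf.mul (BohrAP.ex (-lam)))] at h
  rw [coef, mul_comm, ← h]
  congr 1
  ext t
  rw [ex_add_right, add_comm x t]
  linear_combination (-f (t + x) * ex (-lam) t) * ex_mul_neg_self lam x

/-- Bessel's inequality. -/
lemma sum_norm_coef_sq_le (hf : BohrAP f) (S : Finset (Fin n → ℝ)) :
    ∑ lam ∈ S, ‖coef f lam‖ ^ 2 ≤ meanSq f := by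
  classical
  set P : (Fin n → ℝ) → ℂ := fun x => ∑ lam ∈ S, coef f lam * ex lam x with hP
  have hPap : BohrAP P := BohrAP.sum_ex S _ _
  have hff := hf.mul hf.conj
  have hfP := hf.mul hPap.conj
  have hPf := hPap.mul hf.conj
  have hPP := hPap.mul hPap.conj
  have hconjP : ∀ x, (starRingEnd ℂ) (P x) =
      ∑ lam ∈ S, (starRingEnd ℂ) (coef f lam) * ex (-lam) x := fun x => by
    simp [hP, conj_ex]
  have e1 : mean (fun x => f x * (starRingEnd ℂ) (P x)) =
      ∑ lam ∈ S, ((‖coef f lam‖ ^ 2 : ℝ) : ℂ) := by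
    simp only [hconjP, Finset.mul_sum]
    rw [mean_sum _ fun i _ => hf.mul ((BohrAP.ex _).const_mul _)]
    refine Finset.sum_congr rfl fun i _ => ?_
    have : (fun x => f x * ((starRingEnd ℂ) (coef f i) * ex (-i) x)) =
        fun x => (starRingEnd ℂ) (coef f i) * (f x * ex (-i) x) := by ext; ring
    rw [this, mean_const_mul (hf.mul (BohrAP.ex _)), ← coef, mul_comm, RCLike.mul_conj]
    norm_cast
  have e2 : mean (fun x => P x * (starRingEnd ℂ) (f x)) =
      ∑ lam ∈ S, ((‖coef f lam‖ ^ 2 : ℝ) : ℂ) := by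
    have := mean_conj hfP
    rw [e1] at this
    simp only [map_mul, Complex.conj_conj, map_sum, Complex.conj_ofReal] at this
    rw [← this]; simp only [mul_comm]
  have e3 : mean (fun x => P x * (starRingEnd ℂ) (P x)) =
      ∑ lam ∈ S, ((‖coef f lam‖ ^ 2 : ℝ) : ℂ) := by
    simp only [hconjP, Finset.mul_sum]
    rw [mean_sum _ fun i _ => hPap.mul ((BohrAP.ex _).const_mul _)]
    refine Finset.sum_congr rfl fun i hi => ?_
    have : (fun x => P x * ((starRingEnd ℂ) (coef f i) * ex (-i) x)) =
        fun x => (starRingEnd ℂ) (coef f i) * (P x * ex (-i) x) := by ext; ring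
    rw [this, mean_const_mul (hPap.mul (BohrAP.ex _)), ← coef, hP, coef_sum_ex,
      Finset.sum_ite_eq' S i, if_pos hi, mul_comm, RCLike.mul_conj]
    norm_cast
  -- The two cross terms and the mean square of `P` all equal the same sum, so the mean square of `f
  -- - P` is `meanSq f` minus that sum.
  have h0 := meanSq_nonneg (hf.sub hPap)
  have e4 : (fun x => (f x - P x) * (starRingEnd ℂ) (f x - P x)) = fun x =>
      (f x * (starRingEnd ℂ) (f x) - f x * (starRingEnd ℂ) (P x)) -
      (P x * (starRingEnd ℂ) (f x) - P x * (starRingEnd ℂ) (P x)) := by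
    ext x; rw [map_sub]; ring
  rw [meanSq, e4, mean_sub (hff.sub hfP) (hPf.sub hPP), mean_sub hff hfP, mean_sub hPf hPP,
    e1, e2, e3, sub_self, sub_zero, Complex.sub_re, ← Complex.ofReal_sum, Complex.ofReal_re] at h0
  rw [meanSq]; linarith

lemma finite_coef_gt (hf : BohrAP f) {η : ℝ} (hη : 0 < η) : {lam | η < ‖coef f lam‖}.Finite := by
  by_contra h
  obtain ⟨N, hN⟩ := exists_nat_gt (meanSq f / η ^ 2)
  obtain ⟨S, hS, hcard⟩ := Set.Infinite.exists_subset_card_eq h N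
  have h1 := sum_norm_coef_sq_le hf S
  have h2 : ∑ _lam ∈ S, η ^ 2 ≤ ∑ lam ∈ S, ‖coef f lam‖ ^ 2 :=
    Finset.sum_le_sum fun lam hl => pow_le_pow_left₀ hη.le (le_of_lt (hS hl)) 2
  rw [Finset.sum_const, hcard, nsmul_eq_mul] at h2
  rw [div_lt_iff₀ (by positivity)] at hN
  linarith

lemma countable_coef_ne_zero (hf : BohrAP f) : {lam | coef f lam ≠ 0}.Countable := by
  have : {lam | coef f lam ≠ 0} ⊆ ⋃ k : ℕ, {lam | 1 / ((k : ℝ) + 1) < ‖coef f lam‖} := by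
    intro lam hl
    obtain ⟨k, hk⟩ := exists_nat_one_div_lt (norm_pos_iff.2 hl)
    exact Set.mem_iUnion.2 ⟨k, hk⟩
  exact (Set.countable_iUnion fun k => (finite_coef_gt hf (by positivity)).countable).mono this

end mean

/-! ### Bounds for cube averages that are uniform in the frequency -/

section uniform

variable {n : ℕ} {f : (Fin n → ℝ) → ℂ} {C s : ℝ}

lemma norm_integral_cubeProb_le' (hC0 : 0 ≤ C) (hC : ∀ x, ‖x‖ < s → ‖f x‖ ≤ C) :
    ‖∫ x, f x ∂cubeProb n s‖ ≤ C := by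
  have h : ∀ᵐ x ∂cubeProb n s, ‖f x‖ ≤ C :=
    (ProbabilityTheory.ae_cond_mem measurableSet_ball).mono fun x hx => hC x (by simpa using hx)
  exact (norm_integral_le_of_norm_le_const h).trans (mul_le_of_le_one_right hC0 measureReal_le_one)

lemma norm_sq_le_dotProduct_self (lam : Fin n → ℝ) : ‖lam‖ ^ 2 ≤ dotProduct lam lam := by
  have h0 : 0 ≤ dotProduct lam lam := Finset.sum_nonneg fun i _ => mul_self_nonneg _
  have : ‖lam‖ ≤ √(dotProduct lam lam) := by
    refine (pi_norm_le_iff_of_nonneg (Real.sqrt_nonneg _)).2 fun i => ?_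
    refine Real.le_sqrt_of_sq_le ?_
    rw [Real.norm_eq_abs, sq_abs, sq]
    exact Finset.single_le_sum (f := fun i => lam i * lam i) (fun j _ => mul_self_nonneg _)
      (Finset.mem_univ i)
  calc ‖lam‖ ^ 2 ≤ √(dotProduct lam lam) ^ 2 := pow_le_pow_left₀ (norm_nonneg _) this 2
    _ = _ := Real.sq_sqrt h0

lemma abs_dotProduct_le (x lam : Fin n → ℝ) : |dotProduct x lam| ≤ n * (‖x‖ * ‖lam‖) := by
  refine (Finset.abs_sum_le_sum_abs _ _).trans ?_
  have : ∀ i ∈ Finset.univ, |x i * lam i| ≤ ‖x‖ * ‖lam‖ := fun i _ => by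
    rw [abs_mul]
    exact mul_le_mul (norm_le_pi_norm x i) (norm_le_pi_norm lam i) (abs_nonneg _) (norm_nonneg _)
  simpa using Finset.sum_le_sum this

lemma norm_ex_sub_ex_le (lam mu x : Fin n → ℝ) :
    ‖ex lam x - ex mu x‖ ≤ n * (‖x‖ * ‖lam - mu‖) := by
  have h : ex lam x - ex mu x = ex mu x * (ex (lam - mu) x - 1) := by
    rw [mul_sub, ← ex_add_left, mul_one, add_sub_cancel]
  rw [h, norm_mul, norm_ex, one_mul, ex]
  exact (Real.norm_exp_I_mul_ofReal_sub_one_le).trans (abs_dotProduct_le _ _)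

lemma translation_error_mono (hC : 0 ≤ C) {a b S : ℝ} (ha : 0 ≤ a) (hab : a ≤ b) (hS : 0 < S) :
    2 * C * ((1 + a / S) ^ n - 1) ≤ 2 * C * ((1 + b / S) ^ n - 1) := by
  gcongr

/-- Means over large cubes are controlled by the means over the translates of a fixed cube. -/
lemma norm_integral_le_of_translates {B S : ℝ} (hs : 0 < s) (hS : 0 < S) (hf : Continuous f)
    (hC0 : 0 ≤ C) (hB : 0 ≤ B)
    (hC : ∀ x, ‖f x‖ ≤ C) (h : ∀ x, ‖∫ u, f (u + x) ∂cubeProb n s‖ ≤ B) :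
    ‖∫ u, f u ∂cubeProb n S‖ ≤ B + 2 * C * ((1 + s / S) ^ n - 1) := by
  have := isProbabilityMeasure_cubeProb (n := n) hs
  have hcont : Continuous (Function.uncurry fun x y : Fin n → ℝ => f (y + x)) :=
    hf.comp (by fun_prop)
  have hint : Integrable (Function.uncurry fun x y : Fin n → ℝ => f (y + x))
      ((cubeProb n S).prod (cubeProb n s)) :=
    Integrable.of_bound hcont.aestronglyMeasurable C (Eventually.of_forall fun _ => hC _)
  have h1 : ‖∫ x, ∫ u, f (u + x) ∂cubeProb n s ∂cubeProb n S‖ ≤ B :=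
    norm_integral_cubeProb_le hB h
  -- After the swap, the inner integrals are averages over the large cube translated by a vector of
  -- norm below `s`, hence close to the untranslated one.
  rw [integral_integral_swap hint] at h1
  have h2 : ∫ u, f u ∂cubeProb n S =
      ∫ _ : Fin n → ℝ, (∫ u, f u ∂cubeProb n S) ∂cubeProb n s := by simp
  have hS1 : (1 : ℝ) ≤ (1 + s / S) ^ n := one_le_pow₀ (by
    have : 0 ≤ s / S := by positivity
    linarith)
  have h3 : ‖(∫ y, ∫ x, f (y + x) ∂cubeProb n S ∂cubeProb n s) - ∫ u, f u ∂cubeProb n S‖ ≤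
      2 * C * ((1 + s / S) ^ n - 1) := by
    have hint' : Integrable (fun y => ∫ x, f (y + x) ∂cubeProb n S) (cubeProb n s) :=
      hint.integral_prod_right
    conv_lhs => rw [h2]
    rw [← integral_sub hint' (integrable_const _)]
    refine norm_integral_cubeProb_le' (mul_nonneg (by positivity) (sub_nonneg.2 hS1)) fun y hy => ?_
    simp only [add_comm y]
    exact (norm_integral_translate_sub_le hS hf hC y).trans
      (translation_error_mono hC0 (norm_nonneg _) hy.le hS)
  have := norm_le_norm_add_norm_sub (∫ y, ∫ x, f (y + x) ∂cubeProb n S ∂cubeProb n s)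
    (∫ u, f u ∂cubeProb n S)
  linarith

/-- A Riemann-Lebesgue argument: a short translation reverses the sign of a high-frequency
exponential while barely changing `f`. -/
lemma BohrAP.eventually_norm_integral_ex_le_of_large (hf : BohrAP f) {η : ℝ} (hη : 0 < η) :
    ∃ R : ℝ, ∀ᶠ s in atTop, ∀ lam : Fin n → ℝ, R < ‖lam‖ →
      ‖∫ x, f x * HAP.ex (-lam) x ∂cubeProb n s‖ ≤ η := by
  obtain ⟨C, hC0, hC⟩ := hf.exists_bound
  obtain ⟨δ, hδ, hu⟩ := hf.uc η hη
  -- The bound `1` keeps the translation vector `u` shorter than `π`, so that one boundary estimate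
  -- serves all `lam`; the bound `π / δ` makes `u` shorter than `δ`.
  refine ⟨max 1 (Real.pi / δ), ?_⟩
  filter_upwards [(tendsto_translation_error n C Real.pi).eventually_le_const hη,
    eventually_gt_atTop 0] with s hs hs0 lam hlam
  have hl1 : 1 < ‖lam‖ := (le_max_left _ _).trans_lt hlam
  have hl2 : Real.pi / δ < ‖lam‖ := (le_max_right _ _).trans_lt hlam
  have hd := norm_sq_le_dotProduct_self lam
  have hdpos : 0 < dotProduct lam lam := lt_of_lt_of_le (by positivity) hd
  set u : Fin n → ℝ := (Real.pi / dotProduct lam lam) • lam with hu_def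
  have hunorm : ‖u‖ ≤ Real.pi / ‖lam‖ := by
    rw [hu_def, norm_smul, Real.norm_of_nonneg (by positivity), div_mul_eq_mul_div,
      div_le_div_iff₀ hdpos (by positivity)]
    nlinarith [Real.pi_pos]
  have hupi : ‖u‖ ≤ Real.pi := hunorm.trans (div_le_self Real.pi_pos.le hl1.le)
  have huδ : ‖u‖ < δ := by
    refine hunorm.trans_lt ?_
    rw [div_lt_iff₀ (by positivity)]
    rwa [div_lt_iff₀ hδ, mul_comm] at hl2
  have hexu : HAP.ex (-lam) u = -1 := by
    rw [hu_def, HAP.ex, smul_dotProduct, dotProduct_neg, smul_eq_mul, mul_neg,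
      div_mul_cancel₀ _ hdpos.ne', mul_comm, Complex.ofReal_neg, neg_mul, Complex.exp_neg,
      Complex.exp_pi_mul_I]
    norm_num
  have hφ := hf.mul (BohrAP.ex (-lam))
  have h1 := norm_integral_translate_sub_le (n := n) hs0 hφ.continuous
    (C := C) (fun x => by simpa using hC x) u
  have h2 : ‖(∫ x, f (x + u) * HAP.ex (-lam) (x + u) ∂cubeProb n s) +
      ∫ x, f x * HAP.ex (-lam) x ∂cubeProb n s‖ ≤ η := by
    rw [← integral_add ((hφ.translate u).integrable s) (hφ.integrable s)]
    refine norm_integral_cubeProb_le hη.le fun x => ?_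
    rw [ex_add_right, hexu, show f (x + u) * (HAP.ex (-lam) x * -1) + f x * HAP.ex (-lam) x =
      -((f (x + u) - f x) * HAP.ex (-lam) x) by ring, norm_neg, norm_mul, norm_ex, mul_one]
    exact hu u huδ x
  have h3 := h1.trans ((translation_error_mono hC0 (norm_nonneg u) hupi hs0).trans hs)
  set a := ∫ x, f (x + u) * HAP.ex (-lam) (x + u) ∂cubeProb n s
  set b := ∫ x, f x * HAP.ex (-lam) x ∂cubeProb n s
  have h4 := norm_sub_le (a + b) (a - b)
  rw [show a + b - (a - b) = 2 * b by ring, norm_mul, Complex.norm_ofNat] at h4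
  linarith

/-- On one fixed cube the exponential depends continuously on `lam`, so the bound at `lam₀`, valid
for all translates of that cube, persists nearby; larger cubes are then averages of such translates.
-/
lemma BohrAP.exists_nhds_norm_integral_ex_le (hf : BohrAP f) {A η : ℝ}
    (hA : ∀ lam, ‖coef f lam‖ ≤ A) (hη : 0 < η) (lam₀ : Fin n → ℝ) :
    ∃ U ∈ 𝓝 lam₀, ∀ᶠ s in atTop, ∀ lam ∈ U,
      ‖∫ x, f x * HAP.ex (-lam) x ∂cubeProb n s‖ ≤ A + η := by
  obtain ⟨C, hC0, hC⟩ := hf.exists_bound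
  have hA0 : 0 ≤ A := (norm_nonneg _).trans (hA 0)
  have hφ := hf.mul (BohrAP.ex (-lam₀))
  obtain ⟨s, hs, hs0⟩ := ((hφ.eventually_norm_sub_mean_le (show 0 < η / 4 by positivity)).and
    (eventually_gt_atTop 0)).exists
  -- Translating the exponential costs only a unimodular factor. The frequencies are thus compared
  -- on the cube around `0`, where `‖u‖ < s`, and not around `x`.
  have hsm : ∀ lam : Fin n → ℝ, ∀ x, ‖∫ u, f (u + x) * HAP.ex (-lam) (u + x) ∂cubeProb n s‖ =
      ‖∫ u, f (u + x) * HAP.ex (-lam) u ∂cubeProb n s‖ := fun lam x => by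
    simp only [ex_add_right, ← mul_assoc]
    rw [integral_mul_const, norm_mul, norm_ex, mul_one]
  set K : ℝ := C * (n * s) + 1
  have hK : 0 < K := by positivity
  refine ⟨Metric.ball lam₀ (η / 4 / K), Metric.ball_mem_nhds _ (by positivity), ?_⟩
  filter_upwards [(tendsto_translation_error n C s).eventually_le_const (half_pos hη),
    eventually_gt_atTop 0] with S hS hS0 lam hlam
  rw [Metric.mem_ball, dist_eq_norm] at hlam
  have h1 : ∀ x, ‖∫ u, f (u + x) * HAP.ex (-lam) (u + x) ∂cubeProb n s‖ ≤ A + η / 2 := by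
    intro x
    have h2 : ‖∫ u, f (u + x) * HAP.ex (-lam₀) u ∂cubeProb n s‖ ≤ A + η / 4 := by
      rw [← hsm]
      have h3 := norm_le_norm_add_norm_sub' (∫ u, f (u + x) * HAP.ex (-lam₀) (u + x) ∂cubeProb n s)
        (coef f lam₀)
      have h4 := hs x
      rw [← coef] at h4
      linarith [hA lam₀]
    have h5 : ‖(∫ u, f (u + x) * HAP.ex (-lam) u ∂cubeProb n s) -
        ∫ u, f (u + x) * HAP.ex (-lam₀) u ∂cubeProb n s‖ ≤ η / 4 := by
      rw [← integral_sub (((hf.translate x).mul (BohrAP.ex _)).integrable s)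
        (((hf.translate x).mul (BohrAP.ex _)).integrable s)]
      refine norm_integral_cubeProb_le' (by positivity) fun u hu => ?_
      rw [← mul_sub, norm_mul]
      have h6 := norm_ex_sub_ex_le (-lam) (-lam₀) u
      rw [neg_sub_neg, norm_sub_rev lam₀] at h6
      calc ‖f (u + x)‖ * ‖HAP.ex (-lam) u - HAP.ex (-lam₀) u‖
          ≤ C * (n * (s * (η / 4 / K))) := by
            refine mul_le_mul (hC _) (h6.trans ?_) (norm_nonneg _) hC0
            gcongr
        _ = (C * (n * s)) * (η / 4 / K) := by ring
        _ ≤ K * (η / 4 / K) := by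
            have : C * (n * s) ≤ K := by simp [K]
            gcongr
        _ = η / 4 := by field_simp
    rw [hsm]
    have := norm_le_norm_add_norm_sub' (∫ u, f (u + x) * HAP.ex (-lam) u ∂cubeProb n s)
      (∫ u, f (u + x) * HAP.ex (-lam₀) u ∂cubeProb n s)
    linarith
  have := norm_integral_le_of_translates hs0 hS0 (hf.mul (BohrAP.ex (-lam))).continuous hC0
    (show 0 ≤ A + η / 2 by positivity) (fun x => by simpa using hC x) h1
  linarith

/-- The means of `f e^{-i⟨x, lam⟩}` over large cubes are, uniformly in `lam`, not much larger than
the Fourier-Bohr coefficients of `f`. -/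
lemma BohrAP.eventually_norm_integral_ex_le (hf : BohrAP f) {A η : ℝ}
    (hA : ∀ lam, ‖coef f lam‖ ≤ A) (hη : 0 < η) :
    ∀ᶠ s in atTop, ∀ lam, ‖∫ x, f x * HAP.ex (-lam) x ∂cubeProb n s‖ ≤ A + η := by
  have hA0 : 0 ≤ A := (norm_nonneg _).trans (hA 0)
  obtain ⟨R, hR⟩ := hf.eventually_norm_integral_ex_le_of_large hη
  -- High frequencies are settled by `hR`; the remaining ones form a compact ball.
  have hK : ∀ᶠ s in atTop, ∀ lam ∈ Metric.closedBall (0 : Fin n → ℝ) R,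
      ‖∫ x, f x * HAP.ex (-lam) x ∂cubeProb n s‖ ≤ A + η := by
    refine (isCompact_closedBall (0 : Fin n → ℝ) R).induction_on
      (p := fun U => ∀ᶠ s in atTop, ∀ lam ∈ U,
        ‖∫ x, f x * HAP.ex (-lam) x ∂cubeProb n s‖ ≤ A + η) (by simp) ?_ ?_ ?_
    · exact fun U V hUV h => h.mono fun s hs lam hl => hs lam (hUV hl)
    · intro U V hU hV
      filter_upwards [hU, hV] with s h1 h2 lam hl
      exact hl.elim (h1 lam) (h2 lam)
    · intro lam _
      obtain ⟨U, hU, h⟩ := hf.exists_nhds_norm_integral_ex_le hA hη lam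
      exact ⟨U, mem_nhdsWithin_of_mem_nhds hU, h⟩
  filter_upwards [hR, hK] with s h1 h2 lam
  by_cases h : R < ‖lam‖
  · linarith [h1 lam h]
  · exact h2 lam (by simpa using h)

end uniform

/-! ### Plancherel's theorem and the `L²` norm of convolution operators -/

section plancherel

open scoped FourierTransform SchwartzMap ContDiff

variable {V : Type*} [NormedAddCommGroup V] [InnerProductSpace ℝ V] [FiniteDimensional ℝ V]
  [MeasurableSpace V] [BorelSpace V]

/-- On `L¹ ∩ L²` the Fourier integral represents the `L²` Fourier transform. -/
lemma fourier_toLp_ae_eq {F : V → ℂ} (h1 : Integrable F) (h2 : MemLp F 2) :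
    ⇑(𝓕 (h2.toLp F) : Lp ℂ 2 (volume : Measure V)) =ᵐ[volume] 𝓕 F := by
  have hcont : Continuous (𝓕 F) := by
    exact VectorFourier.fourierIntegral_continuous Real.continuous_fourierChar
      (innerSL ℝ).continuous₂ h1
  refine ae_eq_of_integral_contDiff_smul_eq ((Lp.memLp _).locallyIntegrable (by norm_num))
    hcont.locallyIntegrable fun g hg hgs => ?_
  -- Both sides are tested against a smooth compactly supported function, and the Fourier transform
  -- is moved onto it.
  set G : 𝓢(V, ℂ) := HasCompactSupport.toSchwartzMap (f := fun x => (g x : ℂ))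
    (hgs.comp_left (g := fun t : ℝ => (t : ℂ)) (by simp))
    (Complex.ofRealCLM.contDiff.comp hg) with hG
  have hGx : ∀ x, G x = (g x : ℂ) := fun x => rfl
  have e1 := congrArg (fun T => T G) (Lp.fourier_toTemperedDistribution_eq (h2.toLp F))
  simp only [TemperedDistribution.fourier_apply, Lp.toTemperedDistribution_apply] at e1
  have e2 : ∫ x, (𝓕 G) x • (h2.toLp F) x = ∫ x, (𝓕 G) x • F x :=
    integral_congr_ae (h2.coeFn_toLp.mono fun x hx => by simp only [hx])
  have e3 : ∫ x, (𝓕 F) x • G x = ∫ x, F x • (𝓕 (G : V → ℂ)) x :=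
    VectorFourier.integral_fourierIntegral_smul_eq_flip (L := innerₗ V)
      Real.continuous_fourierChar continuous_inner h1 G.integrable |>.trans (by
        rw [flip_innerₗ]; rfl)
  have e4 : ∫ x, G x • (𝓕 (h2.toLp F) : Lp ℂ 2 (volume : Measure V)) x = ∫ x, G x • (𝓕 F) x := by
    rw [← e1, e2]
    simp only [smul_eq_mul] at e3 ⊢
    simp only [mul_comm (G _), e3]
    simp only [mul_comm, SchwartzMap.fourier_coe]
  simpa only [hGx, Complex.real_smul, smul_eq_mul] using e4

/-- Plancherel's theorem for the Fourier integral on `L¹ ∩ L²`. -/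
lemma integral_norm_sq_fourier {F : V → ℂ} (h1 : Integrable F) (h2 : MemLp F 2) :
    MemLp (𝓕 F) 2 ∧ ∫ x, ‖(𝓕 F) x‖ ^ 2 = ∫ x, ‖F x‖ ^ 2 := by
  have hae := fourier_toLp_ae_eq h1 h2
  have hm : MemLp (𝓕 F) 2 := (memLp_congr_ae hae).1 (Lp.memLp _)
  refine ⟨hm, ?_⟩
  have h3 := Lp.norm_fourier_eq (h2.toLp F)
  have key : ∀ u : Lp ℂ 2 (volume : Measure V), ∫ x, ‖u x‖ ^ 2 = ‖u‖ ^ 2 := fun u => by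
    have := L2.inner_def (𝕜 := ℂ) u u
    rw [inner_self_eq_norm_sq_to_K] at this
    simp only [inner_self_eq_norm_sq_to_K] at this
    have h5 : ∫ x, ((‖u x‖ ^ 2 : ℝ) : ℂ) = ((‖u‖ ^ 2 : ℝ) : ℂ) := by
      push_cast; exact this.symm
    rw [integral_complex_ofReal] at h5
    exact_mod_cast h5
  calc ∫ x, ‖(𝓕 F) x‖ ^ 2
      = ∫ x, ‖(𝓕 (h2.toLp F) : Lp ℂ 2 (volume : Measure V)) x‖ ^ 2 :=
        integral_congr_ae (hae.mono fun x hx => by simp only [hx])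
    _ = ∫ x, ‖(h2.toLp F) x‖ ^ 2 := by rw [key, key, h3]
    _ = ∫ x, ‖F x‖ ^ 2 := integral_congr_ae (h2.coeFn_toLp.mono fun x hx => by simp only [hx])

open scoped Convolution in
/-- The convolution with `F₂` is bounded on `L²` by the supremum of the Fourier integral of `F₂`. -/
lemma integral_norm_sq_convolution_le {F₁ F₂ : V → ℂ} {A C : ℝ} (h1 : Integrable F₁)
    (h2 : Integrable F₂) (hC : ∀ x, ‖F₁ x‖ ≤ C) (hA : ∀ ξ, ‖(𝓕 F₂) ξ‖ ≤ A) :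
    Integrable (fun x => ‖(F₁ ⋆[ContinuousLinearMap.mul ℂ ℂ] F₂) x‖ ^ 2) ∧
    ∫ x, ‖(F₁ ⋆[ContinuousLinearMap.mul ℂ ℂ] F₂) x‖ ^ 2 ≤ A ^ 2 * ∫ x, ‖F₁ x‖ ^ 2 := by
  have hbdd : ∀ {G : V → ℂ} {B : ℝ}, Integrable G → (∀ x, ‖G x‖ ≤ B) → MemLp G 2 := by
    intro G B hG hB
    rw [memLp_two_iff_integrable_sq_norm hG.aestronglyMeasurable]
    refine (hG.norm.const_mul B).mono' (hG.aestronglyMeasurable.norm.pow 2)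
      (Eventually.of_forall fun x => ?_)
    rw [Real.norm_of_nonneg (by positivity), sq]
    exact mul_le_mul_of_nonneg_right (hB x) (norm_nonneg _)
  have hG : Integrable (F₁ ⋆[ContinuousLinearMap.mul ℂ ℂ] F₂) :=
    h1.integrable_convolution _ h2
  have hGb : ∀ x, ‖(F₁ ⋆[ContinuousLinearMap.mul ℂ ℂ] F₂) x‖ ≤ C * ∫ y, ‖F₂ y‖ := by
    intro x
    have e : ∫ t, ‖F₂ (x - t)‖ = ∫ y, ‖F₂ y‖ := integral_sub_left_eq_self (fun y => ‖F₂ y‖) _ x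
    rw [← e, ← integral_const_mul]
    refine norm_integral_le_of_norm_le ((h2.norm.comp_sub_left x).const_mul C)
      (Eventually.of_forall fun t => ?_)
    simp only [ContinuousLinearMap.mul_apply', norm_mul]
    exact mul_le_mul_of_nonneg_right (hC t) (norm_nonneg _)
  obtain ⟨m1, e1⟩ := integral_norm_sq_fourier h1 (hbdd h1 hC)
  obtain ⟨-, e2⟩ := integral_norm_sq_fourier hG (hbdd hG hGb)
  refine ⟨(memLp_two_iff_integrable_sq_norm hG.aestronglyMeasurable).1 (hbdd hG hGb), ?_⟩
  -- On the Fourier side the convolution is a product with a factor bounded by `A`.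
  rw [← e1, ← e2, ← integral_const_mul]
  refine integral_mono_of_nonneg (Eventually.of_forall fun _ => by positivity)
    (((memLp_two_iff_integrable_sq_norm m1.1).1 m1).const_mul _)
    (Eventually.of_forall fun ξ => ?_)
  simp only [Real.fourier_mul_convolution_eq h1 h2 ξ, norm_mul, mul_pow]
  rw [mul_comm]
  exact mul_le_mul_of_nonneg_right (pow_le_pow_left₀ (norm_nonneg _) (hA ξ) 2) (by positivity)

end plancherel

/-! ### Transfer from Euclidean space to tuples -/

section cubes

open scoped FourierTransform Convolution

variable {n : ℕ}

lemma fourier_comp_ofLp (F : (Fin n → ℝ) → ℂ) (ξ : EuclideanSpace ℝ (Fin n)) :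
    (𝓕 (fun v : EuclideanSpace ℝ (Fin n) => F v.ofLp)) ξ =
      ∫ x, F x * ex (-((2 * Real.pi) • ξ.ofLp)) x := by
  rw [Real.fourier_eq', ← (PiLp.volume_preserving_ofLp (Fin n)).integral_comp
    (MeasurableEquiv.toLp 2 (Fin n → ℝ)).symm.measurableEmbedding]
  refine integral_congr_ae (Eventually.of_forall fun v => ?_)
  simp only [smul_eq_mul, ex, EuclideanSpace.inner_eq_star_dotProduct]
  rw [mul_comm]
  congr 2
  rw [dotProduct_neg, dotProduct_smul, dotProduct_comm]
  simp
  ring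

/-- `integral_norm_sq_convolution_le` on the space `ℝⁿ` of tuples. -/
lemma integral_norm_sq_conv_le {F₁ F₂ : (Fin n → ℝ) → ℂ} {A C : ℝ} (h1 : Integrable F₁)
    (h2 : Integrable F₂) (hC : ∀ x, ‖F₁ x‖ ≤ C) (hA : ∀ lam, ‖∫ x, F₂ x * ex (-lam) x‖ ≤ A) :
    Integrable (fun b => ‖∫ a, F₁ a * F₂ (b - a)‖ ^ 2) ∧
    ∫ b, ‖∫ a, F₁ a * F₂ (b - a)‖ ^ 2 ≤ A ^ 2 * ∫ x, ‖F₁ x‖ ^ 2 := by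
  have hmp := PiLp.volume_preserving_ofLp (Fin n)
  have hme : MeasurableEmbedding (@WithLp.ofLp 2 (Fin n → ℝ)) :=
    (MeasurableEquiv.toLp 2 (Fin n → ℝ)).symm.measurableEmbedding
  have := integral_norm_sq_convolution_le (F₁ := fun v : EuclideanSpace ℝ (Fin n) => F₁ v.ofLp)
    (F₂ := fun v : EuclideanSpace ℝ (Fin n) => F₂ v.ofLp) (A := A) (C := C)
    ((hmp.integrable_comp_emb hme).2 h1) ((hmp.integrable_comp_emb hme).2 h2)
    (fun v => hC _) fun ξ => by rw [fourier_comp_ofLp]; exact hA _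
  have e1 : ∫ v : EuclideanSpace ℝ (Fin n), ‖F₁ v.ofLp‖ ^ 2 = ∫ x, ‖F₁ x‖ ^ 2 :=
    hmp.integral_comp hme fun x => ‖F₁ x‖ ^ 2
  have e2 : ∀ v : EuclideanSpace ℝ (Fin n),
      ((fun v : EuclideanSpace ℝ (Fin n) => F₁ v.ofLp) ⋆[ContinuousLinearMap.mul ℂ ℂ]
        (fun v : EuclideanSpace ℝ (Fin n) => F₂ v.ofLp)) v =
      ∫ a, F₁ a * F₂ (v.ofLp - a) := fun v =>
    hmp.integral_comp hme fun a => F₁ a * F₂ (v.ofLp - a)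
  simp only [e2, e1] at this
  rwa [hmp.integral_comp hme fun b => ‖∫ a, F₁ a * F₂ (b - a)‖ ^ 2,
    show (fun v : EuclideanSpace ℝ (Fin n) => ‖∫ a, F₁ a * F₂ (v.ofLp - a)‖ ^ 2) =
      (fun b => ‖∫ a, F₁ a * F₂ (b - a)‖ ^ 2) ∘ WithLp.ofLp from rfl,
    hmp.integrable_comp_emb hme] at this

end cubes

/-! ### Correlation functions and quantitative uniqueness -/

section correlation

variable {n : ℕ} {f h : (Fin n → ℝ) → ℂ} {C s : ℝ}

lemma integrableOn_ball (hf : Continuous f) (hC : ∀ x, ‖f x‖ ≤ C) :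
    IntegrableOn f (Metric.ball 0 s) :=
  Measure.integrableOn_of_bounded measure_ball_lt_top.ne hf.aestronglyMeasurable
    (Eventually.of_forall hC)

/-- The `L²` bound for correlations over cubes. -/
lemma BohrAP.integral_norm_sq_correlation_le (hh : BohrAP h) (hs : 0 < s) {A : ℝ}
    (hA : ∀ lam, ‖∫ x, h x * HAP.ex (-lam) x ∂cubeProb n s‖ ≤ A) :
    ∫ b, ‖∫ a, h (a + b) * (starRingEnd ℂ) (h a) ∂cubeProb n s‖ ^ 2 ∂cubeProb n s ≤
      2 ^ n * A ^ 2 * ∫ x, ‖h x‖ ^ 2 ∂cubeProb n (2 * s) := by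
  obtain ⟨C, hC0, hC⟩ := hh.exists_bound
  set V : ℝ := (2 * s) ^ n with hV
  have hVpos : 0 < V := by positivity
  have hint : ∀ F : (Fin n → ℝ) → ℂ,
      ∫ x in Metric.ball 0 s, F x = V • ∫ x, F x ∂cubeProb n s := fun F => by
    rw [integral_cubeProb hs, smul_inv_smul₀ hVpos.ne']
  -- The cube for `F₁` has twice the radius because `a + b` ranges in it when `a` and `b` lie in the
  -- cube of radius `s`; thus the convolution equals the truncated correlation there, up to the
  -- factor `V`.
  set F₁ := (Metric.ball (0 : Fin n → ℝ) (2 * s)).indicator h with hF₁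
  set F₂ := (Metric.ball (0 : Fin n → ℝ) s).indicator fun u => (starRingEnd ℂ) (h (-u)) with hF₂
  have h1 : Integrable F₁ :=
    (integrable_indicator_iff measurableSet_ball).2 (integrableOn_ball hh.continuous hC)
  have h2 : Integrable F₂ :=
    (integrable_indicator_iff measurableSet_ball).2 (integrableOn_ball (C := C)
      (Complex.continuous_conj.comp (hh.continuous.comp continuous_neg))
      fun x => by rw [RCLike.norm_conj]; exact hC _)
  have hb1 : ∀ x, ‖F₁ x‖ ≤ C := fun x => (norm_indicator_le_norm_self _ _).trans (hC x)
  have hneg : ∀ a : Fin n → ℝ, F₂ (-a) =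
      (Metric.ball (0 : Fin n → ℝ) s).indicator (fun u => (starRingEnd ℂ) (h u)) a := fun a => by
    by_cases ha : a ∈ Metric.ball (0 : Fin n → ℝ) s
    · rw [Set.indicator_of_mem ha, hF₂, Set.indicator_of_mem (by simpa using ha), neg_neg]
    · rw [Set.indicator_of_notMem ha, hF₂, Set.indicator_of_notMem (by simpa using ha)]
  have hA' : ∀ lam, ‖∫ x, F₂ x * HAP.ex (-lam) x‖ ≤ V * A := by
    intro lam
    have e : ∫ x, F₂ x * HAP.ex (-lam) x =
        (starRingEnd ℂ) (∫ x in Metric.ball 0 s, h x * HAP.ex (-lam) x) := by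
      rw [← integral_neg_eq_self, ← integral_conj, ← integral_indicator measurableSet_ball]
      refine integral_congr_ae (Eventually.of_forall fun x => ?_)
      simp only [hneg, ex_neg_right]
      by_cases hx : x ∈ Metric.ball (0 : Fin n → ℝ) s
      · simp only [Set.indicator_of_mem hx, map_mul, conj_ex]
      · simp only [Set.indicator_of_notMem hx, zero_mul]
    rw [e, RCLike.norm_conj, hint, norm_smul, Real.norm_of_nonneg hVpos.le]
    exact mul_le_mul_of_nonneg_left (hA lam) hVpos.le
  obtain ⟨hI, hle⟩ := integral_norm_sq_conv_le h1 h2 hb1 hA'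
  have e1 : ∫ x, ‖F₁ x‖ ^ 2 = 2 ^ n * V * ∫ x, ‖h x‖ ^ 2 ∂cubeProb n (2 * s) := by
    rw [integral_cubeProb (by positivity), ← integral_indicator measurableSet_ball, smul_eq_mul]
    have : (fun x => ‖F₁ x‖ ^ 2) = (Metric.ball (0 : Fin n → ℝ) (2 * s)).indicator
        fun x => ‖h x‖ ^ 2 := by
      ext x
      by_cases hx : x ∈ Metric.ball (0 : Fin n → ℝ) (2 * s)
      · simp only [hF₁, Set.indicator_of_mem hx]
      · simp only [hF₁, Set.indicator_of_notMem hx]; simp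
    rw [this, hV, mul_pow 2 (2 * s), ← mul_assoc, mul_inv_cancel₀ (by positivity), one_mul]
  have e2 : ∀ b ∈ Metric.ball (0 : Fin n → ℝ) s, ∫ a, F₁ a * F₂ (b - a) =
      V • ∫ a, h (a + b) * (starRingEnd ℂ) (h a) ∂cubeProb n s := by
    intro b hb
    rw [← hint, ← integral_indicator measurableSet_ball, ← integral_add_right_eq_self _ b]
    refine integral_congr_ae (Eventually.of_forall fun a => ?_)
    simp only [sub_add_cancel_right, hneg]
    by_cases ha : a ∈ Metric.ball (0 : Fin n → ℝ) s
    · have hab : a + b ∈ Metric.ball (0 : Fin n → ℝ) (2 * s) := by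
        rw [mem_ball_zero_iff] at ha hb ⊢
        linarith [norm_add_le a b]
      simp only [Set.indicator_of_mem ha, hF₁, Set.indicator_of_mem hab]
    · simp only [Set.indicator_of_notMem ha, mul_zero]
  have e3 : ∫ b in Metric.ball (0 : Fin n → ℝ) s, ‖∫ a, F₁ a * F₂ (b - a)‖ ^ 2 =
      V ^ 3 * ∫ b, ‖∫ a, h (a + b) * (starRingEnd ℂ) (h a) ∂cubeProb n s‖ ^ 2 ∂cubeProb n s := by
    have : ∀ b ∈ Metric.ball (0 : Fin n → ℝ) s, ‖∫ a, F₁ a * F₂ (b - a)‖ ^ 2 =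
        V ^ 2 * ‖∫ a, h (a + b) * (starRingEnd ℂ) (h a) ∂cubeProb n s‖ ^ 2 := fun b hb => by
      rw [e2 b hb, norm_smul, Real.norm_of_nonneg hVpos.le, mul_pow]
    rw [setIntegral_congr_fun measurableSet_ball this, integral_const_mul, integral_cubeProb hs,
      smul_eq_mul, ← hV]
    field_simp
  have h3 := setIntegral_le_integral (s := Metric.ball (0 : Fin n → ℝ) s) hI
    (Eventually.of_forall fun b => by positivity)
  rw [e3] at h3
  rw [e1] at hle
  have h4 := h3.trans hle
  -- On the left, `V²` comes from the square and `V` from the average over `b`. On the right, `V²`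
  -- comes from the bound `V * A` and `2 ^ n * V` is the volume of the doubled cube. Only `2 ^ n`
  -- survives.
  have hV3 : 0 < V ^ 3 := by positivity
  refine le_of_mul_le_mul_left (h4.trans (le_of_eq ?_)) hV3
  ring

/-- The correlation function of an almost periodic function. -/
def corr (h : (Fin n → ℝ) → ℂ) (b : Fin n → ℝ) : ℂ :=
  mean fun u => h (u + b) * (starRingEnd ℂ) (h u)

lemma re_corr_zero (h : (Fin n → ℝ) → ℂ) : (corr h 0).re = meanSq h := by
  simp [corr, meanSq]

lemma norm_sub_mul_conj_le {a b c : ℂ} {δ C : ℝ} (h1 : ‖a - b‖ ≤ δ) (h2 : ‖c‖ ≤ C) :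
    ‖a * (starRingEnd ℂ) c - b * (starRingEnd ℂ) c‖ ≤ C * δ := by
  rw [← sub_mul, norm_mul, RCLike.norm_conj, mul_comm]
  exact mul_le_mul h2 h1 (norm_nonneg _) ((norm_nonneg _).trans h2)

/-- This makes the correlation almost periodic, with nets of translates taken from those of `h`. -/
lemma dominated_corr (hh : BohrAP h) (hC : ∀ x, ‖h x‖ ≤ C) : Dominated C h (corr h) := by
  intro s t δ hst x
  have hm := fun y => (hh.translate y).mul hh.conj
  rw [corr, corr, ← mean_sub (hm _) (hm _)]
  refine norm_mean_le ((hm _).sub (hm _)) fun u => ?_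
  rw [← add_assoc, ← add_assoc]
  exact norm_sub_mul_conj_le (hst _) (hC u)

lemma norm_corr_le (hh : BohrAP h) (hC : ∀ x, ‖h x‖ ≤ C) (b : Fin n → ℝ) :
    ‖corr h b‖ ≤ C ^ 2 := by
  refine norm_mean_le ((hh.translate b).mul hh.conj) fun u => ?_
  rw [norm_mul, RCLike.norm_conj, sq]
  exact mul_le_mul (hC _) (hC _) (norm_nonneg _) ((norm_nonneg _).trans (hC 0))

lemma BohrAP.eventually_norm_sub_corr_le (hh : BohrAP h) {ε : ℝ} (hε : 0 < ε) :
    ∀ᶠ s in atTop, ∀ b, ‖(∫ a, h (a + b) * (starRingEnd ℂ) (h a) ∂cubeProb n s) - corr h b‖ ≤ ε := by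
  obtain ⟨C, hC0, hC⟩ := hh.exists_bound
  have hδ : 0 < ε / 3 / (C + 1) := by positivity
  have hCδ : C * (ε / 3 / (C + 1)) ≤ ε / 3 := by
    rw [mul_div_assoc', div_le_iff₀ (by positivity)]; nlinarith
  obtain ⟨S, hS⟩ := hh.net _ hδ
  have hm := fun y => (hh.translate y).mul hh.conj
  have h1 : ∀ᶠ s in atTop, ∀ t ∈ S,
      ‖(∫ a, h (a + t) * (starRingEnd ℂ) (h a) ∂cubeProb n s) - corr h t‖ < ε / 3 := by
    rw [Filter.eventually_all_finset]
    intro t _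
    have := Metric.tendsto_nhds.1 (hm t).tendsto_mean (ε / 3) (by positivity)
    simpa only [dist_eq_norm, corr] using this
  filter_upwards [h1] with s hs b
  obtain ⟨t, ht, hbt⟩ := hS b
  have h2 : ‖(∫ a, h (a + b) * (starRingEnd ℂ) (h a) ∂cubeProb n s) -
      ∫ a, h (a + t) * (starRingEnd ℂ) (h a) ∂cubeProb n s‖ ≤ ε / 3 := by
    rw [← integral_sub ((hm b).integrable s) ((hm t).integrable s)]
    exact (norm_integral_cubeProb_le (by positivity)
      fun a => norm_sub_mul_conj_le (hbt a) (hC a)).trans hCδ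
  have h3 := (dominated_corr hh hC t b _ hbt 0).trans hCδ
  rw [zero_add, zero_add, norm_sub_rev] at h3
  have h4 := hs t ht
  set X := ∫ a, h (a + b) * (starRingEnd ℂ) (h a) ∂cubeProb n s
  set Y := ∫ a, h (a + t) * (starRingEnd ℂ) (h a) ∂cubeProb n s
  have h5 := norm_sub_le_norm_sub_add_norm_sub X Y (corr h b)
  have h6 := norm_sub_le_norm_sub_add_norm_sub Y (corr h t) (corr h b)
  linarith

lemma BohrAP.tendsto_meanSq (hf : BohrAP f) :
    Tendsto (fun s => ∫ x, ‖f x‖ ^ 2 ∂cubeProb n s) atTop (𝓝 (meanSq f)) := by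
  refine ((Complex.continuous_re.tendsto _).comp (hf.mul hf.conj).tendsto_mean).congr fun s => ?_
  have h1 := integral_re (𝕜 := ℂ) ((hf.mul hf.conj).integrable s)
  simp only [RCLike.re_to_complex, re_mul_conj] at h1
  exact h1.symm

/-- The correlation function of `h` is small in mean square when the Fourier-Bohr coefficients of
`h` are small. -/
lemma meanSq_corr_le (hh : BohrAP h) {A : ℝ} (hA : ∀ lam, ‖coef h lam‖ ≤ A) :
    meanSq (corr h) ≤ 2 ^ n * A ^ 2 * meanSq h := by
  obtain ⟨C, hC0, hC⟩ := hh.exists_bound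
  have hcorr := hh.of_dominated (dominated_corr hh hC)
  -- Cube averages replace the mean and the correlation at the price of `η`: the squares of two
  -- numbers bounded by `C ^ 2` differ by at most `2 * C ^ 2` times their distance. Finally `η → 0`.
  have key : ∀ η : ℝ, 0 < η →
      meanSq (corr h) ≤ 2 ^ n * (A + η) ^ 2 * meanSq h + 2 * C ^ 2 * η := by
    intro η hη
    have ht2 : Tendsto (fun s : ℝ => 2 ^ n * (A + η) ^ 2 *
        (∫ x, ‖h x‖ ^ 2 ∂cubeProb n (2 * s)) + 2 * C ^ 2 * η) atTop
        (𝓝 (2 ^ n * (A + η) ^ 2 * meanSq h + 2 * C ^ 2 * η)) :=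
      ((hh.tendsto_meanSq.comp (tendsto_id.const_mul_atTop two_pos)).const_mul _).add_const _
    refine le_of_tendsto_of_tendsto hcorr.tendsto_meanSq ht2 ?_
    filter_upwards [hh.eventually_norm_integral_ex_le hA hη, hh.eventually_norm_sub_corr_le hη,
      eventually_gt_atTop 0] with s hs hs' hs0
    have hs1 := isProbabilityMeasure_cubeProb (n := n) hs0
    have h1 := hh.integral_norm_sq_correlation_le hs0 hs
    set I : (Fin n → ℝ) → ℂ := fun b => ∫ a, h (a + b) * (starRingEnd ℂ) (h a) ∂cubeProb n s
    have hIC : ∀ b, ‖I b‖ ≤ C ^ 2 := fun b => norm_integral_cubeProb_le (by positivity) fun a => by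
      rw [norm_mul, RCLike.norm_conj, sq]
      exact mul_le_mul (hC _) (hC _) (norm_nonneg _) hC0
    have hIm : AEStronglyMeasurable I (cubeProb n s) := by
      have hcont : Continuous (Function.uncurry fun b a : Fin n → ℝ =>
          h (a + b) * (starRingEnd ℂ) (h a)) :=
        (hh.continuous.comp (by fun_prop)).mul
          (Complex.continuous_conj.comp (hh.continuous.comp (by fun_prop)))
      exact hcont.aestronglyMeasurable.integral_prod_right'
    have hIi : Integrable (fun b => ‖I b‖ ^ 2) (cubeProb n s) :=
      Integrable.of_bound (hIm.norm.pow 2) ((C ^ 2) ^ 2) (Eventually.of_forall fun b => by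
        rw [Real.norm_of_nonneg (by positivity)]
        exact pow_le_pow_left₀ (norm_nonneg _) (hIC b) 2)
    have hci : Integrable (fun b => ‖corr h b‖ ^ 2) (cubeProb n s) :=
      Integrable.of_bound (hcorr.continuous.norm.pow 2).aestronglyMeasurable ((C ^ 2) ^ 2)
        (Eventually.of_forall fun b => by
        rw [Real.norm_of_nonneg (by positivity)]
        exact pow_le_pow_left₀ (norm_nonneg _) (norm_corr_le hh hC b) 2)
    calc ∫ b, ‖corr h b‖ ^ 2 ∂cubeProb n s
        ≤ ∫ b, (‖I b‖ ^ 2 + 2 * C ^ 2 * η) ∂cubeProb n s := by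
          refine integral_mono hci (hIi.add (integrable_const _)) fun b => ?_
          have h2 := norm_le_norm_add_norm_sub (I b) (corr h b)
          have h3 := hs' b
          have h4 := hIC b
          have h5 := norm_corr_le hh hC b
          have h6 := norm_nonneg (I b)
          have h7 := norm_nonneg (corr h b)
          change ‖corr h b‖ ^ 2 ≤ ‖I b‖ ^ 2 + 2 * C ^ 2 * η
          have h8 : ‖corr h b‖ - ‖I b‖ ≤ η := by
            have : ‖I b - corr h b‖ ≤ η := h3
            linarith
          nlinarith [mul_le_mul_of_nonneg_right h8 (add_nonneg h6 h7)]
      _ = (∫ b, ‖I b‖ ^ 2 ∂cubeProb n s) + 2 * C ^ 2 * η := by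
          rw [integral_add hIi (integrable_const _)]; simp
      _ ≤ _ := by linarith
  have hc : Tendsto (fun η : ℝ => 2 ^ n * (A + η) ^ 2 * meanSq h + 2 * C ^ 2 * η) (𝓝[>] 0)
      (𝓝 (2 ^ n * (A + 0) ^ 2 * meanSq h + 2 * C ^ 2 * 0)) :=
    ((by fun_prop : Continuous fun η : ℝ =>
      2 ^ n * (A + η) ^ 2 * meanSq h + 2 * C ^ 2 * η).tendsto 0).mono_left nhdsWithin_le_nhds
  simp only [add_zero, mul_zero] at hc
  exact ge_of_tendsto hc (eventually_nhdsWithin_of_forall fun η hη => key η hη)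

/-- A bound of the supremum of an almost periodic function by its mean square and the size of a net
of translates. -/
lemma norm_le_of_net (hh : BohrAP h) {ε : ℝ} {S : Finset (Fin n → ℝ)}
    (hS : ∀ t, ∃ s ∈ S, ∀ x, ‖h (x + t) - h (x + s)‖ ≤ ε) (x₀ : Fin n → ℝ) :
    ‖h x₀‖ ≤ ε + √(S.card * meanSq h) := by
  by_contra! hlt
  set d := ‖h x₀‖ - ε with hd
  have hdpos : √(S.card * meanSq h) < d := by linarith
  have hd0 : 0 ≤ d := (Real.sqrt_nonneg _).trans hdpos.le
  have hsq := hh.mul hh.conj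
  -- Every `t` has some `s ∈ S` for which `h (t + (x₀ - s))` is within `ε` of `h x₀`; averaging over
  -- `t` turns the right side into `S.card * meanSq h`.
  have h1 : ∀ t, d ^ 2 ≤ ∑ s ∈ S, ‖h (t + (x₀ - s))‖ ^ 2 := by
    intro t
    obtain ⟨s, hs, hst⟩ := hS t
    have h2 := hst (x₀ - s)
    rw [sub_add_cancel, add_comm] at h2
    have h3 := norm_le_norm_add_norm_sub (h (t + (x₀ - s))) (h x₀)
    calc d ^ 2 ≤ ‖h (t + (x₀ - s))‖ ^ 2 := pow_le_pow_left₀ hd0 (by linarith) 2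
      _ ≤ _ := Finset.single_le_sum (f := fun s => ‖h (t + (x₀ - s))‖ ^ 2)
        (fun _ _ => by positivity) hs
  have h4 := re_mean_mono (BohrAP.const ((d ^ 2 : ℝ) : ℂ))
    (BohrAP.sum S fun s _ => hsq.translate (x₀ - s)) fun t => by
      simpa only [Complex.re_sum, re_mul_conj, Complex.ofReal_re] using h1 t
  rw [mean_const, mean_sum S fun s _ => hsq.translate (x₀ - s), Complex.ofReal_re,
    Finset.sum_congr rfl fun s _ => mean_translate hsq (x₀ - s), Finset.sum_const, nsmul_eq_mul,
    ← Complex.ofReal_natCast, Complex.re_ofReal_mul] at h4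
  exact absurd (Real.le_sqrt_of_sq_le h4) (not_le.2 hdpos)

/-- A quantitative uniqueness theorem: in a class of almost periodic functions controlled by `f`,
functions with small Fourier-Bohr coefficients are uniformly small. -/
lemma BohrAP.exists_coef_bound (hf : BohrAP f) {B ε : ℝ} (hC : 0 ≤ C) (hB : 0 ≤ B) (hε : 0 < ε) :
    ∃ η : ℝ, 0 < η ∧ ∀ h : (Fin n → ℝ) → ℂ, Dominated C f h → (∀ x, ‖h x‖ ≤ B) →
      (∀ lam, ‖coef h lam‖ ≤ η) → ∀ x, ‖h x‖ ≤ ε := by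
  have hnet : ∀ D δ : ℝ, 0 ≤ D → 0 < δ → ∃ S : Finset (Fin n → ℝ), ∀ h : (Fin n → ℝ) → ℂ,
      Dominated D f h → ∀ t, ∃ s ∈ S, ∀ x, ‖h (x + t) - h (x + s)‖ ≤ δ := by
    intro D δ hD hδ
    obtain ⟨S, hS⟩ := hf.net (δ / (D + 1)) (by positivity)
    refine ⟨S, fun h hh t => ?_⟩
    obtain ⟨s, hs, hst⟩ := hS t
    refine ⟨s, hs, fun x => (hh s t _ hst x).trans ?_⟩
    rw [mul_div_assoc', div_le_iff₀ (by positivity)]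
    nlinarith
  -- The constants are fixed backwards: `S₂` serves the final passage from `meanSq h` to `h`, `κ` is
  -- the mean square it tolerates, and `S₁` serves the passage to a uniform bound for the
  -- correlation. All depend on `f`, `B`, `C`, `ε` only, never on `h`.
  obtain ⟨S₂, hS₂⟩ := hnet C (ε / 2) hC (half_pos hε)
  set κ : ℝ := (ε / 2) ^ 2 / (S₂.card + 1) with hκ
  have hκ0 : 0 < κ := by positivity
  obtain ⟨S₁, hS₁⟩ := hnet (B * C) (κ / 2) (by positivity) (half_pos hκ0)
  set M : ℝ := √(S₁.card * (2 ^ n * B ^ 2)) with hM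
  refine ⟨κ / 2 / (M + 1), by positivity, fun h hdom hbd hcoef x => ?_⟩
  have hh : BohrAP h := hf.of_dominated hdom
  have hcdom : Dominated (B * C) f (corr h) := fun s t δ hst x => by
    rw [mul_assoc]
    exact dominated_corr hh hbd s t _ (hdom s t δ hst) x
  have hcorr := hf.of_dominated hcdom
  have h1 := norm_le_of_net hcorr (hS₁ _ hcdom) 0
  have h2 := meanSq_corr_le hh hcoef
  set η : ℝ := κ / 2 / (M + 1) with hη
  have hη0 : 0 ≤ η := by positivity
  have h3 : √(S₁.card * meanSq (corr h)) ≤ M * η := by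
    calc √(S₁.card * meanSq (corr h)) ≤ √(S₁.card * (2 ^ n * B ^ 2) * η ^ 2) := by
          refine Real.sqrt_le_sqrt ?_
          rw [mul_assoc]
          refine mul_le_mul_of_nonneg_left (h2.trans ?_) (Nat.cast_nonneg _)
          rw [mul_right_comm]
          gcongr
          exact meanSq_le hh hbd
      _ = M * η := by rw [Real.sqrt_mul (by positivity), Real.sqrt_sq hη0]
  have h4 : M * η ≤ κ / 2 := by
    rw [hη, mul_div_assoc', div_le_iff₀ (by positivity)]
    have : 0 ≤ M := Real.sqrt_nonneg _
    nlinarith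
  have h5 : meanSq h ≤ κ := by
    rw [← re_corr_zero]
    exact (Complex.re_le_norm _).trans (by linarith)
  have h6 := norm_le_of_net hh (hS₂ _ hdom) x
  have h7 : √(S₂.card * meanSq h) ≤ ε / 2 := by
    rw [Real.sqrt_le_left (by positivity)]
    calc (S₂.card : ℝ) * meanSq h ≤ (S₂.card + 1) * κ := by
          have := meanSq_nonneg hh
          gcongr; linarith
      _ = (ε / 2) ^ 2 := by rw [hκ]; field_simp
  linarith

end correlation

/-! ### The one-dimensional Fejér kernel -/

section fejer

lemma sum_Icc_neg_succ {M : Type*} [AddCommMonoid M] (f : ℤ → M) (N : ℕ) :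
    ∑ v ∈ Finset.Icc (-((N + 1 : ℕ) : ℤ)) ((N + 1 : ℕ) : ℤ), f v =
      f ((N + 1 : ℕ) : ℤ) + (f (-((N + 1 : ℕ) : ℤ)) + ∑ v ∈ Finset.Icc (-(N : ℤ)) N, f v) := by
  have : Finset.Icc (-((N + 1 : ℕ) : ℤ)) ((N + 1 : ℕ) : ℤ) =
      insert ((N + 1 : ℕ) : ℤ) (insert (-((N + 1 : ℕ) : ℤ)) (Finset.Icc (-(N : ℤ)) N)) := by
    ext v; simp only [Finset.mem_insert, Finset.mem_Icc]; omega
  rw [this, Finset.sum_insert, Finset.sum_insert]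
  · simp only [Finset.mem_Icc]; omega
  · simp only [Finset.mem_insert, Finset.mem_Icc]; omega

/-- The right side is the increment of the product of geometric sums in `fejer_sum` when `N` grows
by one. -/
lemma dirichlet_sum {u : ℂ} (hu : u ≠ 0) (N : ℕ) :
    ∑ v ∈ Finset.Icc (-(N : ℤ)) N, u ^ v =
      (∑ k ∈ Finset.range N, u ^ k) * u⁻¹ ^ N + u ^ N * (∑ k ∈ Finset.range N, u⁻¹ ^ k) + 1 := by
  induction N with
  | zero => simp
  | succ N ih =>
    rw [sum_Icc_neg_succ, ih, Finset.sum_range_succ' (fun k => u ^ k),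
      Finset.sum_range_succ' (fun k => u⁻¹ ^ k), zpow_neg, zpow_natCast]
    simp only [pow_succ, ← Finset.sum_mul, pow_zero]
    have h : u * u⁻¹ = 1 := mul_inv_cancel₀ hu
    linear_combination (-(∑ k ∈ Finset.range N, u ^ k) * u⁻¹ ^ N -
      u ^ N * (∑ k ∈ Finset.range N, u⁻¹ ^ k)) * h

lemma fejer_sum {u : ℂ} (hu : u ≠ 0) (N : ℕ) :
    ∑ v ∈ Finset.Icc (-(N : ℤ)) N, ((N : ℂ) - |(v : ℝ)|) * u ^ v =
      (∑ k ∈ Finset.range N, u ^ k) * (∑ k ∈ Finset.range N, u⁻¹ ^ k) := by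
  induction N with
  | zero => simp
  | succ N ih =>
    have h1 : ∑ v ∈ Finset.Icc (-(N : ℤ)) N, (((N + 1 : ℕ) : ℂ) - |(v : ℝ)|) * u ^ v =
        (∑ v ∈ Finset.Icc (-(N : ℤ)) N, ((N : ℂ) - |(v : ℝ)|) * u ^ v) +
          ∑ v ∈ Finset.Icc (-(N : ℤ)) N, u ^ v := by
      rw [← Finset.sum_add_distrib]
      refine Finset.sum_congr rfl fun v _ => ?_
      push_cast; ring
    have h2 : |((((N + 1 : ℕ) : ℤ) : ℤ) : ℝ)| = ((N + 1 : ℕ) : ℝ) := by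
      rw [Int.cast_natCast, Nat.abs_cast]
    have h3 : |((-((N + 1 : ℕ) : ℤ) : ℤ) : ℝ)| = ((N + 1 : ℕ) : ℝ) := by
      rw [Int.cast_neg, abs_neg, Int.cast_natCast, Nat.abs_cast]
    rw [sum_Icc_neg_succ, h1, ih, dirichlet_sum hu, h2, h3, Complex.ofReal_natCast, sub_self,
      zero_mul, zero_mul, Finset.sum_range_succ, Finset.sum_range_succ]
    have h : u ^ N * u⁻¹ ^ N = 1 := by rw [← mul_pow, mul_inv_cancel₀ hu, one_pow]
    linear_combination -h

/-- The Fejér kernel is non-negative. -/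
lemma fejer_nonneg (u : Circle) {N : ℕ} (hN : N ≠ 0) :
    ∃ r : ℝ, 0 ≤ r ∧
      ∑ v ∈ Finset.Icc (-(N : ℤ)) N, ((1 - |(v : ℝ)| / N : ℝ) : ℂ) * (u : ℂ) ^ v = r := by
  have hu : (u : ℂ) ≠ 0 := u.coe_ne_zero
  have hN' : (N : ℂ) ≠ 0 := Nat.cast_ne_zero.2 hN
  set D : ℂ := ∑ k ∈ Finset.range N, (u : ℂ) ^ k with hD
  refine ⟨‖D‖ ^ 2 / N, by positivity, ?_⟩
  have h1 := fejer_sum hu N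
  have h2 : ∑ k ∈ Finset.range N, (u : ℂ)⁻¹ ^ k = (starRingEnd ℂ) D := by
    rw [hD, map_sum]
    refine Finset.sum_congr rfl fun k _ => ?_
    rw [map_pow, ← Circle.coe_inv_eq_conj, Circle.coe_inv]
  rw [h2, RCLike.mul_conj] at h1
  push_cast
  rw [eq_div_iff hN', Finset.sum_mul]
  refine Eq.trans (Finset.sum_congr rfl fun v _ => ?_) h1
  field_simp

end fejer

/-! ### Bochner-Fejér kernels, sums and approximation on `ℝⁿ` -/

section kernel

variable {n : ℕ} {I : Set ℕ} {ω : ℕ → Fin n → ℝ} {j : ℕ}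

/-- The frequency tuples of the `j`-th Bochner-Fejér sum. -/
def tuples (I : Set ℕ) (j : ℕ) : Finset (firstIdx I j → ℤ) :=
  Fintype.piFinset fun _ => Finset.Icc (-((j ! : ℤ) ^ 2)) ((j ! : ℤ) ^ 2)

/-- The weights of the `j`-th Bochner-Fejér sum. -/
def weight (I : Set ℕ) (j : ℕ) (v : firstIdx I j → ℤ) : ℝ :=
  ∏ r, (1 - |(v r : ℝ)| / (j ! : ℝ) ^ 2)

lemma mem_tuples {v : firstIdx I j → ℤ} :
    v ∈ tuples I j ↔ ∀ r, |(v r : ℝ)| ≤ (j ! : ℝ) ^ 2 := by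
  simp only [tuples, Fintype.mem_piFinset, Finset.mem_Icc, ← abs_le]
  refine forall_congr' fun r => ?_
  rw [← Int.cast_abs]
  exact_mod_cast Iff.rfl

lemma zero_mem_tuples : (0 : firstIdx I j → ℤ) ∈ tuples I j :=
  mem_tuples.2 fun r => by simp

lemma weight_nonneg {v : firstIdx I j → ℤ} (hv : v ∈ tuples I j) : 0 ≤ weight I j v :=
  Finset.prod_nonneg fun r _ => sub_nonneg.2 (div_le_one_of_le₀ (mem_tuples.1 hv r) (by positivity))

lemma weight_le_one {v : firstIdx I j → ℤ} (hv : v ∈ tuples I j) : weight I j v ≤ 1 :=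
  Finset.prod_le_one
    (fun r _ => sub_nonneg.2 (div_le_one_of_le₀ (mem_tuples.1 hv r) (by positivity)))
    fun r _ => sub_le_self _ (by positivity)

@[simp] lemma weight_zero : weight I j 0 = 1 := by simp [weight]

@[simp] lemma freq_zero : freq I ω j 0 = 0 := by simp [freq]

lemma freq_sub (v v' : firstIdx I j → ℤ) :
    freq I ω j (v - v') = freq I ω j v - freq I ω j v' := by
  simp only [freq, ← Finset.sum_sub_distrib, ← sub_smul, ← sub_div, Pi.sub_apply, Int.cast_sub]

/-- Each frequency thus arises from a single tuple, so its total weight is a single Fejér weight. -/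
lemma freq_injective (hω : LinearIndepOn ℚ ω I) : Function.Injective (freq I ω j) := by
  have hsub : ((firstIdx I j : Finset ℕ) : Set ℕ) ⊆ I := fun r hr => by
    simp only [firstIdx, Finset.coe_filter, Finset.mem_range, Set.mem_ofPred_eq] at hr
    exact hr.2
  have hli := Fintype.linearIndependent_iff.1 (hω.mono hsub)
  have h0 : ∀ v, freq I ω j v = 0 → v = 0 := by
    intro v hv
    have := hli (fun r => (v r : ℚ) / (j ! : ℚ)) (by
      rw [← hv, freq]
      refine Finset.sum_congr rfl fun r _ => ?_
      rw [← Rat.cast_smul_eq_qsmul ℝ]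
      push_cast; rfl)
    ext r
    have h := this r
    rw [div_eq_zero_iff] at h
    rcases h with h | h
    · exact_mod_cast h
    · exact absurd h (by exact_mod_cast Nat.factorial_ne_zero j)
  intro v v' h
  exact sub_eq_zero.1 (h0 _ (by rw [freq_sub, h, sub_self]))

lemma addChar_map_sum {A M ι : Type*} [AddCommMonoid A] [CommMonoid M] (ψ : AddChar A M)
    (S : Finset ι) (a : ι → A) : ψ (∑ i ∈ S, a i) = ∏ i ∈ S, ψ (a i) := by
  classical
  induction S using Finset.induction_on with
  | empty => simp
  | insert i S hi ih => rw [Finset.sum_insert hi, Finset.prod_insert hi, AddChar.map_add_eq_mul, ih]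

/-- The Fejér kernels of the Bochner-Fejér sums are non-negative. -/
lemma kernel_nonneg (ψ : AddChar (Fin n → ℝ) Circle) :
    ∃ r : ℝ, 0 ≤ r ∧ ∑ v ∈ tuples I j, (weight I j v : ℂ) * (ψ (freq I ω j v) : ℂ) = r := by
  have hN : j ! ^ 2 ≠ 0 := pow_ne_zero _ (Nat.factorial_ne_zero j)
  -- The sum over tuples factors into one-dimensional Fejér sums of order `(j !) ^ 2` at the points
  -- `ψ (ω i / j !)`. The character has to be defined on all of `ℝⁿ` for these points to make sense.
  choose r hr0 hr using fun i : firstIdx I j => fejer_nonneg (ψ ((1 / (j ! : ℝ)) • ω i)) hN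
  refine ⟨∏ i, r i, Finset.prod_nonneg fun i _ => hr0 i, ?_⟩
  rw [Complex.ofReal_prod, ← Finset.prod_congr rfl fun i _ => hr i, Finset.prod_univ_sum]
  have hset : tuples I j = Fintype.piFinset fun _ : firstIdx I j =>
      Finset.Icc (-((j ! ^ 2 : ℕ) : ℤ)) ((j ! ^ 2 : ℕ) : ℤ) := by
    simp [tuples]
  rw [← hset]
  refine Finset.sum_congr rfl fun v _ => ?_
  rw [Finset.prod_mul_distrib]
  congr 1
  · rw [weight, Complex.ofReal_prod]
    simp
  · have : freq I ω j v = ∑ i, v i • ((1 / (j ! : ℝ)) • ω i) := by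
      rw [freq]
      refine Finset.sum_congr rfl fun i _ => ?_
      rw [← Int.cast_smul_eq_zsmul ℝ, smul_smul, mul_one_div]
    rw [this, addChar_map_sum]
    refine (map_prod Circle.coeHom _ _).trans (Finset.prod_congr rfl fun i _ => ?_)
    rw [AddChar.map_zsmul_eq_zpow]
    exact Circle.coe_zpow _ _

/-- The character of `ℝⁿ` given by `lam ↦ e^{i⟨t, lam⟩}`. -/
def evChar (t : Fin n → ℝ) : AddChar (Fin n → ℝ) Circle where
  toFun lam := Circle.exp (dotProduct t lam)
  map_zero_eq_one' := by simp
  map_add_eq_mul' a b := by rw [dotProduct_add, Circle.exp_add]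

lemma evChar_apply (t lam : Fin n → ℝ) : (evChar t lam : ℂ) = ex lam t := by
  change (Circle.exp (dotProduct t lam) : ℂ) = _
  rw [Circle.coe_exp, ex, mul_comm]

/-- The Bochner-Fejér sums of a function on `ℝⁿ`, perturbed by a character. -/
def bfSum (I : Set ℕ) (ω : ℕ → Fin n → ℝ) (χ : AddChar (Fin n → ℝ) Circle) (j : ℕ)
    (f : (Fin n → ℝ) → ℂ) (x : Fin n → ℝ) : ℂ :=
  ∑ v ∈ tuples I j, (weight I j v : ℂ) * (χ (freq I ω j v) : ℂ) * coef f (freq I ω j v) *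
    ex (freq I ω j v) x

/-- The perturbed Bochner-Fejér kernel. -/
def bfKernel (I : Set ℕ) (ω : ℕ → Fin n → ℝ) (χ : AddChar (Fin n → ℝ) Circle) (j : ℕ)
    (t : Fin n → ℝ) : ℂ :=
  ∑ v ∈ tuples I j, (weight I j v : ℂ) * (χ (freq I ω j v) : ℂ) * ex (-freq I ω j v) t

/-- The total weight of a frequency in a Bochner-Fejér sum. -/
def freqWeight (I : Set ℕ) (ω : ℕ → Fin n → ℝ) (j : ℕ) (lam : Fin n → ℝ) : ℝ :=
  open Classical in ∑ v ∈ tuples I j, if freq I ω j v = lam then weight I j v else 0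

variable {χ : AddChar (Fin n → ℝ) Circle} {f g : (Fin n → ℝ) → ℂ}

lemma bohrAP_bfKernel : BohrAP (bfKernel I ω χ j) :=
  BohrAP.sum_ex _ _ _

/-- The perturbed kernel at `t` is the Fejér kernel evaluated at the character `χ * evChar (-t)`. -/
lemma bfKernel_nonneg (t : Fin n → ℝ) : ∃ r : ℝ, 0 ≤ r ∧ bfKernel I ω χ j t = r := by
  obtain ⟨r, hr, h⟩ := kernel_nonneg (I := I) (ω := ω) (j := j) (χ * evChar (-t))
  refine ⟨r, hr, ?_⟩
  rw [← h, bfKernel]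
  refine Finset.sum_congr rfl fun v _ => ?_
  rw [AddChar.mul_apply, Circle.coe_mul, evChar_apply, ex_neg_right, mul_assoc]

lemma freqWeight_eq (hω : LinearIndepOn ℚ ω I) {v : firstIdx I j → ℤ} (hv : v ∈ tuples I j) :
    freqWeight I ω j (freq I ω j v) = weight I j v := by
  classical
  simp only [freqWeight, (freq_injective hω).eq_iff]
  rw [Finset.sum_ite_eq' _ v, if_pos hv]

lemma freqWeight_mem_Icc (hω : LinearIndepOn ℚ ω I) (lam : Fin n → ℝ) :
    freqWeight I ω j lam ∈ Set.Icc (0 : ℝ) 1 := by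
  by_cases h : ∃ v ∈ tuples I j, freq I ω j v = lam
  · obtain ⟨v, hv, rfl⟩ := h
    rw [freqWeight_eq hω hv]
    exact ⟨weight_nonneg hv, weight_le_one hv⟩
  · push Not at h
    rw [freqWeight, Finset.sum_eq_zero fun v hv => if_neg (h v hv)]
    simp

lemma sum_weight_eq (c : (Fin n → ℝ) → ℂ) (lam : Fin n → ℝ) :
    (open Classical in ∑ v ∈ tuples I j, if freq I ω j v = lam then
      (weight I j v : ℂ) * c (freq I ω j v) else 0) = freqWeight I ω j lam * c lam := by
  rw [freqWeight, Complex.ofReal_sum, Finset.sum_mul]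
  refine Finset.sum_congr rfl fun v _ => ?_
  split_ifs with h
  · rw [h]
  · simp

/-- Only the frequency `0` contributes to the mean; independence gives it to the zero tuple alone,
where the weight and `χ` are `1`. -/
lemma mean_bfKernel (hω : LinearIndepOn ℚ ω I) : mean (bfKernel I ω χ j) = 1 := by
  classical
  have h : mean (bfKernel I ω χ j) = coef (bfKernel I ω χ j) 0 := by simp [coef]
  have h2 := sum_weight_eq (I := I) (ω := ω) (j := j) (fun lam => (χ lam : ℂ)) 0
  rw [← freq_zero (I := I) (ω := ω) (j := j), freqWeight_eq hω zero_mem_tuples, weight_zero,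
    freq_zero] at h2
  rw [h]
  unfold bfKernel
  rw [coef_sum_ex]
  simpa [neg_eq_zero] using h2

lemma norm_mean_le_re_mean (hf : BohrAP f) (hg : BohrAP g) (h : ∀ x, ‖f x‖ ≤ (g x).re) :
    ‖mean f‖ ≤ (mean g).re := by
  refine le_of_tendsto_of_tendsto hf.tendsto_mean.norm
    ((Complex.continuous_re.tendsto _).comp hg.tendsto_mean) (Eventually.of_forall fun s => ?_)
  have h2 := integral_re (𝕜 := ℂ) (hg.integrable s)
  simp only [RCLike.re_to_complex] at h2
  simp only [Function.comp]
  rw [← h2]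
  exact norm_integral_le_of_norm_le (hg.integrable s).re (Eventually.of_forall h)

lemma norm_mean_mul_bfKernel_le (hω : LinearIndepOn ℚ ω I) (hf : BohrAP f) {C : ℝ}
    (hC : ∀ x, ‖f x‖ ≤ C) : ‖mean fun t => f t * bfKernel I ω χ j t‖ ≤ C := by
  have := norm_mean_le_re_mean (hf.mul (bohrAP_bfKernel (I := I) (ω := ω) (χ := χ) (j := j)))
    (bohrAP_bfKernel.const_mul (C : ℂ)) fun t => by
      obtain ⟨r, hr, h⟩ := bfKernel_nonneg (I := I) (ω := ω) (χ := χ) (j := j) t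
      rw [norm_mul, h, Complex.norm_real, Real.norm_of_nonneg hr, ← Complex.ofReal_mul,
        Complex.ofReal_re]
      exact mul_le_mul_of_nonneg_right (hC t) hr
  rwa [mean_const_mul bohrAP_bfKernel, mean_bfKernel hω, mul_one, Complex.ofReal_re] at this

/-- This convolution form makes the positivity of the kernel available: it yields the contraction
property and the commutation with translations. -/
lemma bfSum_eq_mean (hf : BohrAP f) (x : Fin n → ℝ) :
    bfSum I ω χ j f x = mean fun t => f (x + t) * bfKernel I ω χ j t := by
  have hfx : BohrAP fun t => f (x + t) := by simpa only [add_comm x] using hf.translate x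
  have : (fun t => f (x + t) * bfKernel I ω χ j t) = fun t => ∑ v ∈ tuples I j,
      ((weight I j v : ℂ) * (χ (freq I ω j v) : ℂ)) * (f (x + t) * ex (-freq I ω j v) t) := by
    ext t
    rw [bfKernel, Finset.mul_sum]
    exact Finset.sum_congr rfl fun v _ => by ring
  rw [this, mean_sum _ fun v _ => (hfx.mul (BohrAP.ex _)).const_mul _, bfSum]
  refine Finset.sum_congr rfl fun v _ => ?_
  rw [mean_const_mul (hfx.mul (BohrAP.ex _)), mean_translate_mul_ex hf, mul_assoc]

lemma norm_bfSum_le (hω : LinearIndepOn ℚ ω I) (hf : BohrAP f) {C : ℝ}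
    (hC : ∀ x, ‖f x‖ ≤ C) (x : Fin n → ℝ) : ‖bfSum I ω χ j f x‖ ≤ C := by
  rw [bfSum_eq_mean hf]
  have hfx : BohrAP fun t => f (x + t) := by simpa only [add_comm x] using hf.translate x
  exact norm_mean_mul_bfKernel_le hω hfx fun t => hC _

lemma bfSum_sub (hf : BohrAP f) (hg : BohrAP g) (x : Fin n → ℝ) :
    bfSum I ω χ j (fun y => f y - g y) x = bfSum I ω χ j f x - bfSum I ω χ j g x := by
  simp only [bfSum, coef_sub hf hg, mul_sub, sub_mul, Finset.sum_sub_distrib]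

lemma bohrAP_bfSum : BohrAP (bfSum I ω χ j f) :=
  BohrAP.sum_ex _ _ _

lemma bfSum_translate (hf : BohrAP f) (x t : Fin n → ℝ) :
    bfSum I ω χ j (fun y => f (y + t)) x = bfSum I ω χ j f (x + t) := by
  rw [bfSum_eq_mean hf, bfSum_eq_mean (hf.translate t)]
  simp only [add_right_comm]

lemma dominated_bfSum (hω : LinearIndepOn ℚ ω I) (hf : BohrAP f) :
    Dominated 1 f (bfSum I ω χ j f) := by
  intro s t δ hst x
  rw [← bfSum_translate hf, ← bfSum_translate hf, ← bfSum_sub (hf.translate t) (hf.translate s),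
    one_mul]
  exact norm_bfSum_le hω ((hf.translate t).sub (hf.translate s)) hst x

lemma coef_bfSum (lam : Fin n → ℝ) :
    coef (bfSum I ω χ j f) lam = freqWeight I ω j lam * ((χ lam : ℂ) * coef f lam) := by
  classical
  rw [← sum_weight_eq (fun lam => (χ lam : ℂ) * coef f lam)]
  unfold bfSum
  rw [coef_sum_ex]
  refine Finset.sum_congr rfl fun v _ => ?_
  simp only [mul_assoc]

/-- Once `j !` clears the denominators of the coordinates `l r` of `lam`, the tuple of `lam` is `l r
* j !`, and its weight is the product of the factors `1 - |l r| / j !`. -/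
lemma tendsto_freqWeight (hω : LinearIndepOn ℚ ω I) {lam : Fin n → ℝ}
    (h : lam ∈ Submodule.span ℚ (ω '' I)) :
    Tendsto (fun j => freqWeight I ω j lam) atTop (𝓝 1) := by
  obtain ⟨l, hl, rfl⟩ := (Finsupp.mem_span_image_iff_linearCombination ℚ).1 h
  have hlI : ∀ r ∈ l.support, r ∈ I := fun r hr => (Finsupp.mem_supported ℚ l).1 hl hr
  have hlim : Tendsto (fun j : ℕ => ∏ r ∈ l.support, (1 - |(l r : ℝ)| / (j ! : ℝ))) atTop
      (𝓝 1) := by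
    have : Tendsto (fun j : ℕ => (j ! : ℝ)) atTop atTop :=
      tendsto_natCast_atTop_atTop.comp
        (tendsto_atTop_mono Nat.self_le_factorial tendsto_id)
    have h2 := tendsto_finsetProd l.support fun r _ =>
      (tendsto_const_nhds (x := |(l r : ℝ)|)).div_atTop this |>.const_sub 1
    simpa using h2
  refine hlim.congr' ?_
  have hev : ∀ᶠ j : ℕ in atTop, ∀ r ∈ l.support, r < j ∧ (l r).den ≤ j ∧ |(l r : ℝ)| ≤ j := by
    rw [Filter.eventually_all_finset]
    intro r _
    filter_upwards [eventually_gt_atTop r, eventually_ge_atTop (l r).den,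
      tendsto_natCast_atTop_atTop.eventually_ge_atTop |(l r : ℝ)|] with j h1 h2 h3
    exact ⟨h1, h2, h3⟩
  filter_upwards [hev] with j hj
  have hfac : (0 : ℝ) < (j ! : ℝ) := by exact_mod_cast Nat.factorial_pos j
  have hint : ∀ r, ∃ z : ℤ, (z : ℝ) = (l r : ℝ) * (j ! : ℝ) := by
    intro r
    by_cases hr : r ∈ l.support
    · obtain ⟨k, hk⟩ := Nat.dvd_factorial (l r).den_pos (hj r hr).2.1
      refine ⟨(l r).num * k, ?_⟩
      have hden : ((l r).den : ℝ) ≠ 0 := by exact_mod_cast (l r).den_ne_zero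
      rw [hk, Rat.cast_def]
      push_cast
      field_simp
    · exact ⟨0, by simp [Finsupp.notMem_support_iff.1 hr]⟩
  choose z hz using hint
  set v : firstIdx I j → ℤ := fun r => z r with hv
  have hvabs : ∀ r : firstIdx I j, |(v r : ℝ)| = |(l r : ℝ)| * (j ! : ℝ) := fun r => by
    rw [hv, hz, abs_mul, abs_of_pos hfac]
  have hmem : v ∈ tuples I j := mem_tuples.2 fun r => by
    rw [hvabs, sq]
    refine mul_le_mul_of_nonneg_right ?_ hfac.le
    by_cases hr : (r : ℕ) ∈ l.support
    · exact (hj r hr).2.2.trans (by exact_mod_cast Nat.self_le_factorial j)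
    · simp [Finsupp.notMem_support_iff.1 hr]
  have hsub : l.support ⊆ firstIdx I j := fun r hr => by
    simp only [firstIdx, Finset.mem_filter, Finset.mem_range]
    exact ⟨(hj r hr).1, hlI r hr⟩
  have hfreq : freq I ω j v = Finsupp.linearCombination ℚ ω l := by
    rw [Finsupp.linearCombination_apply, Finsupp.sum, freq,
      Finset.sum_coe_sort (firstIdx I j) fun r => ((z r : ℝ) / (j ! : ℝ)) • ω r]
    refine (Finset.sum_subset hsub fun r _ hr => ?_).symm.trans
      (Finset.sum_congr rfl fun r _ => ?_)
    · simp [hz, Finsupp.notMem_support_iff.1 hr]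
    · rw [hz, mul_div_cancel_right₀ _ hfac.ne', Rat.cast_smul_eq_qsmul]
  rw [← hfreq, freqWeight_eq hω hmem, weight]
  have hprod : ∀ r : firstIdx I j, 1 - |(v r : ℝ)| / (j ! : ℝ) ^ 2 =
      1 - |(l r : ℝ)| / (j ! : ℝ) := fun r => by
    rw [hvabs]; field_simp
  rw [Finset.prod_congr rfl fun r _ => hprod r,
    Finset.prod_coe_sort (firstIdx I j) fun r => 1 - |(l r : ℝ)| / (j ! : ℝ)]
  exact Finset.prod_subset hsub fun r _ hr => by simp [Finsupp.notMem_support_iff.1 hr]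

/-- The Bochner-Fejér approximation theorem on `ℝⁿ`. -/
lemma eventually_norm_bfSum_sub_le (hω : LinearIndepOn ℚ ω I) (hf : BohrAP f)
    (hspec : ∀ lam, coef f lam ≠ 0 → lam ∈ Submodule.span ℚ (ω '' I)) {ε : ℝ} (hε : 0 < ε) :
    ∀ᶠ j in atTop, ∀ x, ‖bfSum I ω 1 j f x - f x‖ ≤ ε := by
  obtain ⟨C, hC0, hC⟩ := hf.exists_bound
  -- Uniqueness is applied to `bfSum I ω 1 j f - f`. Its coefficients are those of `f` times
  -- `freqWeight - 1`: only finitely many coefficients of `f` exceed `η`, and for these the weights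
  -- tend to `1`.
  obtain ⟨η, hη, H⟩ := hf.exists_coef_bound (C := 2) (B := 2 * C) zero_le_two (by positivity) hε
  have hfin := finite_coef_gt hf hη
  have h1 : ∀ᶠ j in atTop, ∀ lam ∈ hfin.toFinset, (1 - freqWeight I ω j lam) * C ≤ η := by
    rw [Filter.eventually_all_finset]
    intro lam hlam
    have hne : coef f lam ≠ 0 := fun h0 => by
      have := hfin.mem_toFinset.1 hlam
      simp only [Set.mem_ofPred_eq, h0, norm_zero] at this
      linarith
    have := ((tendsto_freqWeight hω (hspec lam hne)).const_sub 1).mul_const C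
    rw [sub_self, zero_mul] at this
    exact this.eventually_le_const hη
  filter_upwards [h1] with j hj
  refine H _ ?_ ?_ ?_
  · intro s t δ hst x
    have h2 := dominated_bfSum (χ := 1) (j := j) hω hf s t δ hst x
    have h3 := hst x
    have h4 := norm_sub_le (bfSum I ω 1 j f (x + t) - bfSum I ω 1 j f (x + s))
      (f (x + t) - f (x + s))
    rw [show bfSum I ω 1 j f (x + t) - f (x + t) - (bfSum I ω 1 j f (x + s) - f (x + s)) =
      bfSum I ω 1 j f (x + t) - bfSum I ω 1 j f (x + s) - (f (x + t) - f (x + s)) by ring]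
    linarith
  · intro x
    have := norm_bfSum_le (χ := 1) (j := j) hω hf hC x
    have h4 := norm_sub_le (bfSum I ω 1 j f x) (f x)
    linarith [hC x]
  · intro lam
    have hW := freqWeight_mem_Icc (j := j) hω lam
    have e : coef (fun x => bfSum I ω 1 j f x - f x) lam =
        -(((1 - freqWeight I ω j lam : ℝ) : ℂ) * coef f lam) := by
      rw [coef_sub bohrAP_bfSum hf, coef_bfSum]
      simp; ring
    rw [e, norm_neg, norm_mul, Complex.norm_real, Real.norm_of_nonneg (sub_nonneg.2 hW.2)]
    by_cases hl : lam ∈ hfin.toFinset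
    · exact (mul_le_mul_of_nonneg_left (norm_coef_le hf hC lam) (sub_nonneg.2 hW.2)).trans (hj lam hl)
    · have : ‖coef f lam‖ ≤ η := by simpa using hl
      nlinarith [hW.1, hW.2, norm_nonneg (coef f lam)]

/-- Perturbing an exponential sum by a character does not increase its supremum. -/
lemma norm_sum_perturb_le (hω : LinearIndepOn ℚ ω I) {ι : Type*} (S : Finset ι) (c : ι → ℂ)
    (l : ι → Fin n → ℝ) (hl : ∀ i ∈ S, l i ∈ Submodule.span ℚ (ω '' I)) {B : ℝ}
    (hB : ∀ x, ‖∑ i ∈ S, c i * ex (l i) x‖ ≤ B) (x : Fin n → ℝ) :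
    ‖∑ i ∈ S, c i * (χ (l i) : ℂ) * ex (l i) x‖ ≤ B := by
  classical
  set P : (Fin n → ℝ) → ℂ := fun x => ∑ i ∈ S, c i * ex (l i) x with hP
  have hPap : BohrAP P := BohrAP.sum_ex S c l
  -- The perturbed Bochner-Fejér sums of `P` converge to the perturbed sum and are bounded by the
  -- supremum of `P`. The frequencies `l i` may repeat, which is needed when two sums are merged.
  have key : ∀ j, bfSum I ω χ j P x =
      ∑ i ∈ S, (freqWeight I ω j (l i) : ℂ) * (c i * (χ (l i) : ℂ) * ex (l i) x) := by
    intro j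
    have h1 : ∀ i ∈ S, (freqWeight I ω j (l i) : ℂ) * (c i * (χ (l i) : ℂ) * ex (l i) x) =
        ∑ v ∈ tuples I j, if freq I ω j v = l i then (weight I j v : ℂ) *
          (c i * (χ (freq I ω j v) : ℂ) * ex (freq I ω j v) x) else 0 := fun i _ => by
      rw [← sum_weight_eq fun lam => c i * (χ lam : ℂ) * ex lam x]
    rw [Finset.sum_congr rfl h1, Finset.sum_comm, bfSum]
    refine Finset.sum_congr rfl fun v _ => ?_
    rw [hP, coef_sum_ex, Finset.mul_sum, Finset.sum_mul]
    refine Finset.sum_congr rfl fun i _ => ?_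
    simp only [eq_comm (a := l i)]
    split_ifs
    · ring
    · simp
  have hlim : Tendsto (fun j => bfSum I ω χ j P x) atTop
      (𝓝 (∑ i ∈ S, c i * (χ (l i) : ℂ) * ex (l i) x)) := by
    simp only [key]
    refine tendsto_finsetSum S fun i hi => ?_
    have := (Complex.continuous_ofReal.tendsto _).comp (tendsto_freqWeight hω (hl i hi))
    simpa using this.mul_const (c i * (χ (l i) : ℂ) * ex (l i) x)
  exact le_of_tendsto hlim.norm (Eventually.of_forall fun j => norm_bfSum_le hω hPap hB x)

end kernel

/-! ### Almost periodic functions on a tube and their slices -/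

section tube

variable {n m : ℕ} {Ω : Set (Fin n → ℝ)}

/-- The restriction of a function on the tube to the fibre over `y`. -/
def slice (f : (Fin n → ℂ) → ℂ) (y x : Fin n → ℝ) : ℂ := f (cpoint x y)

@[simp] lemma imPart_cpoint (x y : Fin n → ℝ) : imPart (cpoint x y) = y := by
  ext k; simp [imPart, cpoint]

lemma cpoint_re_im (z : Fin n → ℂ) : cpoint (fun k => (z k).re) (imPart z) = z := by
  ext k; simp only [cpoint, imPart]; rw [mul_comm, Complex.re_add_im]

lemma cpoint_add (x t y : Fin n → ℝ) :
    cpoint (x + t) y = fun k => cpoint x y k + (t k : ℂ) := by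
  ext k; simp [cpoint]; ring

lemma cpoint_mem_tube {x y : Fin n → ℝ} {K : Set (Fin n → ℝ)} : cpoint x y ∈ tube K ↔ y ∈ K := by
  simp [tube]

lemma continuous_cpoint :
    Continuous fun p : (Fin n → ℝ) × (Fin n → ℝ) => cpoint p.1 p.2 := by
  unfold cpoint; fun_prop

lemma continuous_imPart : Continuous (imPart : (Fin n → ℂ) → Fin n → ℝ) := by
  unfold imPart
  exact continuous_pi fun k => Complex.continuous_im.comp (continuous_apply k)

lemma isOpen_tube (h : IsOpen Ω) : IsOpen (tube Ω) := h.preimage continuous_imPart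

lemma pairing_cpoint (x y lam : Fin n → ℝ) :
    pairing (cpoint x y) lam = (dotProduct x lam : ℝ) + Complex.I * (dotProduct y lam : ℝ) := by
  simp only [pairing, cpoint, dotProduct, Complex.ofReal_sum, Complex.ofReal_mul, Finset.mul_sum,
    ← Finset.sum_add_distrib]
  exact Finset.sum_congr rfl fun k _ => by ring

lemma exp_pairing (x y lam : Fin n → ℝ) :
    Complex.exp (Complex.I * pairing (cpoint x y) lam) =
      Complex.exp (-(dotProduct y lam : ℝ)) * ex lam x := by
  rw [pairing_cpoint, ex, ← Complex.exp_add]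
  congr 1
  linear_combination ((dotProduct y lam : ℝ) : ℂ) * Complex.I_mul_I

lemma exp_neg_pairing (x y lam : Fin n → ℝ) :
    Complex.exp (-Complex.I * pairing (cpoint x y) lam) =
      Complex.exp (dotProduct y lam : ℝ) * ex (-lam) x := by
  rw [pairing_cpoint, ex, ← Complex.exp_add, dotProduct_neg]
  congr 1
  push_cast
  linear_combination -((dotProduct y lam : ℝ) : ℂ) * Complex.I_mul_I

/-- Scalar holomorphic almost periodic functions on the tube, with almost periods uniform over the
compact subsets of the base. -/
structure TubeAP (Ω : Set (Fin n → ℝ)) (f : (Fin n → ℂ) → ℂ) : Prop where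
  holo : DifferentiableOn ℂ f (tube Ω)
  period : ∀ ε : ℝ, 0 < ε → ∀ K ⊆ Ω, IsCompact K → ∃ T : ℝ, 0 < T ∧ ∀ ξ : Fin n → ℝ,
    ∃ τ : Fin n → ℝ, ‖ξ + τ‖ ≤ T ∧ ∀ y ∈ K, ∀ x, ‖slice f y (x + τ) - slice f y x‖ ≤ ε

lemma IsCompact.relCompactIn {K : Set (Fin n → ℝ)} (hK : IsCompact K) (hKΩ : K ⊆ Ω) :
    RelCompactIn K Ω := by
  rw [RelCompactIn, hK.isClosed.closure_eq]; exact ⟨hK, hKΩ⟩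

lemma IsHAP.tubeAP {F : (Fin n → ℂ) → (Fin m → ℂ)} (hF : IsHAP Ω F) (l : Fin m) :
    TubeAP Ω fun z => F z l := by
  refine ⟨fun z hz => differentiableWithinAt_pi.1 (hF.holomorphic z hz) l, fun ε hε K hKΩ hK => ?_⟩
  obtain ⟨t, ht, h⟩ := hF.almostPeriodic ε hε K (HAP.IsCompact.relCompactIn hK hKΩ)
  refine ⟨‖t‖ + 1, by positivity, fun ξ => ?_⟩
  -- An almost period near `-ξ` brings `ξ` back into a fixed box.
  obtain ⟨τ, hτ, hz⟩ := h (-ξ)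
  refine ⟨τ, (pi_norm_le_iff_of_nonneg (by positivity)).2 fun k => ?_, fun y hy x => ?_⟩
  · have h1 := hτ k
    have h2 := norm_le_pi_norm t k
    rw [Real.norm_eq_abs, abs_of_pos (ht k)] at h2
    rw [Pi.neg_apply, sub_neg_eq_add, add_comm] at h1
    rw [Pi.add_apply, Real.norm_eq_abs]
    linarith
  · have h1 := (hz (cpoint x y) (cpoint_mem_tube.2 hy)).le
    rw [← cpoint_add] at h1
    exact (norm_le_pi_norm (F (cpoint (x + τ) y) - F (cpoint x y)) l).trans h1

namespace TubeAP

variable {f : (Fin n → ℂ) → ℂ} {K : Set (Fin n → ℝ)}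

lemma continuousOn (hf : TubeAP Ω f) :
    ContinuousOn (fun p : (Fin n → ℝ) × (Fin n → ℝ) => slice f p.2 p.1) (Set.univ ×ˢ Ω) :=
  hf.holo.continuousOn.comp continuous_cpoint.continuousOn fun _ hp => cpoint_mem_tube.2 hp.2

/-- Almost periods move every `x` into a fixed compact box, where continuity gives the bound;
uniform continuity and the nets of translates are obtained in the same way. -/
lemma exists_bound (hf : TubeAP Ω f) (hKΩ : K ⊆ Ω) (hK : IsCompact K) :
    ∃ C : ℝ, 0 ≤ C ∧ ∀ y ∈ K, ∀ x, ‖slice f y x‖ ≤ C := by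
  obtain ⟨T, hT, h⟩ := hf.period 1 one_pos K hKΩ hK
  obtain ⟨C, hC⟩ := ((isCompact_closedBall (0 : Fin n → ℝ) T).prod hK).exists_bound_of_continuousOn
    (hf.continuousOn.mono (Set.prod_mono (Set.subset_univ _) hKΩ))
  refine ⟨|C| + 1, by positivity, fun y hy x => ?_⟩
  obtain ⟨τ, hτ, h'⟩ := h x
  have h1 := h' y hy x
  have h2 := hC (x + τ, y) ⟨by simpa using hτ, hy⟩
  have h3 := norm_le_norm_add_norm_sub (slice f y (x + τ)) (slice f y x)
  simp only at h2
  linarith [le_abs_self C]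

lemma uniformContinuity (hf : TubeAP Ω f) (hKΩ : K ⊆ Ω) (hK : IsCompact K) {ε : ℝ} (hε : 0 < ε) :
    ∃ δ : ℝ, 0 < δ ∧ ∀ y ∈ K, ∀ y' ∈ K, ∀ x x' : Fin n → ℝ, ‖x - x'‖ < δ → ‖y - y'‖ < δ →
      ‖slice f y x - slice f y' x'‖ ≤ ε := by
  obtain ⟨T, hT, h⟩ := hf.period (ε / 3) (by positivity) K hKΩ hK
  have huc := ((isCompact_closedBall (0 : Fin n → ℝ) (T + 1)).prod
    hK).uniformContinuousOn_of_continuous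
    (hf.continuousOn.mono (Set.prod_mono (Set.subset_univ _) hKΩ))
  obtain ⟨δ, hδ, H⟩ := Metric.uniformContinuousOn_iff.1 huc (ε / 3) (by positivity)
  refine ⟨min δ 1, lt_min hδ one_pos, fun y hy y' hy' x x' hx hyy => ?_⟩
  obtain ⟨τ, hτ, h'⟩ := h x
  have hx1 : ‖x' + τ‖ ≤ T + 1 := by
    have := norm_sub_le (x + τ) (x - x')
    rw [show x + τ - (x - x') = x' + τ by abel] at this
    linarith [hx.trans_le (min_le_right δ 1)]
  have h1 := H (x + τ, y) ⟨by simp; linarith, hy⟩ (x' + τ, y') ⟨by simpa using hx1, hy'⟩ (by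
    rw [Prod.dist_eq, max_lt_iff]
    simp only [dist_eq_norm, add_sub_add_right_eq_sub]
    exact ⟨hx.trans_le (min_le_left _ _), hyy.trans_le (min_le_left _ _)⟩)
  rw [dist_eq_norm] at h1
  have h2 := h' y hy x
  have h3 := h' y' hy' x'
  rw [norm_sub_rev] at h2
  have h4 := norm_sub_le_norm_sub_add_norm_sub (slice f y x) (slice f y (x + τ)) (slice f y' x')
  have h5 := norm_sub_le_norm_sub_add_norm_sub (slice f y (x + τ)) (slice f y' (x' + τ))
    (slice f y' x')
  simp only at h1
  linarith

lemma bohrAP_slice (hf : TubeAP Ω f) {y : Fin n → ℝ} (hy : y ∈ Ω) : BohrAP (slice f y) := by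
  have hyΩ : ({y} : Set (Fin n → ℝ)) ⊆ Ω := Set.singleton_subset_iff.2 hy
  constructor
  · intro ε hε
    obtain ⟨δ, hδ, H⟩ := hf.uniformContinuity hyΩ isCompact_singleton hε
    exact ⟨δ, hδ, fun u hu x => H y rfl y rfl _ _ (by simpa using hu) (by simpa using hδ)⟩
  · intro ε hε
    obtain ⟨δ, hδ, H⟩ := hf.uniformContinuity hyΩ isCompact_singleton (half_pos hε)
    obtain ⟨T, hT, h⟩ := hf.period (ε / 2) (half_pos hε) {y} hyΩ isCompact_singleton
    obtain ⟨S, -, hSf, hS⟩ := (isCompact_closedBall (0 : Fin n → ℝ) T).finite_cover_balls hδ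
    refine ⟨hSf.toFinset, fun t => ?_⟩
    obtain ⟨τ, hτ, h'⟩ := h t
    have hmem : t + τ ∈ Metric.closedBall (0 : Fin n → ℝ) T := by simpa using hτ
    obtain ⟨s, hs, hts⟩ := Set.mem_iUnion₂.1 (hS hmem)
    refine ⟨s, hSf.mem_toFinset.2 hs, fun x => ?_⟩
    rw [Metric.mem_ball, dist_eq_norm] at hts
    have h1 := H y rfl y rfl (x + (t + τ)) (x + s) (by simpa using hts) (by simpa using hδ)
    have h2 := h' y rfl (x + t)
    rw [norm_sub_rev, add_assoc] at h2
    have h3 := norm_sub_le_norm_sub_add_norm_sub (slice f y (x + t)) (slice f y (x + (t + τ)))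
      (slice f y (x + s))
    linarith

end TubeAP

/-! ### Independence of the mean from the fibre -/

section contour

/-- Averaging over a segment of translations does not change the mean. -/
lemma tendsto_integral_segment {p : (Fin n → ℝ) → ℂ} (hp : BohrAP p) {R : ℝ} (hR : 0 < R)
    (v : Fin n → ℝ) :
    Tendsto (fun s => ∫ x, (∫ a in (0 : ℝ)..R, p (x + a • v)) ∂cubeProb n s) atTop
      (𝓝 (R * mean p)) := by
  obtain ⟨C, hC0, hC⟩ := hp.exists_bound
  rw [Metric.tendsto_nhds]
  intro ε hε
  filter_upwards [hp.eventually_norm_sub_mean_le (show 0 < ε / 2 / R by positivity)] with s hs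
  have hcont : Continuous (Function.uncurry fun (x : Fin n → ℝ) (a : ℝ) => p (x + a • v)) :=
    hp.continuous.comp (by fun_prop)
  have hint : Integrable (Function.uncurry fun (x : Fin n → ℝ) (a : ℝ) => p (x + a • v))
      ((cubeProb n s).prod (volume.restrict (Set.Ioc 0 R))) :=
    Integrable.of_bound hcont.aestronglyMeasurable C (Eventually.of_forall fun _ => hC _)
  have e1 : ∫ x, (∫ a in (0 : ℝ)..R, p (x + a • v)) ∂cubeProb n s =
      ∫ a in (0 : ℝ)..R, ∫ x, p (x + a • v) ∂cubeProb n s := by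
    simp only [intervalIntegral.integral_of_le hR.le]
    exact integral_integral_swap hint
  have hi : IntervalIntegrable (fun a : ℝ => ∫ x, p (x + a • v) ∂cubeProb n s) volume 0 R :=
    (intervalIntegrable_iff_integrableOn_Ioc_of_le hR.le).2 hint.integral_prod_right
  have e2 : (R : ℂ) * mean p = ∫ _ in (0 : ℝ)..R, mean p := by simp
  rw [dist_eq_norm, e1, e2, ← intervalIntegral.integral_sub hi intervalIntegrable_const]
  have := intervalIntegral.norm_integral_le_of_norm_le_const (a := 0) (b := R)
    (f := fun a => (∫ x, p (x + a • v) ∂cubeProb n s) - mean p) fun a _ => hs (a • v)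
  refine this.trans_lt ?_
  rw [sub_zero, abs_of_pos hR, div_mul_cancel₀ _ hR.ne']
  linarith

/-- The mean of a bounded holomorphic function with almost periodic slices does not depend on the
slice. -/
lemma mean_slice_eq {g : (Fin n → ℂ) → ℂ} (hΩ : Convex ℝ Ω) (hg : DifferentiableOn ℂ g (tube Ω))
    {y₀ y₁ : Fin n → ℝ} (h₀ : y₀ ∈ Ω) (h₁ : y₁ ∈ Ω) (hap₀ : BohrAP (slice g y₀))
    (hap₁ : BohrAP (slice g y₁)) {B : ℝ} (hB : ∀ y ∈ segment ℝ y₀ y₁, ∀ x, ‖slice g y x‖ ≤ B) :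
    mean (slice g y₀) = mean (slice g y₁) := by
  have hB0 : 0 ≤ B := (norm_nonneg _).trans (hB y₀ (left_mem_segment ℝ _ _) 0)
  set v := y₁ - y₀ with hv
  have hseg : ∀ b ∈ Set.Icc (0 : ℝ) 1, y₀ + b • v ∈ segment ℝ y₀ y₁ := fun b hb => by
    rw [segment_eq_image']; exact ⟨b, hb, rfl⟩
  have hsegΩ := hΩ.segment_subset h₀ h₁
  have key : ∀ R : ℝ, 0 < R → R * ‖mean (slice g y₀) - mean (slice g y₁)‖ ≤ 2 * B := by
    intro R hR
    have hD : ∀ x, ‖(∫ a in (0 : ℝ)..R, slice g y₀ (x + a • v)) -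
        ∫ a in (0 : ℝ)..R, slice g y₁ (x + a • v)‖ ≤ 2 * B := by
      intro x
      -- Cauchy's theorem is used on the rectangle with sides `R` and `1` in the complex line
      -- through `cpoint x y₀` directed by `v`. The horizontal sides lie over `y₀` and `y₁`; the
      -- vertical ones contribute at most `B` each.
      set G : ℂ → ℂ := fun w => g fun k => cpoint x y₀ k + w * (v k : ℂ) with hG
      have hGab : ∀ a b : ℝ, G (a + b * Complex.I) = slice g (y₀ + b • v) (x + a • v) := by
        intro a b
        simp only [hG, slice]
        congr 1
        ext k
        simp [cpoint]
        ring
      have hdiff : DifferentiableOn ℂ G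
          (Set.uIcc (0 : ℂ).re (R + Complex.I : ℂ).re ×ℂ
            Set.uIcc (0 : ℂ).im (R + Complex.I : ℂ).im) := by
        refine hg.comp (by fun_prop) fun w hw => ?_
        have him : w.im ∈ Set.Icc (0 : ℝ) 1 := by
          have := (Complex.mem_reProdIm.1 hw).2
          simpa [Set.uIcc_of_le] using this
        have : imPart (fun k => cpoint x y₀ k + w * (v k : ℂ)) = y₀ + w.im • v := by
          ext k; simp [imPart, cpoint]
        change imPart (fun k => cpoint x y₀ k + w * (v k : ℂ)) ∈ Ω
        rw [this]
        exact hsegΩ (hseg _ him)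
      have hrect := Complex.integral_boundary_rect_eq_zero_of_differentiableOn G 0
        (R + Complex.I) hdiff
      have hside : ∀ a : ℝ, ‖∫ b in (0 : ℝ)..1, G (a + b * Complex.I)‖ ≤ B := by
        intro a
        have := intervalIntegral.norm_integral_le_of_norm_le_const (a := 0) (b := 1)
          (f := fun b : ℝ => G (a + b * Complex.I)) (C := B) fun b hb => by
            rw [hGab]
            rw [Set.uIoc_of_le zero_le_one] at hb
            exact hB _ (hseg b ⟨hb.1.le, hb.2⟩) _
        simpa using this
      have e0 : ∀ a : ℝ, G a = slice g y₀ (x + a • v) := fun a => by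
        have := hGab a 0; simpa using this
      have e1 : ∀ a : ℝ, G (a + Complex.I) = slice g y₁ (x + a • v) := fun a => by
        have := hGab a 1; simpa [hv] using this
      have hs0 := hside 0
      have hsR := hside R
      simp only [Complex.zero_re, Complex.add_re, Complex.ofReal_re, Complex.I_re, add_zero,
        Complex.zero_im, Complex.add_im, Complex.ofReal_im, Complex.I_im, zero_add,
        Complex.ofReal_zero, zero_mul, Complex.ofReal_one, one_mul, e0, e1, smul_eq_mul] at hrect hs0
      set P := ∫ a in (0 : ℝ)..R, slice g y₀ (x + a • v)
      set Q := ∫ a in (0 : ℝ)..R, slice g y₁ (x + a • v)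
      set U := ∫ b in (0 : ℝ)..1, G (R + b * Complex.I)
      set W := ∫ b in (0 : ℝ)..1, G (b * Complex.I)
      have : P - Q = Complex.I * W - Complex.I * U := by linear_combination hrect
      rw [this]
      refine (norm_sub_le _ _).trans ?_
      rw [norm_mul, norm_mul, Complex.norm_I]
      linarith
    have hlim := (tendsto_integral_segment hap₀ hR v).sub (tendsto_integral_segment hap₁ hR v)
    rw [← mul_sub] at hlim
    have hle := le_of_tendsto hlim.norm (Eventually.of_forall fun s => by
      have hI : ∀ {p : (Fin n → ℝ) → ℂ}, BohrAP p →
          Integrable (fun x => ∫ a in (0 : ℝ)..R, p (x + a • v)) (cubeProb n s) := by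
        intro p hp
        obtain ⟨C, hC0, hC⟩ := hp.exists_bound
        have hcont : Continuous (Function.uncurry fun (x : Fin n → ℝ) (a : ℝ) => p (x + a • v)) :=
          hp.continuous.comp (by fun_prop)
        have hint : Integrable (Function.uncurry fun (x : Fin n → ℝ) (a : ℝ) => p (x + a • v))
            ((cubeProb n s).prod (volume.restrict (Set.Ioc 0 R))) :=
          Integrable.of_bound hcont.aestronglyMeasurable C (Eventually.of_forall fun _ => hC _)
        simp only [intervalIntegral.integral_of_le hR.le]
        exact hint.integral_prod_left
      rw [← integral_sub (hI hap₀) (hI hap₁)]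
      exact norm_integral_cubeProb_le (by positivity) hD)
    rwa [norm_mul, Complex.norm_real, Real.norm_of_nonneg hR.le] at hle
  rw [← sub_eq_zero, ← norm_le_zero_iff]
  by_contra! hpos
  -- This `R` would give `2 * B + 1 ≤ 2 * B`.
  have := key ((2 * B + 1) / ‖mean (slice g y₀) - mean (slice g y₁)‖) (by positivity)
  rw [div_mul_cancel₀ _ hpos.ne'] at this
  linarith

end contour

/-! ### The Bohr transform and the coefficients of slices -/

section bohr

variable {f : (Fin n → ℂ) → ℂ}

lemma bohrMean_eq (f : (Fin n → ℂ) → ℂ) (lam y : Fin n → ℝ) {s : ℝ} (hs : 0 < s) :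
    bohrMean f lam y s = ∫ x, Complex.exp (dotProduct y lam : ℝ) *
      (slice f y x * ex (-lam) x) ∂cubeProb n s := by
  have hset : {x : Fin n → ℝ | ∀ j, |x j| < s} = Metric.ball 0 s := by
    ext x; simp [pi_norm_lt_iff hs]
  rw [bohrMean, hset, integral_cubeProb hs, Complex.real_smul]
  congr 1
  · push_cast; rfl
  · simp only [exp_neg_pairing, slice]
    congr 1; ext x; ring

lemma tendsto_bohrMean {lam y : Fin n → ℝ} (hy : BohrAP (slice f y)) :
    Tendsto (bohrMean f lam y) atTop
      (𝓝 (Complex.exp (dotProduct y lam : ℝ) * coef (slice f y) lam)) := by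
  have h := hy.mul (BohrAP.ex (-lam))
  rw [coef, ← mean_const_mul h]
  refine (h.const_mul _).tendsto_mean.congr' ?_
  filter_upwards [eventually_gt_atTop 0] with s hs
  rw [bohrMean_eq f lam y hs]

lemma bohr_eq_of_tendsto (hΩ : Ω.Nonempty) {lam : Fin n → ℝ} {c : ℂ}
    (h : ∀ y ∈ Ω, Tendsto (bohrMean f lam y) atTop (𝓝 c)) : bohr Ω f lam = c := by
  obtain ⟨y, hy⟩ := hΩ
  have : ∀ y ∈ Ω, Tendsto (bohrMean f lam y) atTop (𝓝 (bohr Ω f lam)) :=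
    Classical.epsilon_spec (p := fun c : ℂ => ∀ y ∈ Ω, Tendsto (bohrMean f lam y) atTop (𝓝 c))
      ⟨c, h⟩
  exact tendsto_nhds_unique (this y hy) (h y hy)

/-- The mean of `e^{-i⟨z, lam⟩} f` is the same on all fibres; the required bound comes from
compactness of the segment joining two of them. This also shows that the limit selected in `bohr`
exists. -/
lemma TubeAP.bohr_eq (hΩ : Convex ℝ Ω) (hf : TubeAP Ω f) {y : Fin n → ℝ} (hy : y ∈ Ω)
    (lam : Fin n → ℝ) :
    bohr Ω f lam = Complex.exp (dotProduct y lam : ℝ) * coef (slice f y) lam := by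
  refine bohr_eq_of_tendsto ⟨y, hy⟩ fun y' hy' => ?_
  set g : (Fin n → ℂ) → ℂ := fun z => Complex.exp (-Complex.I * pairing z lam) * f z with hg
  have hslice : ∀ y, slice g y = fun x =>
      Complex.exp (dotProduct y lam : ℝ) * (slice f y x * ex (-lam) x) := fun y => by
    ext x
    simp only [slice, hg, exp_neg_pairing]; ring
  have hap : ∀ y ∈ Ω, BohrAP (slice g y) := fun y hy => by
    rw [hslice]
    exact ((hf.bohrAP_slice hy).mul (BohrAP.ex _)).const_mul _
  have hgd : DifferentiableOn ℂ g (tube Ω) := by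
    refine DifferentiableOn.mul (Differentiable.differentiableOn ?_) hf.holo
    unfold pairing; fun_prop
  have hsegΩ := hΩ.segment_subset hy' hy
  have hcomp : IsCompact (segment ℝ y' y) := by
    rw [← convexHull_pair]
    exact (Set.toFinite _).isCompact_convexHull ℝ
  obtain ⟨C, hC0, hC⟩ := hf.exists_bound hsegΩ hcomp
  obtain ⟨D, hD⟩ := hcomp.exists_bound_of_continuousOn (f := fun y : Fin n → ℝ =>
    Complex.exp (dotProduct y lam : ℝ)) (by unfold dotProduct; fun_prop)
  have key := mean_slice_eq hΩ hgd hy' hy (hap y' hy') (hap y hy) (B := D * C) fun u hu x => by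
    rw [hslice, norm_mul, norm_mul, norm_ex, mul_one]
    exact mul_le_mul (hD u hu) (hC u hu x) (norm_nonneg _) ((norm_nonneg _).trans (hD u hu))
  have h := tendsto_bohrMean (lam := lam) (hf.bohrAP_slice hy')
  rw [hslice, hslice, mean_const_mul ((hf.bohrAP_slice hy').mul (BohrAP.ex _)),
    mean_const_mul ((hf.bohrAP_slice hy).mul (BohrAP.ex _)), ← coef, ← coef] at key
  rwa [key] at h

lemma TubeAP.bohr_mul_exp (hΩ : Convex ℝ Ω) (hf : TubeAP Ω f) {y : Fin n → ℝ} (hy : y ∈ Ω)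
    (lam x : Fin n → ℝ) :
    bohr Ω f lam * Complex.exp (Complex.I * pairing (cpoint x y) lam) =
      coef (slice f y) lam * ex lam x := by
  rw [hf.bohr_eq hΩ hy, exp_pairing, Complex.exp_neg]
  field_simp [Complex.exp_ne_zero]

lemma TubeAP.bohr_ne_zero_iff (hΩ : Convex ℝ Ω) (hf : TubeAP Ω f) {y : Fin n → ℝ} (hy : y ∈ Ω)
    (lam : Fin n → ℝ) : bohr Ω f lam ≠ 0 ↔ coef (slice f y) lam ≠ 0 := by
  rw [hf.bohr_eq hΩ hy]
  simp [Complex.exp_ne_zero]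

lemma bohr_expSum (hΩ : Ω.Nonempty) {ι : Type*} (S : Finset ι) (c : ι → ℂ) (l : ι → Fin n → ℝ)
    (lam : Fin n → ℝ) :
    bohr Ω (fun z => ∑ i ∈ S, c i * Complex.exp (Complex.I * pairing z (l i))) lam =
      open Classical in ∑ i ∈ S, if l i = lam then c i else 0 := by
  classical
  refine bohr_eq_of_tendsto hΩ fun y _ => ?_
  set q : (Fin n → ℂ) → ℂ := fun z => ∑ i ∈ S, c i * Complex.exp (Complex.I * pairing z (l i))
  have hs : slice q y = fun x =>
      ∑ i ∈ S, (c i * Complex.exp (-(dotProduct y (l i) : ℝ))) * ex (l i) x := by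
    ext x
    simp only [slice, q, exp_pairing, mul_assoc]
  have h := tendsto_bohrMean (f := q) (lam := lam) (y := y) (by rw [hs]; exact BohrAP.sum_ex _ _ _)
  convert h using 2
  rw [hs, coef_sum_ex, Finset.mul_sum]
  refine Finset.sum_congr rfl fun i _ => ?_
  split_ifs with hi
  · rw [hi, mul_left_comm, ← Complex.exp_add]; simp
  · simp

variable {I : Set ℕ} {ω : ℕ → Fin n → ℝ} {𝔾 : AddSubgroup (Fin n → ℝ)}

lemma bochnerFejer_eq (I : Set ℕ) (ω : ℕ → Fin n → ℝ) (j : ℕ) (f : (Fin n → ℂ) → ℂ) :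
    bochnerFejer Ω I ω j f = fun z => ∑ v ∈ tuples I j,
      ((weight I j v : ℂ) * bohr Ω f (freq I ω j v)) *
        Complex.exp (Complex.I * pairing z (freq I ω j v)) := by
  ext z
  simp only [bochnerFejer, tuples, weight, Complex.ofReal_prod]

/-- The perturbed Bochner-Fejér sums of an almost periodic function restrict to the perturbed sums
of its slices. -/
lemma TubeAP.expPerturb_bochnerFejer (hΩ : Convex ℝ Ω) (hf : TubeAP Ω f)
    (hω : LinearIndepOn ℚ ω I) (hspec : spec Ω f ⊆ 𝔾) {χ : AddChar (Fin n → ℝ) Circle}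
    {χ₀ : AddChar 𝔾 Circle} (hχ : ∀ g : 𝔾, χ g = χ₀ g) (j : ℕ) {y : Fin n → ℝ} (hy : y ∈ Ω)
    (x : Fin n → ℝ) :
    expPerturb Ω χ₀ (bochnerFejer Ω I ω j f) (cpoint x y) = bfSum I ω χ j (slice f y) x := by
  classical
  set q := bochnerFejer Ω I ω j f with hq
  have hbq : ∀ lam, bohr Ω q lam = ∑ v ∈ tuples I j, if freq I ω j v = lam then
      (weight I j v : ℂ) * bohr Ω f (freq I ω j v) else 0 := fun lam => by
    rw [hq, bochnerFejer_eq, bohr_expSum ⟨y, hy⟩]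
  have hbv : ∀ v ∈ tuples I j, bohr Ω q (freq I ω j v) =
      (weight I j v : ℂ) * bohr Ω f (freq I ω j v) := fun v hv => by
    rw [hbq]
    simp only [(freq_injective hω).eq_iff]
    rw [Finset.sum_ite_eq' _ v, if_pos hv]
  have hsub : Function.support (fun lam => (spec Ω q).indicator (fun lam =>
      bohr Ω q lam * charVal χ₀ lam * Complex.exp (Complex.I * pairing (cpoint x y) lam)) lam) ⊆
      ((tuples I j).image (freq I ω j) : Finset (Fin n → ℝ)) := by
    intro lam hlam
    have hmem : lam ∈ spec Ω q := Set.mem_of_indicator_ne_zero hlam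
    by_contra hnot
    refine hmem ?_
    rw [hbq]
    refine Finset.sum_eq_zero fun v hv => if_neg fun h => hnot ?_
    rw [← h]
    exact Finset.mem_coe.2 (Finset.mem_image_of_mem _ hv)
  rw [expPerturb, finsum_mem_def, finsum_eq_sum_of_support_subset _ hsub,
    Finset.sum_image fun a _ b _ h => freq_injective hω h, bfSum]
  refine Finset.sum_congr rfl fun v hv => ?_
  have h1 : (spec Ω q).indicator (fun lam => bohr Ω q lam * charVal χ₀ lam *
      Complex.exp (Complex.I * pairing (cpoint x y) lam)) (freq I ω j v) =
      bohr Ω q (freq I ω j v) * charVal χ₀ (freq I ω j v) *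
        Complex.exp (Complex.I * pairing (cpoint x y) (freq I ω j v)) := by
    by_cases h : freq I ω j v ∈ spec Ω q
    · rw [Set.indicator_of_mem h]
    · have h0 : bohr Ω q (freq I ω j v) = 0 := not_not.1 h
      rw [Set.indicator_of_notMem h, h0, zero_mul, zero_mul]
  rw [h1, hbv v hv, mul_assoc _ (coef _ _), ← hf.bohr_mul_exp hΩ hy]
  -- A frequency outside `𝔾` is outside the spectrum, so the default value `0` of `charVal` only
  -- meets vanishing terms.
  by_cases h : bohr Ω f (freq I ω j v) = 0
  · simp [h]
  · have hmem : freq I ω j v ∈ 𝔾 := hspec h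
    have : charVal χ₀ (freq I ω j v) = (χ (freq I ω j v) : ℂ) := by
      rw [charVal, dif_pos hmem, ← hχ ⟨_, hmem⟩]
    rw [this]; ring

end bohr

end tube

/-! ### Locally uniform limits of holomorphic functions of several variables -/

section holomorphic

variable {E : Type*} [NormedAddCommGroup E] [NormedSpace ℂ E]

/-- Cauchy's estimate for the derivative of a bounded holomorphic function of several variables. -/
lemma norm_fderiv_le_of_closedBall {h : E → ℂ} {w : E} {r C : ℝ} (hr : 0 < r) {U : Set E}
    (hU : IsOpen U) (hsub : Metric.closedBall w r ⊆ U) (hh : DifferentiableOn ℂ h U)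
    (hC : ∀ z ∈ Metric.closedBall w r, ‖h z‖ ≤ C) : ‖fderiv ℂ h w‖ ≤ C / r := by
  have hw : w ∈ Metric.closedBall w r := Metric.mem_closedBall_self hr.le
  have hC0 : 0 ≤ C := (norm_nonneg _).trans (hC w hw)
  refine ContinuousLinearMap.opNorm_le_bound _ (by positivity) fun v => ?_
  rcases eq_or_ne v 0 with rfl | hv
  · simp
  have hvpos : 0 < ‖v‖ := norm_pos_iff.2 hv
  have hmem : ∀ t ∈ Metric.closedBall (0 : ℂ) (r / ‖v‖), w + t • v ∈ Metric.closedBall w r := by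
    intro t ht
    rw [mem_closedBall_zero_iff, le_div_iff₀ hvpos] at ht
    simpa [norm_smul] using ht
  -- Restriction to the complex line `w + t v` reduces the estimate to one variable.
  have hline : ∀ t : ℂ, HasDerivAt (fun t : ℂ => w + t • v) v t := fun t => by
    simpa using ((hasDerivAt_id t).smul_const v).const_add w
  have hdiff : ∀ t ∈ Metric.closedBall (0 : ℂ) (r / ‖v‖),
      HasDerivAt (fun t : ℂ => h (w + t • v)) (fderiv ℂ h (w + t • v) v) t := fun t ht =>
    ((hh _ (hsub (hmem t ht))).differentiableAt
      (hU.mem_nhds (hsub (hmem t ht)))).hasFDerivAt.comp_hasDerivAt t (hline t)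
  have hdc : DiffContOnCl ℂ (fun t : ℂ => h (w + t • v)) (Metric.ball 0 (r / ‖v‖)) := by
    refine DifferentiableOn.diffContOnCl fun t ht => ?_
    rw [closure_ball _ (by positivity)] at ht
    exact (hdiff t ht).differentiableAt.differentiableWithinAt
  have h1 := Complex.norm_deriv_le_of_forall_mem_sphere_norm_le (by positivity) hdc
    fun t ht => hC _ (hmem t (Metric.sphere_subset_closedBall ht))
  rw [(hdiff 0 (Metric.mem_closedBall_self (by positivity))).deriv] at h1
  simp only [zero_smul, add_zero] at h1
  refine h1.trans (le_of_eq ?_)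
  field_simp

/-- Locally uniform limits of holomorphic functions of several variables are holomorphic. -/
lemma differentiableOn_of_tendstoUniformlyOn_nhds {U : Set E} (hU : IsOpen U)
    {f : ℕ → E → ℂ} {g : E → ℂ} (hf : ∀ j, DifferentiableOn ℂ (f j) U)
    (hlim : ∀ z ∈ U, ∃ t ∈ 𝓝 z, TendstoUniformlyOn f g atTop t) : DifferentiableOn ℂ g U := by
  intro z hz
  obtain ⟨t, ht, htu⟩ := hlim z hz
  obtain ⟨r, hr, hball⟩ := Metric.mem_nhds_iff.1 (Filter.inter_mem ht (hU.mem_nhds hz))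
  have hr2 : 0 < r / 2 := half_pos hr
  have hcb : ∀ w ∈ Metric.ball z (r / 2), Metric.closedBall w (r / 4) ⊆ t ∩ U := fun w hw => by
    refine (Metric.closedBall_subset_ball' ?_).trans hball
    rw [Metric.mem_ball] at hw
    linarith
  -- Balls of radius `r / 4` around points of the half ball stay inside the ball of radius `r`, so
  -- Cauchy's estimate passes the uniform Cauchy property to the derivatives.
  have hcauchy : UniformCauchySeqOn (fun j => fderiv ℂ (f j)) atTop (Metric.ball z (r / 2)) := by
    rw [Metric.uniformCauchySeqOn_iff]
    intro ε hε
    obtain ⟨N, hN⟩ := Metric.uniformCauchySeqOn_iff.1 htu.uniformCauchySeqOn (ε * (r / 4) / 2)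
      (by positivity)
    refine ⟨N, fun j hj k hk w hw => ?_⟩
    have hwU : w ∈ U := (hcb w hw (Metric.mem_closedBall_self (by positivity))).2
    have hd : ∀ i, DifferentiableAt ℂ (f i) w := fun i =>
      (hf i w hwU).differentiableAt (hU.mem_nhds hwU)
    rw [dist_eq_norm, ← fderiv_sub (hd j) (hd k)]
    refine (norm_fderiv_le_of_closedBall (r := r / 4) (by positivity) hU
      ((hcb w hw).trans Set.inter_subset_right) ((hf j).sub (hf k))
      (C := ε * (r / 4) / 2) fun x hx => ?_).trans_lt ?_
    · have := (hN j hj k hk x (hcb w hw hx).1).le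
      rwa [dist_eq_norm] at this
    · rw [div_lt_iff₀ (by positivity)]
      have : 0 < ε * (r / 4) := by positivity
      linarith
  have hex : ∀ w, ∃ L : E →L[ℂ] ℂ, w ∈ Metric.ball z (r / 2) →
      Tendsto (fun j => fderiv ℂ (f j) w) atTop (𝓝 L) := fun w => by
    by_cases hw : w ∈ Metric.ball z (r / 2)
    · obtain ⟨L, hL⟩ := cauchySeq_tendsto_of_complete (hcauchy.cauchySeq hw)
      exact ⟨L, fun _ => hL⟩
    · exact ⟨0, fun h => absurd h hw⟩
  choose g' hg' using hex
  have hunif := hcauchy.tendstoUniformlyOn_of_tendsto fun w hw => hg' w hw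
  have hz2 : z ∈ Metric.ball z (r / 2) := Metric.mem_ball_self hr2
  refine (hasFDerivAt_of_tendstoUniformlyOn (f := f) Metric.isOpen_ball hunif (fun j w hw => ?_)
    (fun w hw => ?_) hz2).differentiableAt.differentiableWithinAt
  · have hwU : w ∈ U := (hcb w hw (Metric.mem_closedBall_self (by positivity))).2
    exact ((hf j w hwU).differentiableAt (hU.mem_nhds hwU)).hasFDerivAt
  · exact htu.tendsto_at (hcb w hw (Metric.mem_closedBall_self (by positivity))).1

end holomorphic

/-! ### Convergence of the perturbed sums, uniformly in the character -/

section limit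

variable {n : ℕ} {Ω : Set (Fin n → ℝ)} {I I' : Set ℕ} {ω ω' : ℕ → Fin n → ℝ}
  {f : (Fin n → ℂ) → ℂ} {χ : AddChar (Fin n → ℝ) Circle} {K : Set (Fin n → ℝ)}

lemma freq_mem_span (j : ℕ) (v : firstIdx I j → ℤ) :
    freq I ω j v ∈ Submodule.span ℚ (ω '' I) := by
  refine Submodule.sum_mem _ fun r _ => ?_
  have : ((v r : ℝ) / (j ! : ℝ)) • ω r = ((v r : ℚ) / (j ! : ℚ)) • ω r := by
    rw [← Rat.cast_smul_eq_qsmul ℝ]; push_cast; rfl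
  rw [this]
  refine Submodule.smul_mem _ _ (Submodule.subset_span ⟨r, ?_, rfl⟩)
  have := r.2
  simp only [firstIdx, Finset.mem_filter] at this
  exact this.2

/-- Perturbation does not increase the distance between two Bochner-Fejér sums. -/
lemma norm_bfSum_sub_bfSum_le (hω : LinearIndepOn ℚ ω I)
    (hspan : Submodule.span ℚ (ω' '' I') = Submodule.span ℚ (ω '' I)) {j k : ℕ}
    {p q : (Fin n → ℝ) → ℂ} {B : ℝ}
    (hB : ∀ x, ‖bfSum I ω 1 j p x - bfSum I' ω' 1 k q x‖ ≤ B) (x : Fin n → ℝ) :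
    ‖bfSum I ω χ j p x - bfSum I' ω' χ k q x‖ ≤ B := by
  -- The difference of the two sums is written as one exponential sum over the disjoint union of the
  -- tuples, so that `norm_sum_perturb_le` applies with `ψ = 1` as the unperturbed case.
  set c : (firstIdx I j → ℤ) ⊕ (firstIdx I' k → ℤ) → ℂ :=
    Sum.elim (fun v => (weight I j v : ℂ) * coef p (freq I ω j v))
      fun v => -((weight I' k v : ℂ) * coef q (freq I' ω' k v)) with hc
  set l : (firstIdx I j → ℤ) ⊕ (firstIdx I' k → ℤ) → Fin n → ℝ :=
    Sum.elim (freq I ω j) (freq I' ω' k) with hl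
  have key : ∀ (ψ : AddChar (Fin n → ℝ) Circle) (x : Fin n → ℝ),
      ∑ i ∈ (tuples I j).disjSum (tuples I' k), c i * (ψ (l i) : ℂ) * ex (l i) x =
        bfSum I ω ψ j p x - bfSum I' ω' ψ k q x := by
    intro ψ x
    rw [Finset.sum_disjSum, sub_eq_add_neg, bfSum, bfSum, ← Finset.sum_neg_distrib]
    congr 1
    · refine Finset.sum_congr rfl fun v _ => ?_
      simp only [hc, hl, Sum.elim_inl]; ring
    · refine Finset.sum_congr rfl fun v _ => ?_
      simp only [hc, hl, Sum.elim_inr]; ring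
  rw [← key]
  refine norm_sum_perturb_le hω _ c l ?_ (fun y => ?_) x
  · rintro (v | v) _
    · exact freq_mem_span j v
    · rw [← hspan]; exact freq_mem_span k v
  · have := hB y
    rw [← key] at this
    simpa using this

/-- The contraction property carries the approximation from `y₀` to neighbouring fibres at the cost
of the distance of the slices; compactness of `K` does the rest. -/
lemma TubeAP.eventually_norm_bfSum_slice_sub_le (hΩ : Convex ℝ Ω) (hf : TubeAP Ω f)
    (hω : LinearIndepOn ℚ ω I) (hspec : spec Ω f ⊆ Submodule.span ℚ (ω '' I))
    (hKΩ : K ⊆ Ω) (hK : IsCompact K) {ε : ℝ} (hε : 0 < ε) :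
    ∀ᶠ j in atTop, ∀ y ∈ K, ∀ x, ‖bfSum I ω 1 j (slice f y) x - slice f y x‖ ≤ ε := by
  obtain ⟨δ, hδ, hu⟩ := hf.uniformContinuity hKΩ hK (show 0 < ε / 3 by positivity)
  refine hK.induction_on (p := fun A => ∀ᶠ j in atTop, ∀ y ∈ A, ∀ x,
    ‖bfSum I ω 1 j (slice f y) x - slice f y x‖ ≤ ε) (by simp)
    (fun A B hAB h => h.mono fun j hj y hy => hj y (hAB hy)) ?_ ?_
  · intro A B hA hB
    filter_upwards [hA, hB] with j h1 h2 y hy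
    exact hy.elim (h1 y) (h2 y)
  · intro y₀ hy₀
    have hap := fun y (hy : y ∈ K) => hf.bohrAP_slice (hKΩ hy)
    refine ⟨Metric.ball y₀ δ ∩ K, Filter.inter_mem
      (mem_nhdsWithin_of_mem_nhds (Metric.ball_mem_nhds _ hδ)) self_mem_nhdsWithin, ?_⟩
    filter_upwards [eventually_norm_bfSum_sub_le hω (hap y₀ hy₀) (fun lam hlam =>
      hspec ((hf.bohr_ne_zero_iff hΩ (hKΩ hy₀) lam).2 hlam)) (show 0 < ε / 3 by positivity)]
      with j hj y hy x
    have hyd : ‖y - y₀‖ < δ := by simpa [dist_eq_norm] using hy.1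
    have hd : ∀ x, ‖slice f y x - slice f y₀ x‖ ≤ ε / 3 := fun x =>
      hu y hy.2 y₀ hy₀ x x (by simpa using hδ) hyd
    have h1 := norm_bfSum_le (χ := 1) (j := j) hω ((hap y hy.2).sub (hap y₀ hy₀)) hd x
    rw [bfSum_sub (hap y hy.2) (hap y₀ hy₀)] at h1
    have h2 := hj x
    have h3 := hd x
    rw [norm_sub_rev] at h3
    have h4 := norm_sub_le_norm_sub_add_norm_sub (bfSum I ω 1 j (slice f y) x)
      (bfSum I ω 1 j (slice f y₀) x) (slice f y x)
    have h5 := norm_sub_le_norm_sub_add_norm_sub (bfSum I ω 1 j (slice f y₀) x)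
      (slice f y₀ x) (slice f y x)
    linarith

/-- The perturbed Bochner-Fejér sums form a Cauchy sequence uniformly in the character, and any two
bases have the same limits. -/
lemma TubeAP.exists_norm_bfSum_slice_sub_le (hΩ : Convex ℝ Ω) (hf : TubeAP Ω f)
    (hω : LinearIndepOn ℚ ω I) (hω' : LinearIndepOn ℚ ω' I')
    (hspan : Submodule.span ℚ (ω' '' I') = Submodule.span ℚ (ω '' I))
    (hspec : spec Ω f ⊆ Submodule.span ℚ (ω '' I))
    (hKΩ : K ⊆ Ω) (hK : IsCompact K) {ε : ℝ} (hε : 0 < ε) :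
    ∃ N, ∀ j ≥ N, ∀ k ≥ N, ∀ (χ : AddChar (Fin n → ℝ) Circle), ∀ y ∈ K, ∀ x,
      ‖bfSum I ω χ j (slice f y) x - bfSum I' ω' χ k (slice f y) x‖ ≤ ε := by
  have h1 := hf.eventually_norm_bfSum_slice_sub_le hΩ hω hspec hKΩ hK (half_pos hε)
  have h2 := hf.eventually_norm_bfSum_slice_sub_le hΩ hω' (hspan ▸ hspec) hKΩ hK (half_pos hε)
  obtain ⟨N, hN⟩ := eventually_atTop.1 (h1.and h2)
  refine ⟨N, fun j hj k hk χ y hy => norm_bfSum_sub_bfSum_le hω hspan fun x => ?_⟩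
  have h3 := (hN j hj).1 y hy x
  have h4 := (hN k hk).2 y hy x
  rw [norm_sub_rev] at h4
  have h5 := norm_sub_le_norm_sub_add_norm_sub (bfSum I ω 1 j (slice f y) x) (slice f y x)
    (bfSum I' ω' 1 k (slice f y) x)
  linarith

/-- The perturbed Bochner-Fejér sums as functions on the tube. -/
def bfTube (I : Set ℕ) (ω : ℕ → Fin n → ℝ) (χ : AddChar (Fin n → ℝ) Circle) (j : ℕ)
    (f : (Fin n → ℂ) → ℂ) (z : Fin n → ℂ) : ℂ :=
  bfSum I ω χ j (slice f (imPart z)) fun k => (z k).re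

/-- The perturbation of `f` by the character `χ`, computed with the family `ω`. -/
def pert (I : Set ℕ) (ω : ℕ → Fin n → ℝ) (χ : AddChar (Fin n → ℝ) Circle)
    (f : (Fin n → ℂ) → ℂ) (z : Fin n → ℂ) : ℂ :=
  limUnder atTop fun j => bfTube I ω χ j f z

lemma bfTube_cpoint (j : ℕ) (x y : Fin n → ℝ) :
    bfTube I ω χ j f (cpoint x y) = bfSum I ω χ j (slice f y) x := by
  rw [bfTube, imPart_cpoint]
  congr 1
  ext k; simp [cpoint]

lemma TubeAP.bfTube_eq (hΩ : Convex ℝ Ω) (hf : TubeAP Ω f) (j : ℕ) {z : Fin n → ℂ}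
    (hz : z ∈ tube Ω) :
    bfTube I ω χ j f z = ∑ v ∈ tuples I j, (weight I j v : ℂ) * (χ (freq I ω j v) : ℂ) *
      bohr Ω f (freq I ω j v) * Complex.exp (Complex.I * pairing z (freq I ω j v)) := by
  rw [bfTube, bfSum]
  refine Finset.sum_congr rfl fun v _ => ?_
  conv_rhs => rw [← cpoint_re_im z]
  rw [mul_assoc _ (bohr _ _ _), hf.bohr_mul_exp hΩ hz, mul_assoc]

lemma TubeAP.differentiableOn_bfTube (hΩ : Convex ℝ Ω) (hf : TubeAP Ω f) (j : ℕ) :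
    DifferentiableOn ℂ (bfTube I ω χ j f) (tube Ω) := by
  have hd : DifferentiableOn ℂ (fun z : Fin n → ℂ => ∑ v ∈ tuples I j,
      (weight I j v : ℂ) * (χ (freq I ω j v) : ℂ) * bohr Ω f (freq I ω j v) *
        Complex.exp (Complex.I * pairing z (freq I ω j v))) (tube Ω) := by
    unfold pairing; fun_prop
  exact hd.congr fun z hz => hf.bfTube_eq hΩ j hz

lemma TubeAP.exists_norm_bfTube_sub_le (hΩ : Convex ℝ Ω) (hf : TubeAP Ω f)
    (hω : LinearIndepOn ℚ ω I) (hω' : LinearIndepOn ℚ ω' I')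
    (hspan : Submodule.span ℚ (ω' '' I') = Submodule.span ℚ (ω '' I))
    (hspec : spec Ω f ⊆ Submodule.span ℚ (ω '' I))
    (hKΩ : K ⊆ Ω) (hK : IsCompact K) {ε : ℝ} (hε : 0 < ε) :
    ∃ N, ∀ j ≥ N, ∀ k ≥ N, ∀ (χ : AddChar (Fin n → ℝ) Circle), ∀ z ∈ tube K,
      ‖bfTube I ω χ j f z - bfTube I' ω' χ k f z‖ ≤ ε := by
  obtain ⟨N, hN⟩ := hf.exists_norm_bfSum_slice_sub_le hΩ hω hω' hspan hspec hKΩ hK hε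
  exact ⟨N, fun j hj k hk χ z hz => hN j hj k hk χ _ hz _⟩

lemma TubeAP.tendsto_bfTube (hΩ : Convex ℝ Ω) (hf : TubeAP Ω f) (hω : LinearIndepOn ℚ ω I)
    (hspec : spec Ω f ⊆ Submodule.span ℚ (ω '' I)) {z : Fin n → ℂ} (hz : z ∈ tube Ω) :
    Tendsto (fun j => bfTube I ω χ j f z) atTop (𝓝 (pert I ω χ f z)) := by
  refine CauchySeq.tendsto_limUnder (Metric.cauchySeq_iff.2 fun ε hε => ?_)
  obtain ⟨N, hN⟩ := hf.exists_norm_bfTube_sub_le (K := {imPart z}) hΩ hω hω rfl hspec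
    (Set.singleton_subset_iff.2 hz) isCompact_singleton (half_pos hε)
  refine ⟨N, fun j hj k hk => ?_⟩
  rw [dist_eq_norm]
  linarith [hN j hj k hk χ z rfl]

lemma TubeAP.exists_norm_bfTube_sub_pert_le (hΩ : Convex ℝ Ω) (hf : TubeAP Ω f)
    (hω : LinearIndepOn ℚ ω I) (hω' : LinearIndepOn ℚ ω' I')
    (hspan : Submodule.span ℚ (ω' '' I') = Submodule.span ℚ (ω '' I))
    (hspec : spec Ω f ⊆ Submodule.span ℚ (ω '' I))
    (hKΩ : K ⊆ Ω) (hK : IsCompact K) {ε : ℝ} (hε : 0 < ε) :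
    ∃ N, ∀ k ≥ N, ∀ (χ : AddChar (Fin n → ℝ) Circle), ∀ z ∈ tube K,
      ‖bfTube I' ω' χ k f z - pert I ω χ f z‖ ≤ ε := by
  obtain ⟨N, hN⟩ := hf.exists_norm_bfTube_sub_le hΩ hω hω' hspan hspec hKΩ hK hε
  refine ⟨N, fun k hk χ z hz => ?_⟩
  rw [norm_sub_rev]
  refine le_of_tendsto ((hf.tendsto_bfTube hΩ hω hspec (hKΩ hz)).sub_const _).norm ?_
  filter_upwards [eventually_ge_atTop N] with j hj
  exact hN j hj k hk χ z hz

lemma TubeAP.differentiableOn_pert (hΩ : Convex ℝ Ω) (hΩo : IsOpen Ω) (hf : TubeAP Ω f)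
    (hω : LinearIndepOn ℚ ω I) (hspec : spec Ω f ⊆ Submodule.span ℚ (ω '' I)) :
    DifferentiableOn ℂ (pert I ω χ f) (tube Ω) := by
  refine differentiableOn_of_tendstoUniformlyOn_nhds (isOpen_tube hΩo)
    (f := fun j => bfTube I ω χ j f) (fun j => hf.differentiableOn_bfTube hΩ j) fun z hz => ?_
  obtain ⟨r, hr, hball⟩ := Metric.isOpen_iff.1 hΩo _ hz
  have hsub : Metric.closedBall (imPart z) (r / 2) ⊆ Ω :=
    (Metric.closedBall_subset_ball (half_lt_self hr)).trans hball
  refine ⟨tube (Metric.closedBall (imPart z) (r / 2)), continuous_imPart.continuousAt.preimage_mem_nhds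
    (Metric.closedBall_mem_nhds _ (half_pos hr)), Metric.tendstoUniformlyOn_iff.2 fun ε hε => ?_⟩
  obtain ⟨N, hN⟩ := hf.exists_norm_bfTube_sub_pert_le hΩ hω hω rfl hspec hsub
    (isCompact_closedBall _ _) (half_pos hε)
  filter_upwards [eventually_ge_atTop N] with j hj w hw
  rw [dist_comm, dist_eq_norm]
  linarith [hN j hj χ w hw]

/-- Almost periods of `f` remain almost periods of its perturbation, with the same error. -/
lemma TubeAP.norm_pert_translate_sub_le (hΩ : Convex ℝ Ω) (hf : TubeAP Ω f)
    (hω : LinearIndepOn ℚ ω I) (hspec : spec Ω f ⊆ Submodule.span ℚ (ω '' I))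
    {y τ : Fin n → ℝ} {δ : ℝ} (hy : y ∈ Ω)
    (h : ∀ x, ‖slice f y (x + τ) - slice f y x‖ ≤ δ) (x : Fin n → ℝ) :
    ‖pert I ω χ f (cpoint (x + τ) y) - pert I ω χ f (cpoint x y)‖ ≤ δ := by
  refine le_of_tendsto ((hf.tendsto_bfTube hΩ hω hspec (cpoint_mem_tube.2 hy)).sub
    (hf.tendsto_bfTube hΩ hω hspec (cpoint_mem_tube.2 hy))).norm (Eventually.of_forall fun j => ?_)
  rw [bfTube_cpoint, bfTube_cpoint]
  have := dominated_bfSum (χ := χ) (j := j) hω (hf.bohrAP_slice hy) 0 τ δ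
    (by simpa only [add_zero] using h) x
  simpa only [add_zero, one_mul] using this

/-- The real part of a point is absorbed into the character, which allows every zero to be placed on
`iΩ`. -/
lemma pert_mul_evChar (x y : Fin n → ℝ) :
    pert I ω (χ * evChar x) f (cpoint 0 y) = pert I ω χ f (cpoint x y) := by
  unfold pert
  congr 1
  ext j
  rw [bfTube_cpoint, bfTube_cpoint, bfSum, bfSum]
  refine Finset.sum_congr rfl fun v _ => ?_
  rw [AddChar.mul_apply, Circle.coe_mul, evChar_apply, ex_zero_right]
  ring

end limit

/-! ### Extension and compactness of characters -/

section characters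

/-- The circle is a divisible group. -/
instance circleDivisible : DivisibleBy (Additive Circle) ℤ where
  div a k := Additive.ofMul (Circle.exp (Complex.arg (a.toMul : ℂ) / k))
  div_zero a := by simp
  div_cancel {k} a hk := by
    have hk' : (k : ℝ) ≠ 0 := Int.cast_ne_zero.2 hk
    apply Additive.toMul.injective
    rw [toMul_zsmul, toMul_ofMul, ← Circle.exp_zsmul, zsmul_eq_mul, mul_div_cancel₀ _ hk',
      Circle.exp_arg]

/-- Characters of a subgroup extend to the whole group. -/
lemma exists_addChar_extend {A : Type*} [AddCommGroup A] {G : AddSubgroup A}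
    (χ₀ : AddChar G Circle) : ∃ χ : AddChar A Circle, ∀ g : G, χ g = χ₀ g := by
  -- A divisible abelian group is injective, so homomorphisms into it extend from subgroups.
  obtain ⟨h, hh⟩ := (Module.Baer.of_divisible (Additive Circle)).extension_property_addMonoidHom
    G.subtype Subtype.val_injective χ₀.toAddMonoidHom
  refine ⟨AddChar.toAddMonoidHomEquiv.symm h, fun g => ?_⟩
  exact congrArg Additive.toMul (DFunLike.congr_fun hh g)

/-- The characters of an additive monoid, as a set of functions. -/
def charSet (A : Type*) [AddMonoid A] : Set (A → Circle) :=
  {c | c 0 = 1 ∧ ∀ a b, c (a + b) = c a * c b}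

variable {A : Type*} [AddMonoid A]

/-- The character given by a multiplicative function. -/
def addCharOf (c : charSet A) : AddChar A Circle where
  toFun := c.1
  map_zero_eq_one' := c.2.1
  map_add_eq_mul' := c.2.2

lemma addCharOf_surjective : Function.Surjective (addCharOf (A := A)) := fun χ =>
  ⟨⟨χ, χ.map_zero_eq_one, χ.map_add_eq_mul⟩, rfl⟩

lemma continuous_addCharOf_apply (a : A) : Continuous fun c : charSet A => addCharOf c a :=
  (_root_.continuous_apply a).comp continuous_subtype_val

/-- For the topology of pointwise convergence this makes the characters a closed subset of a product
of circles, which is compact by Tychonoff. -/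
lemma isClosed_charSet : IsClosed (charSet A) := by
  have : charSet A = {c | c 0 = 1} ∩ ⋂ (a : A) (b : A), {c | c (a + b) = c a * c b} := by
    ext c; simp [charSet]
  rw [this]
  exact (isClosed_eq (_root_.continuous_apply _) continuous_const).inter <|
    isClosed_iInter fun a => isClosed_iInter fun b =>
      isClosed_eq (_root_.continuous_apply _)
        ((_root_.continuous_apply a).mul (_root_.continuous_apply b))

instance : CompactSpace (charSet A) := isCompact_iff_compactSpace.1 isClosed_charSet.isCompact

end characters

/-! ### Existence of a basis indexed by natural numbers -/

section basis

variable {n m : ℕ} {Ω : Set (Fin n → ℝ)} {F : (Fin n → ℂ) → (Fin m → ℂ)}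

lemma qModule_eq_span : qModule Ω F = Submodule.span ℚ (specUnion Ω F) := by
  refine le_antisymm (Submodule.span_le.2 ?_) (Submodule.span_mono AddSubgroup.subset_closure)
  exact (AddSubgroup.closure_le (Submodule.span ℚ (specUnion Ω F)).toAddSubgroup).2
    Submodule.subset_span

lemma spec_subset_specUnion (l : Fin m) : spec Ω (fun z => F z l) ⊆ specUnion Ω F :=
  Set.subset_iUnion (fun l => spec Ω fun z => F z l) l

lemma spec_subset_qModule (l : Fin m) : spec Ω (fun z => F z l) ⊆ qModule Ω F :=
  (spec_subset_specUnion l).trans (qModule_eq_span (Ω := Ω) (F := F) ▸ Submodule.subset_span)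

lemma TubeAP.countable_spec {f : (Fin n → ℂ) → ℂ} (hΩ : Convex ℝ Ω) (hΩn : Ω.Nonempty)
    (hf : TubeAP Ω f) : (spec Ω f).Countable := by
  obtain ⟨y, hy⟩ := hΩn
  exact (countable_coef_ne_zero (hf.bohrAP_slice hy)).mono fun lam hlam =>
    (hf.bohr_ne_zero_iff hΩ hy lam).1 hlam

/-- The spectrum is countable by Bessel's inequality. A basis extracted from it is injected into `ℕ`
by `e`, and `ω` is the inverse of `e`. -/
lemma IsHAP.exists_isQBasis (hΩ : Convex ℝ Ω) (hΩn : Ω.Nonempty) (hF : IsHAP Ω F) :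
    ∃ (I : Set ℕ) (ω : ℕ → Fin n → ℝ), IsQBasis Ω F I ω := by
  have hc : (specUnion Ω F).Countable := Set.countable_iUnion fun l =>
    (hF.tubeAP l).countable_spec hΩ hΩn
  obtain ⟨b, hb, hspan, hli⟩ := exists_linearIndependent ℚ (specUnion Ω F)
  obtain ⟨e, he⟩ := Set.countable_iff_exists_injOn.1 (hc.mono hb)
  have hinv : Set.LeftInvOn (Function.invFunOn e b) e b := he.leftInvOn_invFunOn
  have himg : Function.invFunOn e b '' (e '' b) = b := hinv.image_image
  have hinj : Set.InjOn (Function.invFunOn e b) (e '' b) := by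
    rintro _ ⟨x, hx, rfl⟩ _ ⟨x', hx', rfl⟩ h
    rw [hinv hx, hinv hx'] at h
    rw [h]
  refine ⟨e '' b, Function.invFunOn e b, ?_, by rw [himg, hspan, qModule_eq_span]⟩
  rw [linearIndepOn_iff_image hinj, himg]
  exact hli

end basis

/-! ### Perturbed mappings and the amoeba -/

section perturb

variable {n m : ℕ} {Ω : Set (Fin n → ℝ)} {F : (Fin n → ℂ) → (Fin m → ℂ)} {I I' : Set ℕ}
  {ω ω' : ℕ → Fin n → ℝ} {𝔾 : AddSubgroup (Fin n → ℝ)} {χ : AddChar (Fin n → ℝ) Circle}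
  {χ₀ : AddChar 𝔾 Circle}

lemma IsQBasis.spec_subset (hI : IsQBasis Ω F I ω) (l : Fin m) :
    spec Ω (fun z => F z l) ⊆ Submodule.span ℚ (ω '' I) :=
  hI.2 ▸ spec_subset_qModule l

lemma IsHAP.perturbedSum_eq (hΩ : Convex ℝ Ω) (hF : IsHAP Ω F) (hI : IsQBasis Ω F I ω)
    (h𝔾 : specUnion Ω F ⊆ 𝔾) (hχ : ∀ g : 𝔾, χ g = χ₀ g) (j : ℕ) {z : Fin n → ℂ}
    (hz : z ∈ tube Ω) (l : Fin m) :
    perturbedSum Ω F χ₀ I ω j z l = bfTube I ω χ j (fun z => F z l) z := by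
  have := (hF.tubeAP l).expPerturb_bochnerFejer hΩ hI.1 ((spec_subset_specUnion l).trans h𝔾) hχ j
    hz fun k => (z k).re
  rwa [cpoint_re_im] at this

lemma IsHAP.tendstoTube_perturbedSum (hΩ : Convex ℝ Ω) (hF : IsHAP Ω F) (hI : IsQBasis Ω F I ω)
    (hI' : IsQBasis Ω F I' ω') (h𝔾 : specUnion Ω F ⊆ 𝔾) (hχ : ∀ g : 𝔾, χ g = χ₀ g) :
    TendstoTube Ω (perturbedSum Ω F χ₀ I' ω') fun z l => pert I ω χ (fun z => F z l) z := by
  intro K hK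
  refine Metric.tendstoUniformlyOn_iff.2 fun ε hε => ?_
  have h : ∀ l, ∀ᶠ k in atTop, ∀ z ∈ tube (closure K),
      ‖bfTube I' ω' χ k (fun z => F z l) z - pert I ω χ (fun z => F z l) z‖ ≤ ε / 2 := fun l => by
    obtain ⟨N, hN⟩ := (hF.tubeAP l).exists_norm_bfTube_sub_pert_le hΩ hI.1 hI'.1
      (hI'.2.trans hI.2.symm) (hI.spec_subset l) hK.2 hK.1 (half_pos hε)
    filter_upwards [eventually_ge_atTop N] with k hk using hN k hk χ
  filter_upwards [eventually_all.2 h] with k hk z hz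
  rw [dist_comm, dist_eq_norm]
  refine ((pi_norm_le_iff_of_nonneg (half_pos hε).le).2 fun l => ?_).trans_lt (half_lt_self hε)
  have hz' : z ∈ tube (closure K) := subset_closure hz
  rw [Pi.sub_apply, hF.perturbedSum_eq hΩ hI' h𝔾 hχ k (hK.2 hz')]
  exact hk l z hz'

/-- The basis behind the choice in `perturb` is unknown, but limits for all bases agree pointwise; a
one-point base suffices for the comparison. -/
lemma IsHAP.perturb_eq (hΩ : Convex ℝ Ω) (hF : IsHAP Ω F) (hI : IsQBasis Ω F I ω)
    (h𝔾 : specUnion Ω F ⊆ 𝔾) (hχ : ∀ g : 𝔾, χ g = χ₀ g) {z : Fin n → ℂ} (hz : z ∈ tube Ω) :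
    perturb Ω F χ₀ z = fun l => pert I ω χ (fun z => F z l) z := by
  obtain ⟨I', ω', hI', hlim⟩ := Classical.epsilon_spec
    (p := fun G : (Fin n → ℂ) → (Fin m → ℂ) => ∃ (I : Set ℕ) (ω : ℕ → Fin n → ℝ),
      IsQBasis Ω F I ω ∧ TendstoTube Ω (perturbedSum Ω F χ₀ I ω) G)
    ⟨_, I, ω, hI, hF.tendstoTube_perturbedSum hΩ hI hI h𝔾 hχ⟩
  have hy : RelCompactIn {imPart z} Ω :=
    HAP.IsCompact.relCompactIn isCompact_singleton (Set.singleton_subset_iff.2 hz)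
  have hz' : z ∈ tube {imPart z} := rfl
  exact tendsto_nhds_unique ((hlim _ hy).tendsto_at hz')
    ((hF.tendstoTube_perturbedSum hΩ hI hI' h𝔾 hχ _ hy).tendsto_at hz')

lemma IsHAP.perturb (hΩo : IsOpen Ω) (hΩ : Convex ℝ Ω) (hF : IsHAP Ω F)
    (hI : IsQBasis Ω F I ω) (h𝔾 : specUnion Ω F ⊆ 𝔾) (hχ : ∀ g : 𝔾, χ g = χ₀ g) :
    IsHAP Ω (HAP.perturb Ω F χ₀) := by
  have heq : ∀ z ∈ tube Ω, HAP.perturb Ω F χ₀ z = fun l => pert I ω χ (fun z => F z l) z :=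
    fun z hz => hF.perturb_eq hΩ hI h𝔾 hχ hz
  refine ⟨?_, fun ε hε K hK => ?_⟩
  · exact DifferentiableOn.congr (differentiableOn_pi.2 fun l =>
      (hF.tubeAP l).differentiableOn_pert hΩ hΩo hI.1 (hI.spec_subset l)) heq
  · obtain ⟨t, ht, h⟩ := hF.almostPeriodic (ε / 2) (half_pos hε) K hK
    refine ⟨t, ht, fun ξ => ?_⟩
    obtain ⟨τ, hτ, hper⟩ := h ξ
    refine ⟨τ, hτ, fun z hz => ?_⟩
    have hy : imPart z ∈ Ω := hK.2 (subset_closure hz)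
    set x : Fin n → ℝ := fun k => (z k).re with hx
    have hzx : cpoint x (imPart z) = z := cpoint_re_im z
    rw [← hzx, ← cpoint_add, heq _ (cpoint_mem_tube.2 hy), heq _ (cpoint_mem_tube.2 hy)]
    refine ((pi_norm_le_iff_of_nonneg (half_pos hε).le).2 fun l => ?_).trans_lt (half_lt_self hε)
    refine (hF.tubeAP l).norm_pert_translate_sub_le hΩ hI.1 (hI.spec_subset l) hy
      (fun u => ?_) x
    have := hper (cpoint u (imPart z)) (cpoint_mem_tube.2 hz)
    rw [← cpoint_add] at this
    exact (norm_le_pi_norm (F (cpoint (u + τ) (imPart z)) - F (cpoint u (imPart z))) l).trans this.le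

lemma mulI_eq_cpoint (y : Fin n → ℝ) : mulI y = cpoint 0 y := by
  ext k; simp [mulI, cpoint]

/-- The amoeba consists of the purely imaginary zeros of the perturbations by the characters of
`ℝⁿ`. -/
lemma IsHAP.mem_yAmoeba_iff (hΩ : Convex ℝ Ω) (hF : IsHAP Ω F) (hI : IsQBasis Ω F I ω)
    (h𝔾 : specUnion Ω F ⊆ 𝔾) {y : Fin n → ℝ} :
    y ∈ yAmoeba Ω F 𝔾 ↔ y ∈ Ω ∧
      ∃ χ : AddChar (Fin n → ℝ) Circle, ∀ l, pert I ω χ (fun z => F z l) (mulI y) = 0 := by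
  simp only [yAmoeba, Set.mem_iUnion, Set.mem_image]
  constructor
  · rintro ⟨χ₀, z, ⟨hz, hz0⟩, rfl⟩
    obtain ⟨χ, hχ⟩ := exists_addChar_extend χ₀
    refine ⟨hz, χ * evChar fun k => (z k).re, fun l => ?_⟩
    rw [mulI_eq_cpoint, pert_mul_evChar, cpoint_re_im]
    rw [hF.perturb_eq hΩ hI h𝔾 hχ hz] at hz0
    exact congrFun hz0 l
  · rintro ⟨hy, χ, hχ⟩
    have hyt : mulI y ∈ tube Ω := by rw [mulI_eq_cpoint]; exact cpoint_mem_tube.2 hy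
    refine ⟨χ.compAddMonoidHom 𝔾.subtype, mulI y, ⟨hyt, ?_⟩, by rw [mulI_eq_cpoint, imPart_cpoint]⟩
    rw [hF.perturb_eq (χ := χ) hΩ hI h𝔾 (fun _ => rfl) hyt]
    exact funext hχ

/-- Each Bochner-Fejér sum involves finitely many values of `χ`, so it is continuous in `(χ, y)`;
convergence is uniform in `χ` and locally uniform in `y`. -/
lemma TubeAP.continuous_pert {f : (Fin n → ℂ) → ℂ} (hΩ : Convex ℝ Ω) (hΩo : IsOpen Ω)
    (hf : TubeAP Ω f) (hω : LinearIndepOn ℚ ω I) (hspec : spec Ω f ⊆ Submodule.span ℚ (ω '' I)) :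
    Continuous fun p : charSet (Fin n → ℝ) × Ω => pert I ω (addCharOf p.1) f (mulI p.2) := by
  have hmem : ∀ y : Ω, mulI (y : Fin n → ℝ) ∈ tube Ω := fun y => by
    rw [mulI_eq_cpoint]; exact cpoint_mem_tube.2 y.2
  have hcont : ∀ j, Continuous fun p : charSet (Fin n → ℝ) × Ω =>
      bfTube I ω (addCharOf p.1) j f (mulI p.2) := fun j => by
    simp only [hf.bfTube_eq hΩ j (hmem _)]
    refine continuous_finsetSum _ fun v _ => ?_
    have h1 : Continuous fun p : charSet (Fin n → ℝ) × Ω =>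
        (addCharOf p.1 (freq I ω j v) : ℂ) :=
      continuous_subtype_val.comp ((continuous_addCharOf_apply _).comp continuous_fst)
    have h2 : Continuous fun p : charSet (Fin n → ℝ) × Ω =>
        pairing (mulI (p.2 : Fin n → ℝ)) (freq I ω j v) := by
      have h3 : Continuous fun p : charSet (Fin n → ℝ) × Ω => (p.2 : Fin n → ℝ) :=
        continuous_subtype_val.comp continuous_snd
      refine continuous_finsetSum _ fun k _ => (continuous_const.mul ?_).mul continuous_const
      exact Complex.continuous_ofReal.comp ((_root_.continuous_apply k).comp h3)
    fun_prop
  refine continuous_of_locally_uniform_approx_of_continuousAt fun p u hu => ?_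
  obtain ⟨ε, hε, hu⟩ := Metric.mem_uniformity_dist.1 hu
  obtain ⟨r, hr, hball⟩ := Metric.isOpen_iff.1 hΩo _ p.2.2
  have hsub : Metric.closedBall (p.2 : Fin n → ℝ) (r / 2) ⊆ Ω :=
    (Metric.closedBall_subset_ball (half_lt_self hr)).trans hball
  obtain ⟨N, hN⟩ := hf.exists_norm_bfTube_sub_pert_le hΩ hω hω rfl hspec hsub
    (isCompact_closedBall _ _) (half_pos hε)
  refine ⟨(fun q => (q.2 : Fin n → ℝ)) ⁻¹' Metric.closedBall (p.2 : Fin n → ℝ) (r / 2),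
    (continuous_subtype_val.comp continuous_snd).continuousAt.preimage_mem_nhds
      (Metric.closedBall_mem_nhds _ (half_pos hr)), _, (hcont N).continuousAt, fun q hq => hu ?_⟩
  have hq' : mulI (q.2 : Fin n → ℝ) ∈ tube (Metric.closedBall (p.2 : Fin n → ℝ) (r / 2)) := by
    rw [mulI_eq_cpoint]; exact cpoint_mem_tube.2 hq
  rw [dist_comm, dist_eq_norm]
  linarith [hN N le_rfl (addCharOf q.1) _ hq']

/-- The amoeba is the projection to `Ω` of a closed subset of the product of the compact character
space with `Ω`. -/
lemma IsHAP.isClosed_yAmoeba (hΩ : Convex ℝ Ω) (hΩo : IsOpen Ω) (hF : IsHAP Ω F)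
    (hI : IsQBasis Ω F I ω) (h𝔾 : specUnion Ω F ⊆ 𝔾) :
    IsClosed {y : Ω | (y : Fin n → ℝ) ∈ yAmoeba Ω F 𝔾} := by
  have hcl : IsClosed {p : charSet (Fin n → ℝ) × Ω |
      ∀ l, pert I ω (addCharOf p.1) (fun z => F z l) (mulI p.2) = 0} := by
    simp only [Set.ofPred_forall]
    exact isClosed_iInter fun l => isClosed_eq
      ((hF.tubeAP l).continuous_pert hΩ hΩo hI.1 (hI.spec_subset l)) continuous_const
  convert isClosedMap_snd_of_compactSpace _ hcl using 1
  ext y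
  simp only [Set.mem_ofPred_eq, hF.mem_yAmoeba_iff hΩ hI h𝔾, Set.mem_image, Prod.exists,
    exists_eq_right, addCharOf_surjective.exists, y.2, true_and]

end perturb

end HAP

end

/-! ### The theorem -/

theorem theorem4p1 {n m : ℕ} (Ω : Set (Fin n → ℝ)) (hΩo : IsOpen Ω) (hΩc : Convex ℝ Ω)
    (hΩn : Ω.Nonempty) (F : (Fin n → ℂ) → (Fin m → ℂ)) (hF : HAP.IsHAP Ω F)
    (𝔾 : AddSubgroup (Fin n → ℝ)) (h𝔾 : HAP.specUnion Ω F ⊆ (𝔾 : Set (Fin n → ℝ))) :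
    -- the perturbed mappings are well defined
    (∃ (I : Set ℕ) (ω : ℕ → Fin n → ℝ), HAP.IsQBasis Ω F I ω) ∧
    (∀ χ : AddChar 𝔾 Circle, HAP.IsHAP Ω (HAP.perturb Ω F χ) ∧
      ∀ (I : Set ℕ) (ω : ℕ → Fin n → ℝ), HAP.IsQBasis Ω F I ω →
        HAP.TendstoTube Ω (HAP.perturbedSum Ω F χ I ω) (HAP.perturb Ω F χ)) ∧
    -- the amoeba is a closed subset of the base
    HAP.yAmoeba Ω F 𝔾 ⊆ Ω ∧
    IsClosed {y : Ω | (y : Fin n → ℝ) ∈ HAP.yAmoeba Ω F 𝔾} ∧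
    -- the description by purely imaginary zeros, with the characters of the whole of `ℝⁿ`
    HAP.mulI '' HAP.yAmoeba Ω F 𝔾 =
      (HAP.mulI '' Ω) ∩
        ⋃ χ : AddChar (⊤ : AddSubgroup (Fin n → ℝ)) Circle,
          HAP.zeroSet Ω (HAP.perturb Ω F χ) := by
  obtain ⟨I, ω, hI⟩ := hF.exists_isQBasis hΩc hΩn
  have htop : HAP.specUnion Ω F ⊆ ((⊤ : AddSubgroup (Fin n → ℝ)) : Set (Fin n → ℝ)) :=
    Set.subset_univ _
  have hmem := fun y => hF.mem_yAmoeba_iff hΩc hI h𝔾 (y := y)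
  refine ⟨⟨I, ω, hI⟩, fun χ₀ => ?_, fun y hy => ((hmem y).1 hy).1,
    hF.isClosed_yAmoeba hΩc hΩo hI h𝔾, ?_⟩
  -- All computations use a character of `ℝⁿ`; on the spectrum it agrees with the given character of
  -- `𝔾`.
  · obtain ⟨χ, hχ⟩ := HAP.exists_addChar_extend χ₀
    refine ⟨hF.perturb hΩo hΩc hI h𝔾 hχ, fun I' ω' hI' K hK => ?_⟩
    exact (hF.tendstoTube_perturbedSum hΩc hI hI' h𝔾 hχ K hK).congr_right fun z hz =>
      (hF.perturb_eq hΩc hI h𝔾 hχ (hK.2 (subset_closure hz))).symm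
  · ext z
    simp only [Set.mem_image, Set.mem_inter_iff, Set.mem_iUnion]
    constructor
    · rintro ⟨y, hy, rfl⟩
      -- The criterion of `IsHAP.mem_yAmoeba_iff` does not involve `𝔾`, so the same character gives
      -- a zero for the full group.
      obtain ⟨hyΩ, χ, hχ⟩ := (hmem y).1 hy
      have hyt : HAP.mulI y ∈ HAP.tube Ω := by
        rw [HAP.mulI_eq_cpoint]; exact HAP.cpoint_mem_tube.2 hyΩ
      refine ⟨⟨y, hyΩ, rfl⟩, χ.compAddMonoidHom (⊤ : AddSubgroup (Fin n → ℝ)).subtype, hyt, ?_⟩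
      rw [hF.perturb_eq (χ := χ) hΩc hI htop (fun _ => rfl) hyt]
      exact funext hχ
    · rintro ⟨⟨y, hyΩ, rfl⟩, χ₀, hyt, h0⟩
      obtain ⟨χ, hχ⟩ := HAP.exists_addChar_extend χ₀
      refine ⟨y, (hmem y).2 ⟨hyΩ, χ, fun l => ?_⟩, rfl⟩
      rw [hF.perturb_eq hΩc hI htop hχ hyt] at h0
      exact congrFun h0 l
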